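/- Conventions. Let $S^1=\Delta^1/\partial\Delta^1$ and $\Sigma T=S^1\wedge T$ for a pointed simplicial set $T$. A (Bousfield–Friedlander) spectrum $X$ is a sequence of pointed simplicial sets $X_n$ ($n\ge 0$) with bonding maps $\Sigma X_n\to X_{n+1}$; maps of spectra are levelwise pointed maps commuting with the bonding maps, and finite products are formed levelwise. With respect to the stable model structure, $X$ is cofibrant if and only if all bonding maps $\Sigma X_n\to X_{n+1}$ are monomorphisms, and $X$ is fibrant if and only if every $X_n$ is a Kan complex and $X$ is an $\Omega$-spectrum, i.e. all adjoint maps $X_n\to\Omega X_{n+1}$ are weak equivalences (bijective on $\pi_0$ and on all homotopy groups at all vertices). For a simplicial abelian group $G$ let $BG=\operatorname{diag}B_\bullet(*,G,*)$, the simplicial abelian group with $(BG)_k=(G_k)^k$. For an abelian group $A$, let $HA$ be the spectrum with levels $(HA)_n=B^nA$ (iterating $B$ on the constant simplicial abelian group $A$) and bonding maps $S^1\wedge B^nA\to B^{n+1}A$ given in simplicial degree $k$ by the inclusion $\bigvee_{i=1}^k(B^nA)_k\to\prod_{i=1}^k(B^nA)_k$. Let $\mathrm{sh}^mX$ be the shifted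 spectrum with $(\mathrm{sh}^mX)_n=X_{m+n}$. Theorem. 1. For every abelian group $A$, the spectrum $HA$ is fibrant and cofibrant, and it is an abelian group object in the category of spectra, with addition map $HA\times HA\to HA$ given in each level and simplicial degree by the addition of the abelian group $(B^nA)_k$ (in level $0$: by the addition of $A$). It is an Eilenberg–MacLane spectrum: for every $n$ the level $(HA)_n$ is an Eilenberg–MacLane space $K(A,n)$, and the identifications $\pi_n((HA)_n)\cong A$ can be chosen so that the addition map of $HA$ induces the addition of $A$. If moreover $A$ is an $\mathbb F_p$-vector space for a prime $p$, then $HA$, with this addition, is an $\mathbb F_p$-vector space object in the category of spectra, the scalars acting on level $0$ by the scalar multiplication of $A$. 2. For every abelian group $A$ and $m\ge 0$, the shift $\mathrm{sh}^mHA$ is an $\Omega$-spectrum, fibrant and cofibrant, its $n$-th level is a $K(A,m+n)$ for every $n$, and it is an abelian group object under the addition of the groups $(B^{m+n}A)_k$. 3. For all abelian groups $A_1,\dots,A_r$ and integers $m_1,\dots,m_r\ge 0$ ($r\ge 0$), the product $\prod_{i=1}^r\mathrm{sh}^{m_i}HA_i$ in the category of spectra is fibrant and cofibrant, and it is an abelian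 group object for which every projection to a factor is additive. -/

import Mathlib

open CategoryTheory MonoidalCategory CartesianMonoidalCategory Simplicial Opposite Limits MonObj

universe u

/-! ### Pointed simplicial sets -/

/-- A pointed simplicial set: a simplicial set with a chosen vertex. -/
structure PSSet : Type (u + 1) where
  /-- the underlying simplicial set -/
  sset : SSet.{u}
  /-- the base vertex -/
  pt : sset _⦋0⦌

namespace PSSet

/-- The basepoint in simplicial degree `k`: the degeneracy of the base vertex. -/
def base (X : PSSet.{u}) (k : SimplexCategoryᵒᵖ) : X.sset.obj k :=
  X.sset.map (k.unop.const ⦋0⦌ 0).op X.pt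

lemma map_base (X : PSSet.{u}) {k l : SimplexCategoryᵒᵖ} (f : k ⟶ l) :
    X.sset.map f (X.base k) = X.base l := by
  unfold base
  rw [← CategoryTheory.comp_apply, ← Functor.map_comp]
  rfl

lemma base_zero (X : PSSet.{u}) : X.base (op ⦋0⦌) = X.pt := by
  have h : (SimplexCategory.const ⦋0⦌ ⦋0⦌ 0) = 𝟙 _ := by
    ext i : 3; exact Subsingleton.elim (α := Fin 1) _ _
  change X.sset.map (SimplexCategory.const ⦋0⦌ ⦋0⦌ 0).op X.pt = X.pt
  rw [h]
  simp

lemma base_const (X : PSSet.{u}) {k : SimplexCategoryᵒᵖ} (f : op ⦋0⦌ ⟶ k) :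
    X.sset.map f X.pt = X.base k := by
  rw [← X.base_zero, X.map_base]

/-- Pointed maps of pointed simplicial sets. -/
@[ext]
structure Hom (X Y : PSSet.{u}) : Type u where
  /-- the underlying simplicial map -/
  map : X.sset ⟶ Y.sset
  map_pt : map.app _ X.pt = Y.pt

instance : Category PSSet.{u} where
  Hom := Hom
  id X := ⟨𝟙 X.sset, rfl⟩
  comp f g := ⟨f.map ≫ g.map, by
    change g.map.app _ (f.map.app _ _) = _
    rw [f.map_pt, g.map_pt]⟩

@[ext]
lemma hom_ext {X Y : PSSet.{u}} {f g : X ⟶ Y} (h : f.map = g.map) : f = g := Hom.ext h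

@[simp] lemma id_map (X : PSSet.{u}) : Hom.map (𝟙 X) = 𝟙 X.sset := rfl

@[simp] lemma comp_map {X Y Z : PSSet.{u}} (f : X ⟶ Y) (g : Y ⟶ Z) :
    (f ≫ g).map = f.map ≫ g.map := rfl

lemma Hom.map_base {X Y : PSSet.{u}} (f : X ⟶ Y) (k : SimplexCategoryᵒᵖ) :
    f.map.app k (X.base k) = Y.base k := by
  unfold base
  rw [NatTrans.naturality_apply, f.map_pt]

lemma Hom.map_naturality {X Y : PSSet.{u}} (f : X ⟶ Y) {k l : SimplexCategoryᵒᵖ} (a : k ⟶ l)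
    (x : X.sset.obj k) : f.map.app l (X.sset.map a x) = Y.sset.map a (f.map.app k x) :=
  NatTrans.naturality_apply f.map a x

/-- The product of pointed simplicial sets. -/
def prod (X Y : PSSet.{u}) : PSSet.{u} := ⟨X.sset ⊗ Y.sset, (X.pt, Y.pt)⟩

/-- The first projection. -/
def prodFst (X Y : PSSet.{u}) : prod X Y ⟶ X := ⟨fst _ _, rfl⟩

/-- The second projection. -/
def prodSnd (X Y : PSSet.{u}) : prod X Y ⟶ Y := ⟨snd _ _, rfl⟩

/-- The map into a product with given components. -/
def prodLift {T X Y : PSSet.{u}} (f : T ⟶ X) (g : T ⟶ Y) : T ⟶ prod X Y :=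
  ⟨lift f.map g.map, Prod.ext f.map_pt g.map_pt⟩

@[simp] lemma prodLift_fst {T X Y : PSSet.{u}} (f : T ⟶ X) (g : T ⟶ Y) :
    prodLift f g ≫ prodFst X Y = f := rfl

@[simp] lemma prodLift_snd {T X Y : PSSet.{u}} (f : T ⟶ X) (g : T ⟶ Y) :
    prodLift f g ≫ prodSnd X Y = g := rfl

lemma prod_hom_ext {T X Y : PSSet.{u}} {f g : T ⟶ prod X Y}
    (h₁ : f ≫ prodFst X Y = g ≫ prodFst X Y) (h₂ : f ≫ prodSnd X Y = g ≫ prodSnd X Y) :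
    f = g :=
  PSSet.hom_ext (CartesianMonoidalCategory.hom_ext _ _
    (congrArg Hom.map h₁) (congrArg Hom.map h₂))

/-- Collapsing a subcomplex: two simplices are identified when they are equal or both lie
in the subcomplex. -/
def collapseRel {X : SSet.{u}} (A : X.Subcomplex) (k : SimplexCategoryᵒᵖ) (x y : X.obj k) : Prop :=
  x = y ∨ (x ∈ A.obj k ∧ y ∈ A.obj k)

/-- The quotient `X / A` of a simplicial set by a subcomplex `A` containing the vertex `a`, pointed
by the image of `a`. -/
def collapse (X : SSet.{u}) (A : X.Subcomplex) (a : X _⦋0⦌) (_ha : a ∈ A.obj _) : PSSet.{u} where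
  sset :=
    { obj k := Quot (collapseRel A k)
      map {k l} f := ↾(Quot.map (X.map f) (by
        rintro x y (rfl | ⟨hx, hy⟩)
        · exact Or.inl rfl
        · exact Or.inr ⟨A.map f hx, A.map f hy⟩))
      map_id k := by ext ⟨x⟩; exact congrArg (Quot.mk _) (by simp)
      map_comp f g := by ext ⟨x⟩; exact congrArg (Quot.mk _) (by simp) }
  pt := Quot.mk _ a

/-- The simplicial circle `S¹ = Δ¹ / ∂Δ¹`. -/
def circle : PSSet.{u} :=
  collapse Δ[1] ∂Δ[1] (SSet.stdSimplex.objMk (m := op ⦋0⦌) ⟨fun _ => (0 : Fin 2), fun _ _ _ => le_rfl⟩)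
    (by
      intro h
      obtain ⟨i, hi⟩ := h (1 : Fin 2)
      exact absurd hi (by change ¬ ((0 : Fin 2) = 1); decide))

/-- The wedge `X ∨ Y = X × {*} ∪ {*} × Y` as a subcomplex of `X × Y`. -/
def wedge (X Y : PSSet.{u}) : (X.sset ⊗ Y.sset).Subcomplex where
  obj k := { z | z.1 = X.base k ∨ z.2 = Y.base k }
  map {k l} f z hz := by
    rcases hz with hz | hz
    · exact Or.inl ((congrArg (X.sset.map f) hz).trans (X.map_base f))
    · exact Or.inr ((congrArg (Y.sset.map f) hz).trans (Y.map_base f))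

/-- The smash product `X ∧ Y = (X × Y) / (X ∨ Y)`. -/
def smash (X Y : PSSet.{u}) : PSSet.{u} :=
  collapse (X.sset ⊗ Y.sset) (wedge X Y) (X.pt, Y.pt) (Or.inl X.base_zero.symm)

/-- The class `s ∧ x` of a pair of simplices. -/
def smashMk {X Y : PSSet.{u}} {k : SimplexCategoryᵒᵖ} (x : X.sset.obj k) (y : Y.sset.obj k) :
    (smash X Y).sset.obj k :=
  Quot.mk _ (x, y)

/-- The reduced suspension functor `Σ T = S¹ ∧ T`. -/
def susp : PSSet.{u} ⥤ PSSet.{u} where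
  obj T := smash circle T
  map {T U} f :=
    { map :=
        { app k := ↾(Quot.map (fun z => (z.1, f.map.app k z.2)) (by
            rintro x y (rfl | ⟨hx, hy⟩)
            · exact Or.inl rfl
            · refine Or.inr ⟨hx.imp_right fun h => ?_, hy.imp_right fun h => ?_⟩
              · exact (congrArg (f.map.app k) h).trans (f.map_base k)
              · exact (congrArg (f.map.app k) h).trans (f.map_base k)))
          naturality k l a := by
            ext ⟨z⟩
            exact congrArg (Quot.mk _) (Prod.ext rfl (f.map_naturality a z.2)) }
      map_pt := congrArg (Quot.mk _) (Prod.ext rfl f.map_pt) }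
  map_id T := by
    ext k ⟨z⟩
    rfl
  map_comp f g := by
    ext k ⟨z⟩
    rfl

/-- The pointed function complex `Map_*(T, Y)`, whose `k`-simplices are the simplicial maps
`T × Δᵏ → Y` sending `{*} × Δᵏ` to the basepoint. -/
def funComplex (T Y : PSSet.{u}) : PSSet.{u} where
  sset :=
    { obj k := { f : T.sset ⊗ SSet.stdSimplex.obj k.unop ⟶ Y.sset //
        ∀ (m : SimplexCategoryᵒᵖ) (s : (SSet.stdSimplex.obj k.unop).obj m),
          f.app m (T.base m, s) = Y.base m }
      map {k l} a := ↾fun f => ⟨T.sset ◁ SSet.stdSimplex.map a.unop ≫ f.1, fun m s => f.2 m _⟩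
      map_id k := by
        ext f : 3
        refine Subtype.ext ?_
        refine (congrArg (fun h => T.sset ◁ h ≫ f.1) (SSet.stdSimplex.map_id k.unop)).trans ?_
        rw [MonoidalCategory.whiskerLeft_id, Category.id_comp]
        rfl
      map_comp a b := by
        ext f : 3
        refine Subtype.ext ?_
        refine (congrArg (fun h => T.sset ◁ h ≫ f.1) (SSet.stdSimplex.map_comp b.unop a.unop)).trans ?_
        exact (congrArg (· ≫ f.1) (MonoidalCategory.whiskerLeft_comp _ _ _)).trans
          (Category.assoc _ _ _) }
  pt := ⟨SSet.const Y.pt, fun _ _ => rfl⟩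

/-- The loop space `Ω Y = Map_*(S¹, Y)`. -/
def loop (Y : PSSet.{u}) : PSSet.{u} := funComplex circle Y

/-- The adjoint `T → Ω Y` of a pointed map `σ : Σ T → Y`: the simplex `x` goes to
`(s, a) ↦ σ (s ∧ a^* x)`. -/
def adjoint {T Y : PSSet.{u}} (σ : susp.obj T ⟶ Y) : T ⟶ loop Y where
  map :=
    { app k := ↾fun x =>
        ⟨{ app m := ↾fun z =>
            σ.map.app m (smashMk z.1 (T.sset.map (SSet.stdSimplex.objEquiv z.2).op x))
           naturality m n a := by
            ext z
            refine Eq.trans ?_ (σ.map_naturality a _)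
            refine congrArg (σ.map.app n) (congrArg (Quot.mk _) (Prod.ext rfl ?_))
            change _ = T.sset.map a (T.sset.map _ x)
            rw [← Functor.map_comp_apply]
            rfl },
          fun m s => by
            refine Eq.trans (congrArg (σ.map.app m) ?_) (σ.map_base m)
            exact Quot.sound (Or.inr ⟨Or.inl rfl, Or.inl rfl⟩)⟩
      naturality k l a := by
        ext x
        apply Subtype.ext
        ext m z
        refine congrArg (σ.map.app m) (congrArg (Quot.mk _) (Prod.ext rfl ?_))
        change T.sset.map _ (T.sset.map a x) = T.sset.map _ x
        rw [← Functor.map_comp_apply]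
        rfl }
  map_pt := by
    apply Subtype.ext
    ext m z
    refine Eq.trans (congrArg (σ.map.app m) ?_) (σ.map_base m)
    exact Quot.sound (Or.inr ⟨Or.inr (T.base_const _), Or.inr rfl⟩)

/-! ### Homotopy groups and weak equivalences of Kan complexes -/

/-- The `n`-th homotopy group of a (Kan) simplicial set at a vertex `x`, as a set: `n`-simplices
with boundary at `x`, where `f ∼ g` when some `(n+1)`-simplex has `n`-th face `f`, `(n+1)`-st face
`g`, and all the other faces constant at `x`. -/
def piSet (n : ℕ) (X : SSet.{u}) (x : X _⦋0⦌) : Type u :=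
  Quot (fun f g : X.PtSimplex n x => Nonempty (f.RelStruct g (Fin.last n)))

/-- The image of an `n`-simplex with constant boundary under a simplicial map. -/
def ptSimplexMap {X Y : SSet.{u}} (φ : X ⟶ Y) {n : ℕ} {x : X _⦋0⦌} {y : Y _⦋0⦌}
    (h : φ.app _ x = y) (f : X.PtSimplex n x) : Y.PtSimplex n y :=
  f.comp (SSet.RelativeMorphism.ofSimplex₀ φ x y h) rfl

/-- The map induced on homotopy groups. -/
def piMap {X Y : SSet.{u}} (φ : X ⟶ Y) (n : ℕ) {x : X _⦋0⦌} {y : Y _⦋0⦌} (h : φ.app _ x = y) :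
    piSet n X x → piSet n Y y :=
  Quot.map (ptSimplexMap φ h) (by
    rintro f g ⟨r⟩
    have hc : ∀ {Z : SSet.{u}}, (SSet.const x : Z ⟶ X) ≫ φ = SSet.const y := by
      subst h
      intro Z
      simp
    refine ⟨⟨r.map ≫ φ, ?_, ?_, ?_, ?_⟩⟩
    · rw [r.δ_castSucc_map_assoc]; rfl
    · rw [r.δ_succ_map_assoc]; rfl
    · intro j hj
      rw [r.δ_map_of_lt_assoc j hj, hc]
    · intro j hj
      rw [r.δ_map_of_gt_assoc j hj, hc])

/-- A map of Kan complexes is a weak equivalence when it induces a bijection on connected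
components and on all homotopy groups at all vertices. -/
def IsWeakEquiv {X Y : SSet.{u}} (φ : X ⟶ Y) : Prop :=
  Function.Bijective (SSet.mapπ₀ φ) ∧
    ∀ (n : ℕ) (x : X _⦋0⦌), Function.Bijective (piMap φ (n + 1) (x := x) rfl)

end PSSet

/-! ### Bousfield--Friedlander spectra of simplicial sets -/

/-- A Bousfield--Friedlander spectrum: pointed simplicial sets `X₀, X₁, …` with bonding maps
`Σ Xₙ → Xₙ₊₁`. -/
structure BFSpectrum : Type (u + 1) where
  /-- the levels -/
  level : ℕ → PSSet.{u}
  /-- the bonding maps -/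
  bond (n : ℕ) : PSSet.susp.obj (level n) ⟶ level (n + 1)

namespace BFSpectrum

/-- Maps of spectra: levelwise pointed maps commuting with the bonding maps. -/
@[ext]
structure Hom (X Y : BFSpectrum.{u}) : Type u where
  /-- the levels of the map -/
  map (n : ℕ) : X.level n ⟶ Y.level n
  comm (n : ℕ) : X.bond n ≫ map (n + 1) = PSSet.susp.map (map n) ≫ Y.bond n

instance : Category BFSpectrum.{u} where
  Hom := Hom
  id X := ⟨fun n => 𝟙 _, fun n => by simp⟩
  comp f g := ⟨fun n => f.map n ≫ g.map n, fun n => by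
    rw [Functor.map_comp, Category.assoc, ← g.comm, ← Category.assoc, f.comm, Category.assoc]⟩

@[ext]
lemma hom_ext {X Y : BFSpectrum.{u}} {f g : X ⟶ Y} (h : ∀ n, f.map n = g.map n) : f = g :=
  Hom.ext (funext h)

@[simp] lemma id_map (X : BFSpectrum.{u}) (n : ℕ) : Hom.map (𝟙 X) n = 𝟙 (X.level n) := rfl

@[simp] lemma comp_map {X Y Z : BFSpectrum.{u}} (f : X ⟶ Y) (g : Y ⟶ Z) (n : ℕ) :
    (f ≫ g).map n = f.map n ≫ g.map n := rfl

/-- The value of a map of spectra on a `k`-simplex of the `n`-th level. -/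
def Hom.eval {X Y : BFSpectrum.{u}} (f : X ⟶ Y) {n : ℕ} {k : SimplexCategoryᵒᵖ}
    (x : (X.level n).sset.obj k) : (Y.level n).sset.obj k :=
  (f.map n).map.app k x

/-- Cofibrant spectra of the stable model structure: the bonding maps are cofibrations of
simplicial sets, that is monomorphisms. -/
def Cofibrant (X : BFSpectrum.{u}) : Prop :=
  ∀ n, Mono (X.bond n).map

/-- Levelwise fibrant spectra. -/
def LevelFibrant (X : BFSpectrum.{u}) : Prop :=
  ∀ n, SSet.KanComplex (X.level n).sset

/-- The (levelwise fibrant) spectrum `X` is an `Ω`-spectrum: the adjoint bonding maps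
`Xₙ → Ω Xₙ₊₁` are weak equivalences. -/
def IsOmega (X : BFSpectrum.{u}) : Prop :=
  ∀ n, PSSet.IsWeakEquiv (PSSet.adjoint (X.bond n)).map

/-- Fibrant spectra of the stable model structure: the levelwise fibrant `Ω`-spectra. -/
def Fibrant (X : BFSpectrum.{u}) : Prop :=
  X.LevelFibrant ∧ X.IsOmega

/-- The `m`-fold shift `shᵐ X`, with `(shᵐ X)ₙ = Xₘ₊ₙ`. -/
def shift (m : ℕ) (X : BFSpectrum.{u}) : BFSpectrum.{u} where
  level n := X.level (m + n)
  bond n := X.bond (m + n)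

/-! Finite products of spectra, formed levelwise. -/

/-- The one-point spectrum. -/
def point : BFSpectrum.{u} where
  level _ := ⟨(Functor.const _).obj PUnit, PUnit.unit⟩
  bond _ := ⟨{ app _ := ↾fun _ => PUnit.unit }, rfl⟩

/-- The product of two spectra. -/
def prod (X Y : BFSpectrum.{u}) : BFSpectrum.{u} where
  level n := PSSet.prod (X.level n) (Y.level n)
  bond n := PSSet.prodLift (PSSet.susp.map (PSSet.prodFst _ _) ≫ X.bond n)
    (PSSet.susp.map (PSSet.prodSnd _ _) ≫ Y.bond n)

/-- The first projection. -/
def prodFst (X Y : BFSpectrum.{u}) : prod X Y ⟶ X where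
  map _ := PSSet.prodFst _ _
  comm _ := PSSet.prodLift_fst _ _

/-- The second projection. -/
def prodSnd (X Y : BFSpectrum.{u}) : prod X Y ⟶ Y where
  map _ := PSSet.prodSnd _ _
  comm _ := PSSet.prodLift_snd _ _

/-- The map into a product with given components. -/
def prodLift {T X Y : BFSpectrum.{u}} (f : T ⟶ X) (g : T ⟶ Y) : T ⟶ prod X Y where
  map n := PSSet.prodLift (f.map n) (g.map n)
  comm n := by
    apply PSSet.prod_hom_ext
    · dsimp only [prod]
      rw [Category.assoc, Category.assoc, PSSet.prodLift_fst, PSSet.prodLift_fst, f.comm,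
        ← Category.assoc, ← Functor.map_comp, PSSet.prodLift_fst]
    · dsimp only [prod]
      rw [Category.assoc, Category.assoc, PSSet.prodLift_snd, PSSet.prodLift_snd, g.comm,
        ← Category.assoc, ← Functor.map_comp, PSSet.prodLift_snd]

/-- Spectra with their levelwise finite products. -/
instance : CartesianMonoidalCategory BFSpectrum.{u} :=
  .ofChosenFiniteProducts
    ⟨asEmptyCone point, IsTerminal.ofUniqueHom
      (fun X => ⟨fun n => ⟨{ app _ := ↾fun _ => PUnit.unit }, rfl⟩, fun n => rfl⟩)
      (fun X f => rfl)⟩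
    (fun X Y => ⟨BinaryFan.mk (prodFst X Y) (prodSnd X Y), BinaryFan.isLimitMk
      (fun s => prodLift s.fst s.snd)
      (fun s => hom_ext fun n => PSSet.prodLift_fst _ _)
      (fun s => hom_ext fun n => PSSet.prodLift_snd _ _)
      (fun s m h₁ h₂ => hom_ext fun n => PSSet.prod_hom_ext
        (congrArg (fun f => Hom.map f n) h₁) (congrArg (fun f => Hom.map f n) h₂))⟩)

instance : BraidedCategory BFSpectrum.{u} := .ofCartesianMonoidalCategory

end BFSpectrum

/-! ### The bar construction and Eilenberg--MacLane spectra -/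

/-- For `x = (x₁, …, x_k)` in an abelian group and `f : [m] → [k]`, the tuple whose `j`-th entry is
the sum of the `xᵢ` with `f (j - 1) < i ≤ f j`. This is the simplicial structure of the bar
construction `B_•(*, M, *)`: inner faces add neighbours, outer faces drop an entry, degeneracies
insert `0`. -/
def barMap {M : Type u} [AddCommGroup M] {m k : ℕ} (f : Fin (m + 1) →o Fin (k + 1)) :
    (Fin k → M) →+ (Fin m → M) where
  toFun x j := ∑ i : Fin k, if f j.castSucc ≤ i.castSucc ∧ i.succ ≤ f j.succ then x i else 0
  map_zero' := by ext j; simp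
  map_add' x y := by
    ext j
    simp only [Pi.add_apply, ← Finset.sum_add_distrib]
    refine Finset.sum_congr rfl fun i _ => ?_
    split_ifs <;> simp

lemma barMap_id {M : Type u} [AddCommGroup M] {k : ℕ} (x : Fin k → M) :
    barMap (OrderHom.id : Fin (k + 1) →o Fin (k + 1)) x = x := by
  ext j
  change (∑ i : Fin k, if j.castSucc ≤ i.castSucc ∧ i.succ ≤ j.succ then x i else 0) = x j
  have h (i : Fin k) : (j.castSucc ≤ i.castSucc ∧ i.succ ≤ j.succ) ↔ j = i := by
    simp only [Fin.le_def, Fin.ext_iff, Fin.val_castSucc, Fin.val_succ]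
    omega
  simp only [h]
  simp

lemma barMap_comp {M : Type u} [AddCommGroup M] {l m k : ℕ} (g : Fin (l + 1) →o Fin (m + 1))
    (f : Fin (m + 1) →o Fin (k + 1)) (x : Fin k → M) :
    barMap (f.comp g) x = barMap g (barMap f x) := by
  have key (b c : Fin (m + 1)) (hbc : b ≤ c) (i : Fin k) :
      (if f b ≤ i.castSucc ∧ i.succ ≤ f c then x i else 0) =
        ∑ j : Fin m, if b ≤ j.castSucc ∧ j.succ ≤ c then
          (if f j.castSucc ≤ i.castSucc ∧ i.succ ≤ f j.succ then x i else 0) else 0 := by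
    induction c using Fin.induction with
    | zero =>
      obtain rfl : b = 0 := Fin.le_zero_iff.mp hbc
      rw [if_neg (by rintro ⟨h₁, h₂⟩; exact absurd (h₂.trans h₁) (by simp))]
      symm
      refine Finset.sum_eq_zero fun j _ => if_neg ?_
      rintro ⟨_, h⟩
      exact absurd h (by simp)
    | succ c ih =>
      rcases hbc.eq_or_lt with rfl | hlt
      · rw [if_neg (by rintro ⟨h₁, h₂⟩; exact absurd (h₂.trans h₁) (by simp))]
        symm
        refine Finset.sum_eq_zero fun j _ => if_neg ?_
        rintro ⟨h₁, h₂⟩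
        exact absurd (h₂.trans h₁) (by simp)
      · have hbc' : b ≤ c.castSucc := Fin.le_castSucc_iff.mpr hlt
        have hsplit (j : Fin m) : (if b ≤ j.castSucc ∧ j.succ ≤ c.succ then
            (if f j.castSucc ≤ i.castSucc ∧ i.succ ≤ f j.succ then x i else 0) else 0) =
            (if b ≤ j.castSucc ∧ j.succ ≤ c.castSucc then
              (if f j.castSucc ≤ i.castSucc ∧ i.succ ≤ f j.succ then x i else 0) else 0) +
            (if j = c then
              (if f j.castSucc ≤ i.castSucc ∧ i.succ ≤ f j.succ then x i else 0) else 0) := by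
          by_cases hj : j = c
          · subst hj
            have hn : ¬ (b ≤ j.castSucc ∧ j.succ ≤ j.castSucc) := by simp [Fin.le_def]
            rw [if_pos ⟨hbc', le_rfl⟩, if_pos rfl, if_neg hn, zero_add]
          · have hiff : j.succ ≤ c.succ ↔ j.succ ≤ c.castSucc := by
              have : (j : ℕ) ≠ c := fun h => hj (Fin.ext h)
              simp only [Fin.le_def, Fin.val_castSucc, Fin.val_succ]
              omega
            rw [if_neg hj, add_zero]
            simp only [hiff]
        simp only [hsplit]
        rw [Finset.sum_add_distrib, ← ih hbc', Finset.sum_ite_eq' Finset.univ c, if_pos (Finset.mem_univ _)]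
        have h₁ : f b ≤ f c.castSucc := f.monotone hbc'
        have h₂ : f c.castSucc ≤ f c.succ := f.monotone (Fin.castSucc_lt_succ).le
        by_cases h : i.succ ≤ f c.castSucc
        · have h' : ¬ f c.castSucc ≤ i.castSucc := fun hh =>
            absurd (h.trans hh) (by simp [Fin.le_def])
          simp [h, h', h.trans h₂]
        · have h' : f c.castSucc ≤ i.castSucc := by
            simp only [Fin.le_def, Fin.val_castSucc, Fin.val_succ] at h ⊢
            omega
          simp [h, h', h₁.trans h']
  ext j
  change (∑ i : Fin k, if f (g j.castSucc) ≤ i.castSucc ∧ i.succ ≤ f (g j.succ) then x i else 0) =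
    ∑ a : Fin m, if g j.castSucc ≤ a.castSucc ∧ a.succ ≤ g j.succ then
      (∑ i : Fin k, if f a.castSucc ≤ i.castSucc ∧ i.succ ≤ f a.succ then x i else 0) else 0
  simp only [fun i => key _ _ (g.monotone (Fin.castSucc_lt_succ (i := j)).le) i]
  rw [Finset.sum_comm]
  refine Finset.sum_congr rfl fun a _ => ?_
  split_ifs
  · rfl
  · simp

lemma barMap_natural {M N : Type u} [AddCommGroup M] [AddCommGroup N] (φ : M →+ N) {m k : ℕ}
    (f : Fin (m + 1) →o Fin (k + 1)) (x : Fin k → M) :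
    barMap f (φ ∘ x) = φ ∘ barMap f x := by
  ext j
  change (∑ i : Fin k, if f j.castSucc ≤ i.castSucc ∧ i.succ ≤ f j.succ then φ (x i) else 0) =
    φ (∑ i : Fin k, if f j.castSucc ≤ i.castSucc ∧ i.succ ≤ f j.succ then x i else 0)
  rw [map_sum]
  refine Finset.sum_congr rfl fun i _ => ?_
  split_ifs <;> simp

/-- The classifying space `B G = diag B_•(*, G, *)` of a simplicial abelian group, as a simplicial
abelian group: `(B G)_k = (G_k)ᵏ` with entrywise addition, and simplicial operators the composite of
those of `G` with those of the bar construction. -/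
def bar (G : SimplicialObject AddCommGrpCat.{u}) : SimplicialObject AddCommGrpCat.{u} where
  obj k := AddCommGrpCat.of (Fin k.unop.len → G.obj k)
  map {k l} a := AddCommGrpCat.ofHom
    ((barMap a.unop.toOrderHom).comp ((G.map a).hom.compLeft (Fin k.unop.len)))
  map_id k := by
    refine AddCommGrpCat.hom_ext (AddMonoidHom.ext fun x => ?_)
    refine (barMap_id (M := G.obj k) _).trans ?_
    ext j
    change G.map (𝟙 k) (x j) = x j
    simp
  map_comp {k l m} a b := by
    refine AddCommGrpCat.hom_ext (AddMonoidHom.ext fun x => ?_)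
    change barMap (a.unop.toOrderHom.comp b.unop.toOrderHom) (G.map (a ≫ b) ∘ x) =
      barMap b.unop.toOrderHom (G.map b ∘ barMap a.unop.toOrderHom (G.map a ∘ x))
    rw [barMap_comp, ← barMap_natural (G.map b).hom]
    refine congrArg _ (congrArg _ ?_)
    ext j
    change G.map (a ≫ b) (x j) = G.map b (G.map a (x j))
    simp

/-- The iterated bar construction `Bⁿ A`, starting from the constant simplicial abelian group. -/
def iterBar (A : Type u) [AddCommGroup A] (n : ℕ) : SimplicialObject AddCommGrpCat.{u} :=
  Nat.rec ((Functor.const _).obj (AddCommGrpCat.of A)) (fun _ G => bar G) n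

/-- The simplicial set underlying a simplicial abelian group, pointed at `0`. -/
def underlying (G : SimplicialObject AddCommGrpCat.{u}) : PSSet.{u} where
  sset := G ⋙ forget AddCommGrpCat
  pt := (0 : G.obj (op ⦋0⦌))

/-- A `k`-simplex of `S¹` is the class of a monotone map `α : [k] → [1]`; if `α` is not constant it
has a unique jump `α (i - 1) ≠ α i`. This is the inclusion of the `i`-th wedge summand
`⋁_{i=1}^k M → ∏_{i=1}^k M`: the tuple with `x` at the jump of `α`, and `0` elsewhere (everywhere,
if `α` is constant). -/
def circleTuple {M : Type u} [AddCommGroup M] {k : SimplexCategoryᵒᵖ}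
    (s : PSSet.circle.{u}.sset.obj k) (x : M) : Fin k.unop.len → M :=
  Quot.lift
    (fun (α : (Δ[1] : SSet.{u}).obj k) (j : Fin k.unop.len) =>
      if (SSet.stdSimplex.objEquiv α).toOrderHom j.castSucc =
        (SSet.stdSimplex.objEquiv α).toOrderHom j.succ then 0 else x)
    (by
      have h0 (α : (Δ[1] : SSet.{u}).obj k) (hα : α ∈ (∂Δ[1] : (Δ[1] : SSet.{u}).Subcomplex).obj k)
          (a b : Fin (k.unop.len + 1)) : (SSet.stdSimplex.objEquiv α).toOrderHom a =
            (SSet.stdSimplex.objEquiv α).toOrderHom b := by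
        by_contra hab
        refine hα fun c => ?_
        change ∃ a, (SSet.stdSimplex.objEquiv α).toOrderHom a = c
        generalize (SSet.stdSimplex.objEquiv α).toOrderHom = F at *
        change Fin _ →o Fin 2 at F
        change Fin 2 at c
        by_cases h : F a = c
        · exact ⟨a, h⟩
        · refine ⟨b, ?_⟩
          change ¬ ((F a : Fin 2) = F b) at hab
          revert h hab
          generalize F a = p
          generalize F b = q
          revert p q c
          decide
      rintro α β (rfl | ⟨hα, hβ⟩)
      · rfl
      · ext j
        rw [if_pos (h0 α hα _ _), if_pos (h0 β hβ _ _)])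
    s

lemma circleTuple_mk {M : Type u} [AddCommGroup M] {k : SimplexCategoryᵒᵖ}
    (α : (Δ[1] : SSet.{u}).obj k) (x : M) :
    circleTuple (Quot.mk _ α) x =
      barMap (SSet.stdSimplex.objEquiv α).toOrderHom (fun _ : Fin 1 => x) := by
  ext j
  change (if (SSet.stdSimplex.objEquiv α).toOrderHom j.castSucc =
    (SSet.stdSimplex.objEquiv α).toOrderHom j.succ then 0 else x) =
    ∑ i : Fin 1, if (SSet.stdSimplex.objEquiv α).toOrderHom j.castSucc ≤ i.castSucc ∧
      i.succ ≤ (SSet.stdSimplex.objEquiv α).toOrderHom j.succ then x else 0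
  have hm := (SSet.stdSimplex.objEquiv α).toOrderHom.monotone (Fin.castSucc_lt_succ (i := j)).le
  revert hm
  generalize (SSet.stdSimplex.objEquiv α).toOrderHom j.castSucc = p
  generalize (SSet.stdSimplex.objEquiv α).toOrderHom j.succ = q
  change Fin 2 at p q
  intro hm
  have h2 : ∀ p q : Fin 2, p ≤ q → ((p = q) ↔ ¬ (p ≤ (0 : Fin 1).castSucc ∧ (0 : Fin 1).succ ≤ q)) := by
    decide
  rw [Fin.sum_univ_one]
  by_cases h : p = q
  · rw [if_pos h, if_neg ((h2 p q hm).mp h)]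
  · rw [if_neg h, if_pos (not_not.mp (mt (h2 p q hm).mpr h))]

lemma circleTuple_zero {M : Type u} [AddCommGroup M] {k : SimplexCategoryᵒᵖ}
    (s : PSSet.circle.{u}.sset.obj k) : circleTuple s (0 : M) = 0 := by
  obtain ⟨α⟩ := s
  rw [circleTuple_mk]
  exact map_zero _

lemma circleTuple_map {M N : Type u} [AddCommGroup M] [AddCommGroup N] (φ : M →+ N)
    {k l : SimplexCategoryᵒᵖ} (a : k ⟶ l) (s : PSSet.circle.{u}.sset.obj k) (x : M) :
    circleTuple (PSSet.circle.sset.map a s) (φ x) =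
      barMap a.unop.toOrderHom (φ ∘ circleTuple s x) := by
  obtain ⟨α⟩ := s
  rw [circleTuple_mk, ← barMap_natural]
  change circleTuple (Quot.mk _ ((Δ[1] : SSet.{u}).map a α)) (φ x) = _
  rw [circleTuple_mk]
  exact barMap_comp _ _ _

lemma circleTuple_base {M : Type u} [AddCommGroup M] (k : SimplexCategoryᵒᵖ) (x : M) :
    circleTuple (PSSet.circle.{u}.base k) x = 0 := by
  refine (circleTuple_map (AddMonoidHom.id M) _ PSSet.circle.pt x).trans ?_
  rw [show (AddMonoidHom.id M) ∘ circleTuple PSSet.circle.{u}.pt x = 0 from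
    funext fun i : Fin 0 => i.elim0]
  exact map_zero _

/-- The natural map `Σ G = S¹ ∧ G → B G`, in degree `k` the inclusion
`⋁_{i=1}^k G_k → ∏_{i=1}^k G_k`. -/
def barBond (G : SimplicialObject AddCommGrpCat.{u}) :
    PSSet.susp.obj (underlying G) ⟶ underlying (bar G) where
  map :=
    { app k := ↾(Quot.lift
        (fun z : PSSet.circle.{u}.sset.obj k × G.obj k =>
          (circleTuple z.1 z.2 : Fin k.unop.len → G.obj k))
        (by
          have h0 (z : PSSet.circle.{u}.sset.obj k × G.obj k)
              (hz : z.1 = PSSet.circle.base k ∨ z.2 = (underlying G).base k) :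
              (circleTuple z.1 z.2 : Fin k.unop.len → G.obj k) = 0 := by
            rcases hz with hz | hz
            · rw [hz, circleTuple_base]
            · rw [show z.2 = 0 from hz.trans (map_zero (G.map _).hom), circleTuple_zero]
          rintro z w (rfl | ⟨hz, hw⟩)
          · rfl
          · exact (h0 z hz).trans (h0 w hw).symm))
      naturality k l a := by
        ext ⟨z⟩
        exact circleTuple_map (G.map a).hom a z.1 z.2 }
  map_pt := circleTuple_zero (M := G.obj (op ⦋0⦌)) PSSet.circle.pt

/-- The Eilenberg--MacLane spectrum `HA`, with levels `(HA)ₙ = Bⁿ A`. -/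
def HA (A : Type u) [AddCommGroup A] : BFSpectrum.{u} where
  level n := underlying (iterBar A n)
  bond n := barBond (iterBar A n)

/-- The `m`-fold shift `shᵐ HA`. -/
def shiftHA (A : Type u) [AddCommGroup A] (m : ℕ) : BFSpectrum.{u} :=
  (HA A).shift m

/-- The simplices of `HA` in each level and degree form abelian groups. -/
instance (A : Type u) [AddCommGroup A] (n : ℕ) (k : SimplexCategoryᵒᵖ) :
    AddCommGroup (((HA A).level n).sset.obj k) :=
  inferInstanceAs (AddCommGroup ((iterBar A n).obj k))

instance (A : Type u) [AddCommGroup A] (m n : ℕ) (k : SimplexCategoryᵒᵖ) :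
    AddCommGroup (((shiftHA A m).level n).sset.obj k) :=
  inferInstanceAs (AddCommGroup ((iterBar A (m + n)).obj k))

/-- The structure of an Eilenberg--MacLane space `K(A, n)` on a pointed Kan complex: a bijection of
the `n`-th homotopy group with `A`, turning the product of homotopy classes into addition when
`n ≥ 1`, and the vanishing of all the other homotopy groups. As in the usual definition of the group
structure, `MulStruct f g h i` with `i` the last index exhibits `[h]` as the product of `[f]` and
`[g]` by an `(n+1)`-simplex with last three faces `g`, `h`, `f` and the other faces constant. -/
structure EMStructure (A : Type u) [AddCommGroup A] (n : ℕ) (X : PSSet.{u}) where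
  /-- the identification of the `n`-th homotopy group -/
  equiv : PSSet.piSet n X.sset X.pt ≃ A
  map_mul (f g h : X.sset.PtSimplex n X.pt) (i : Fin n) (hi : (i : ℕ) + 1 = n)
    (r : f.MulStruct g h i) :
    equiv (Quot.mk _ h) = equiv (Quot.mk _ f) + equiv (Quot.mk _ g)
  subsingleton (k : ℕ) (hk : k ≠ n) (x : X.sset _⦋0⦌) : Subsingleton (PSSet.piSet k X.sset x)

/-- The map induced by a map of spectra on the `n`-th homotopy group of the `n`-th level. -/
def BFSpectrum.Hom.piLevel {X Y : BFSpectrum.{u}} (f : X ⟶ Y) (n : ℕ) :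
    PSSet.piSet n (X.level n).sset (X.level n).pt → PSSet.piSet n (Y.level n).sset (Y.level n).pt :=
  PSSet.piMap (f.map n).map n (f.map n).map_pt

/-- An `R`-module structure on a commutative group object `X` of a category with finite products:
an action of `R` by endomorphisms of the group object `X`, such that sums in `R` act by pointwise
sums, products act by composites, and `1` acts as the identity. For `R = 𝔽_p` these are the
`𝔽_p`-vector space objects. -/
structure ModuleObj (R : Type*) [Ring R] {C : Type*} [Category* C] [CartesianMonoidalCategory C]
    [BraidedCategory C] (X : C) [CommGrpObj X] where
  /-- the action -/
  smul : R → (X ⟶ X)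
  isMonHom (r : R) : IsMonHom (smul r)
  add_smul (r s : R) : smul (r + s) = lift (smul r) (smul s) ≫ μ[X]
  mul_smul (r s : R) : smul (r * s) = smul s ≫ smul r
  one_smul : smul 1 = 𝟙 X

/-! ### Simplicial abelian groups: cycles and null cycles -/

/-! In a simplicial abelian group homotopy is algebra. After translation to `0`, an `n`-simplex with
boundary at a vertex is an element of `cycles`, and two such are homotopic exactly when their
difference lies in `null` (`isPt_iff`, `ptRel_iff`). Moore's horn filling, in the form relative to a
levelwise surjection (`exists_filler`), makes the levels Kan complexes and surjections Kan
fibrations.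

The core is that `G ⟶ Ω B G` is bijective on homotopy groups (`isPiIso_loopBar`). The total space
`tot G` is acyclic (`cycles_tot_le_null`), and consecutive differences project it onto `bar G` with
the constant functions, a copy of `G`, as kernel. A simplex of `G` gives a path in `tot G` from `0`
to its constant function, and this path projects to the suspension loop in `bar G`. Conversely a
loop in `bar G` lifts to a path in `tot G` starting at `0`, because paths in `G` starting at `0`
form an acyclic group, and the end of the lift lies in `G`. Paths in `tot G` with the same ends
differ by a loop in `tot G`, which is null because `tot G` is acyclic.

The same short exact sequence has a connecting isomorphism from `π_{n+1} (B G)` to `π_n G`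
(`Connects`, `PiIdent.bar`). Induction from the constant group shows that `Bⁿ A` is a `K(A, n)`,
with addition visible on cycles.

Cofibrancy holds because a nonconstant monotone map to `[1]` is determined by its jump, so a tuple
with one nonzero entry remembers its wedge summand (`circleTuple_inj`). Shifts inherit everything
level by level, and products can be treated on simplices, factor by factor (`IsLevelProd`). Group
objects come from levelwise groups respected by the operators and the bonding maps (`IsAdditive`). A
scalar in `𝔽_p` acts as multiplication by a natural number representing it, since `p` annihilates
every `Bⁿ A`. -/

/-- Simplicial abelian groups. -/
abbrev SAb : Type (u + 1) := SimplicialObject AddCommGrpCat.{u}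

namespace SAb

variable {G H : SAb.{u}} {k l m n : ℕ}

/-- The action of a simplicial operator on a simplicial abelian group. -/
def act (G : SAb.{u}) (a : ⦋m⦌ ⟶ ⦋n⦌) : G.obj (op ⦋n⦌) →+ G.obj (op ⦋m⦌) := (G.map a.op).hom

lemma act_act (a : ⦋l⦌ ⟶ ⦋m⦌) (b : ⦋m⦌ ⟶ ⦋n⦌) (x : G.obj (op ⦋n⦌)) :
    G.act a (G.act b x) = G.act (a ≫ b) x := by
  change G.map a.op (G.map b.op x) = G.map (a ≫ b).op x
  rw [op_comp, G.map_comp]; rfl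

lemma act_id (x : G.obj (op ⦋n⦌)) : G.act (𝟙 _) x = x := by
  change G.map (𝟙 (op ⦋n⦌)) x = x
  simp

/-- The `i`-th face operator. -/
def d (G : SAb.{u}) (i : ℕ) : G.obj (op ⦋n + 1⦌) →+ G.obj (op ⦋n⦌) :=
  G.act (SimplexCategory.δ (Fin.ofNat (n + 2) i))

/-- The `i`-th degeneracy operator. -/
def s (G : SAb.{u}) (i : ℕ) : G.obj (op ⦋n⦌) →+ G.obj (op ⦋n + 1⦌) :=
  G.act (SimplexCategory.σ (Fin.ofNat (n + 1) i))

lemma delta_val (i : ℕ) (hi : i ≤ n + 1) (j : Fin (n + 1)) :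
    ((SimplexCategory.δ (Fin.ofNat (n + 2) i)).toOrderHom j : ℕ) = if (j : ℕ) < i then (j : ℕ) else j + 1 := by
  change ((Fin.succAbove (Fin.ofNat (n + 2) i) j : Fin (n + 2)) : ℕ) = _
  have : i % (n + 2) = i := Nat.mod_eq_of_lt (by omega)
  simp only [Fin.succAbove, Fin.lt_def, Fin.val_castSucc, Fin.ofNat, this]
  split_ifs <;> simp

lemma sigma_val (i : ℕ) (hi : i ≤ n) (j : Fin (n + 2)) :
    ((SimplexCategory.σ (Fin.ofNat (n + 1) i)).toOrderHom j : ℕ) = if (j : ℕ) ≤ i then (j : ℕ) else j - 1 := by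
  change ((Fin.predAbove (Fin.ofNat (n + 1) i) j : Fin (n + 1)) : ℕ) = _
  have : i % (n + 1) = i := Nat.mod_eq_of_lt (by omega)
  simp only [Fin.predAbove, Fin.lt_def, Fin.val_castSucc, Fin.ofNat, this]
  split_ifs <;> first | omega | simp

lemma op_ext {a b : ⦋m⦌ ⟶ ⦋n⦌} (h : ∀ j : Fin (m + 1), (a.toOrderHom j : ℕ) = b.toOrderHom j) : a = b := by
  ext j : 3
  exact Fin.ext (h j)

lemma comp_val (a : ⦋l⦌ ⟶ ⦋m⦌) (b : ⦋m⦌ ⟶ ⦋n⦌) (j : Fin (l + 1)) :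
    (a ≫ b).toOrderHom j = b.toOrderHom (a.toOrderHom j) := rfl

lemma d_d {i j : ℕ} (hij : i < j) (hj : j ≤ n + 2) (x : G.obj (op ⦋n + 2⦌)) :
    G.d i (G.d j x) = G.d (j - 1) (G.d i x) := by
  unfold d
  rw [act_act, act_act]
  congr 2
  refine op_ext fun r => ?_
  rw [comp_val, comp_val, delta_val _ hj, delta_val _ (by omega), delta_val _ (by omega),
    delta_val _ (by omega)]
  split_ifs <;> omega

lemma d_s_of_lt {i j : ℕ} (hij : i < j) (hj : j ≤ n + 1) (x : G.obj (op ⦋n + 1⦌)) :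
    G.d i (G.s j x) = G.s (j - 1) (G.d i x) := by
  unfold d s
  rw [act_act, act_act]
  congr 2
  refine op_ext fun r => ?_
  rw [comp_val, comp_val, delta_val _ (by omega), sigma_val _ (by omega), delta_val _ (by omega),
    sigma_val _ (by omega)]
  split_ifs <;> omega

lemma d_s_self {i : ℕ} (hi : i ≤ n) (x : G.obj (op ⦋n⦌)) : G.d i (G.s i x) = x := by
  unfold d s
  rw [act_act]
  convert act_id x
  refine op_ext fun r => ?_
  rw [comp_val, sigma_val _ (by omega), delta_val _ (by omega)]
  change _ = (r : ℕ)
  split_ifs <;> omega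

lemma d_s_succ {i : ℕ} (hi : i ≤ n) (x : G.obj (op ⦋n⦌)) : G.d (i + 1) (G.s i x) = x := by
  unfold d s
  rw [act_act]
  convert act_id x
  refine op_ext fun r => ?_
  rw [comp_val, sigma_val _ (by omega), delta_val _ (by omega)]
  change _ = (r : ℕ)
  split_ifs <;> omega

lemma d_s_of_gt {i j : ℕ} (hij : j + 1 < i) (hi : i ≤ n + 2) (x : G.obj (op ⦋n + 1⦌)) :
    G.d i (G.s j x) = G.s j (G.d (i - 1) x) := by
  unfold d s
  rw [act_act, act_act]
  congr 2
  refine op_ext fun r => ?_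
  rw [comp_val, comp_val, delta_val _ (by omega), sigma_val _ (by omega), delta_val _ (by omega),
    sigma_val _ (by omega)]
  split_ifs <;> omega

/-- Simplices all of whose proper faces vanish. -/
def cycles (G : SAb.{u}) (n : ℕ) : AddSubgroup (G.obj (op ⦋n⦌)) where
  carrier := { z | ∀ (l : ℕ) (a : ⦋l⦌ ⟶ ⦋n⦌), ¬ Function.Surjective a.toOrderHom → G.act a z = 0 }
  zero_mem' _ _ _ := map_zero _
  add_mem' hx hy l a ha := by rw [map_add, hx l a ha, hy l a ha, add_zero]
  neg_mem' hx l a ha := by rw [map_neg, hx l a ha, neg_zero]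

lemma mem_cycles {z : G.obj (op ⦋n⦌)} : z ∈ G.cycles n ↔
    ∀ (l : ℕ) (a : ⦋l⦌ ⟶ ⦋n⦌), ¬ Function.Surjective a.toOrderHom → G.act a z = 0 := Iff.rfl

lemma d_eq_zero_of_mem_cycles {z : G.obj (op ⦋n + 1⦌)} (hz : z ∈ G.cycles (n + 1)) {i : ℕ}
    (hi : i ≤ n + 1) : G.d i z = 0 := by
  refine hz _ _ fun h => ?_
  obtain ⟨j, hj⟩ := h (⟨i, by omega⟩ : Fin (n + 2))
  have := congrArg Fin.val hj
  rw [delta_val _ hi] at this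
  dsimp at this
  split_ifs at this <;> omega

lemma exists_factor_delta {a : ⦋l⦌ ⟶ ⦋n + 1⦌} (ha : ¬ Function.Surjective a.toOrderHom) :
    ∃ (i : ℕ) (_ : i ≤ n + 1) (b : ⦋l⦌ ⟶ ⦋n⦌), a = b ≫ SimplexCategory.δ (Fin.ofNat (n + 2) i) := by
  obtain ⟨i, b, rfl⟩ := SimplexCategory.eq_comp_δ_of_not_surjective a ha
  exact ⟨i, Nat.lt_succ_iff.mp i.2, b, by simp⟩

lemma mem_cycles_succ {z : G.obj (op ⦋n + 1⦌)} :
    z ∈ G.cycles (n + 1) ↔ ∀ i ≤ n + 1, G.d i z = 0 := by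
  refine ⟨fun h i hi => d_eq_zero_of_mem_cycles h hi, fun h l a ha => ?_⟩
  obtain ⟨i, hi, b, rfl⟩ := exists_factor_delta ha
  rw [← act_act]
  exact (congrArg _ (h i hi)).trans (map_zero _)

lemma mem_cycles_zero (z : G.obj (op ⦋0⦌)) : z ∈ G.cycles 0 := by
  intro l a ha
  exact absurd (fun y => ⟨0, Subsingleton.elim (α := Fin 1) _ _⟩) ha

/-- The composite `δ i ≫ σ j` misses the vertex `i` if `i < j` and `i - 1` if `i > j + 1`, so it
factors through a proper face. -/
lemma d_s_of_mem_cycles {z : G.obj (op ⦋n⦌)} (hz : z ∈ G.cycles n) {i j : ℕ} (hi : i ≤ n + 1)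
    (hj : j ≤ n) (h₁ : i ≠ j) (h₂ : i ≠ j + 1) : G.d i (G.s j z) = 0 := by
  unfold d s
  rw [act_act]
  refine hz _ _ fun h => ?_
  obtain ⟨r, hr⟩ := h (⟨if i < j then i else i - 1, by split_ifs <;> omega⟩ : Fin (n + 1))
  have := congrArg Fin.val hr
  rw [comp_val, sigma_val _ hj, delta_val _ hi] at this
  dsimp at this
  split_ifs at this <;> omega

/-- The simplices which are the `m`-th face of a simplex all of whose other faces vanish. -/
def null (G : SAb.{u}) (m n : ℕ) : AddSubgroup (G.obj (op ⦋n⦌)) where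
  carrier := { z | ∃ y : G.obj (op ⦋n + 1⦌), G.d m y = z ∧ ∀ i ≤ n + 1, i ≠ m → G.d i y = 0 }
  zero_mem' := ⟨0, map_zero _, fun _ _ _ => map_zero _⟩
  add_mem' := by
    rintro _ _ ⟨x, rfl, hx⟩ ⟨y, rfl, hy⟩
    exact ⟨x + y, map_add _ _ _, fun i hi hm => by rw [map_add, hx i hi hm, hy i hi hm, add_zero]⟩
  neg_mem' := by
    rintro _ ⟨x, rfl, hx⟩
    exact ⟨-x, map_neg _ _, fun i hi hm => by rw [map_neg, hx i hi hm, neg_zero]⟩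

lemma null_le_cycles (hm : m ≤ n + 1) : G.null m n ≤ G.cycles n := by
  rintro _ ⟨y, rfl, hy⟩
  obtain _ | n := n
  · exact mem_cycles_zero _
  · rw [mem_cycles_succ]
    intro i hi
    rcases lt_or_ge i m with h | h
    · rw [d_d h hm, hy i (by omega) (by omega), map_zero]
    · have := d_d (G := G) (i := m) (j := i + 1) (by omega) (by omega) y
      rw [hy (i + 1) (by omega) (by omega), map_zero] at this
      exact this.symm

/-- For a cycle `z`, the degenerate simplex `s m z` has `z` as its faces `m` and `m + 1` and zero
elsewhere. Hence `y ↦ s m z - y` moves the face `z` of a witness `y` from one of these positions to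
the other. -/
lemma mem_null_succ_iff {z : G.obj (op ⦋n⦌)} (hz : z ∈ G.cycles n) (hm : m ≤ n) :
    z ∈ G.null (m + 1) n ↔ z ∈ G.null m n := by
  constructor <;> rintro ⟨y, rfl, hy⟩
  · refine ⟨G.s m (G.d (m + 1) y) - y, ?_, fun i hi him => ?_⟩
    · rw [map_sub, d_s_self hm, hy m (by omega) (by omega), sub_zero]
    · rw [map_sub]
      by_cases h : i = m + 1
      · subst h; rw [d_s_succ hm, sub_self]
      · rw [d_s_of_mem_cycles hz hi hm him h, hy i hi h, sub_zero]
  · refine ⟨G.s m (G.d m y) - y, ?_, fun i hi him => ?_⟩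
    · rw [map_sub, d_s_succ hm, hy (m + 1) (by omega) (by omega), sub_zero]
    · rw [map_sub]
      by_cases h : i = m
      · subst h; rw [d_s_self hm, sub_self]
      · rw [d_s_of_mem_cycles hz hi hm h him, hy i hi h, sub_zero]

lemma mem_null_iff {z : G.obj (op ⦋n⦌)} (hz : z ∈ G.cycles n) (hm : m ≤ n + 1) :
    z ∈ G.null m n ↔ z ∈ G.null 0 n := by
  induction m with
  | zero => rfl
  | succ m ih => rw [mem_null_succ_iff hz (by omega), ih (by omega)]

lemma null_eq (hm : m ≤ n + 1) : G.null m n = G.null 0 n := by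
  ext z
  exact ⟨fun h => (mem_null_iff (null_le_cycles hm h) hm).mp h,
    fun h => (mem_null_iff (null_le_cycles (Nat.zero_le _) h) hm).mpr h⟩

/-! ### Morphisms -/

/-- The component of a morphism of simplicial abelian groups. -/
def ap (φ : G ⟶ H) (n : ℕ) : G.obj (op ⦋n⦌) →+ H.obj (op ⦋n⦌) := (φ.app (op ⦋n⦌)).hom

lemma ap_act (φ : G ⟶ H) (a : ⦋m⦌ ⟶ ⦋n⦌) (x : G.obj (op ⦋n⦌)) :
    ap φ m (G.act a x) = H.act a (ap φ n x) :=
  ConcreteCategory.congr_hom (φ.naturality a.op) x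

lemma ap_d (φ : G ⟶ H) (i : ℕ) (x : G.obj (op ⦋n + 1⦌)) : ap φ n (G.d i x) = H.d i (ap φ (n + 1) x) :=
  ap_act _ _ _

lemma ap_s (φ : G ⟶ H) (i : ℕ) (x : G.obj (op ⦋n⦌)) : ap φ (n + 1) (G.s i x) = H.s i (ap φ n x) :=
  ap_act _ _ _

lemma ap_mem_cycles (φ : G ⟶ H) {z : G.obj (op ⦋n⦌)} (hz : z ∈ G.cycles n) : ap φ n z ∈ H.cycles n := by
  intro l a ha
  rw [← ap_act, hz l a ha, map_zero]

lemma mem_cycles_of_ap (φ : G ⟶ H) (hφ : ∀ n, Function.Injective (ap φ n)) {z : G.obj (op ⦋n⦌)}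
    (hz : ap φ n z ∈ H.cycles n) : z ∈ G.cycles n := by
  intro l a ha
  apply hφ
  rw [ap_act, hz l a ha, map_zero]

lemma ap_mem_null (φ : G ⟶ H) {z : G.obj (op ⦋n⦌)} (hz : z ∈ G.null m n) : ap φ n z ∈ H.null m n := by
  obtain ⟨y, rfl, hy⟩ := hz
  exact ⟨ap φ _ y, (ap_d _ _ _).symm, fun i hi him => by rw [← ap_d, hy i hi him, map_zero]⟩

/-- A morphism is bijective on homotopy groups. -/
structure IsPiIso (φ : G ⟶ H) : Prop where
  surj (n : ℕ) (h : H.obj (op ⦋n⦌)) (hh : h ∈ H.cycles n) :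
    ∃ g ∈ G.cycles n, ap φ n g - h ∈ H.null 0 n
  inj (n : ℕ) (g : G.obj (op ⦋n⦌)) (hg : g ∈ G.cycles n) (h : ap φ n g ∈ H.null 0 n) : g ∈ G.null 0 n

/-- The relative form of Moore's theorem: a horn in a simplicial abelian group `G`, lying over a simplex `b` of `H`
along a levelwise surjective map `G ⟶ H`, has a filler over `b`. -/
lemma exists_filler (φ : G ⟶ H) (hφ : ∀ n, Function.Surjective (ap φ n)) (i : ℕ) (hi : i ≤ n + 1)
    (y : ℕ → G.obj (op ⦋n⦌)) (b : H.obj (op ⦋n + 1⦌))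
    (hb : ∀ j ≤ n + 1, j ≠ i → ap φ n (y j) = H.d j b)
    (hy : ∀ (p : ℕ) (hp : n = p + 1) (j k : ℕ), j < k → k ≤ n + 1 → j ≠ i → k ≠ i →
      G.d j (hp ▸ y k : G.obj (op ⦋p + 1⦌)) = G.d (k - 1) (hp ▸ y j : G.obj (op ⦋p + 1⦌))) :
    ∃ u : G.obj (op ⦋n + 1⦌), ap φ (n + 1) u = b ∧ ∀ j ≤ n + 1, j ≠ i → G.d j u = y j := by
  -- Faces below `i` are corrected in increasing order by adding `s t` of the error at face `t`. By
  -- compatibility the lower faces of this correction vanish, and since the error lies over zero the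
  -- image `b` is kept.
  have lower (t : ℕ) (ht : t ≤ i) :
      ∃ u : G.obj (op ⦋n + 1⦌), ap φ (n + 1) u = b ∧ ∀ j < t, G.d j u = y j := by
    induction t with
    | zero =>
      obtain ⟨u, hu⟩ := hφ _ b
      exact ⟨u, hu, fun j hj => absurd hj (by omega)⟩
    | succ t ih =>
      obtain ⟨u, hu, hj⟩ := ih (by omega)
      refine ⟨u + G.s t (y t - G.d t u), ?_, fun j hjt => ?_⟩
      · rw [map_add, hu, ap_s, map_sub, hb t (by omega) (by omega), ap_d, hu, sub_self, map_zero,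
          add_zero]
      · rw [map_add]
        by_cases hjt' : j = t
        · subst hjt'
          rw [d_s_self (by omega)]; abel
        · obtain _ | p := n
          · omega
          · rw [d_s_of_lt (by omega) (by omega), map_sub (G.d j), hy p rfl j t (by omega) (by omega) (by omega) (by omega),
              d_d (by omega) (by omega), hj j (by omega), sub_self, map_zero, add_zero]
  -- Faces above `i` are corrected in decreasing order from `n + 1`, with `t` of them done so far.
  -- Face `r + 1` is repaired by `s r`, which disturbs neither the faces below `i` nor those above
  -- `r + 1`.
  have upper (t : ℕ) (ht : t ≤ n + 1 - i) :
      ∃ u : G.obj (op ⦋n + 1⦌), ap φ (n + 1) u = b ∧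
        ∀ j ≤ n + 1, (j < i ∨ n + 1 < j + t) → G.d j u = y j := by
    induction t with
    | zero =>
      obtain ⟨u, hu, hj⟩ := lower i le_rfl
      exact ⟨u, hu, fun j hj' h => hj j (by omega)⟩
    | succ t ih =>
      obtain ⟨u, hu, hj⟩ := ih (by omega)
      obtain ⟨r, hr⟩ : ∃ r, r + 1 + t = n + 1 := ⟨n - t, by omega⟩
      refine ⟨u + G.s r (y (r + 1) - G.d (r + 1) u), ?_, fun j hj' h => ?_⟩
      · rw [map_add, hu, ap_s, map_sub, hb _ (by omega) (by omega), ap_d, hu, sub_self, map_zero,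
          add_zero]
      · rw [map_add]
        by_cases hjr : j = r + 1
        · subst hjr
          rw [d_s_succ (by omega)]; abel
        · obtain _ | p := n
          · omega
          · rcases h with h | h
            · rw [d_s_of_lt (by omega) (by omega), map_sub (G.d j), hy p rfl j (r + 1) (by omega) (by omega) (by omega) (by omega),
                d_d (by omega) (by omega), hj j (by omega) (by omega), sub_self, map_zero, add_zero]
            · have e₁ := hy p rfl (r + 1) j (by omega) (by omega) (by omega) (by omega)
              have e₂ := d_d (G := G) (i := r + 1) (j := j) (by omega) (by omega) u
              rw [hj j (by omega) (by omega)] at e₂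
              dsimp only at e₁
              rw [d_s_of_gt (by omega) (by omega), map_sub (G.d (j - 1)), ← e₁, e₂, sub_self, map_zero, add_zero,
                hj j (by omega) (by omega)]
  obtain ⟨u, hu, h⟩ := upper (n + 1 - i) le_rfl
  exact ⟨u, hu, fun j hj hji => h j hj (by omega)⟩

end SAb

namespace SAb

variable {G H : SAb.{u}} {k l m n : ℕ}

/-! ### The total space of the bar construction -/

/-- The sum telescopes. This makes consecutive differences commute with the operators of the bar
construction. -/
lemma sum_differences {M : Type u} [AddCommGroup M] {k : ℕ} (y : Fin (k + 1) → M) (b c : Fin (k + 1))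
    (hbc : b ≤ c) :
    (∑ i : Fin k, if b ≤ i.castSucc ∧ i.succ ≤ c then y i.succ - y i.castSucc else 0) = y c - y b := by
  induction c using Fin.induction with
  | zero =>
    obtain rfl : b = 0 := Fin.le_zero_iff.mp hbc
    rw [sub_self]
    exact Finset.sum_eq_zero fun j _ => if_neg fun h => absurd h.2 (by simp)
  | succ c ih =>
    rcases hbc.eq_or_lt with rfl | hlt
    · rw [sub_self]
      exact Finset.sum_eq_zero fun j _ => if_neg fun h => absurd (h.2.trans h.1) (by simp)
    · have hb : b ≤ c.castSucc := Fin.le_castSucc_iff.mpr hlt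
      have e (i : Fin k) : (if b ≤ i.castSucc ∧ i.succ ≤ c.succ then y i.succ - y i.castSucc else 0) =
          (if b ≤ i.castSucc ∧ i.succ ≤ c.castSucc then y i.succ - y i.castSucc else 0) +
            if i = c then y i.succ - y i.castSucc else 0 := by
        by_cases hi : i = c
        · subst hi
          rw [if_pos ⟨hb, le_rfl⟩, if_neg (by simp [Fin.le_def]), if_pos rfl, zero_add]
        · have : i.succ ≤ c.succ ↔ i.succ ≤ c.castSucc := by
            have : (i : ℕ) ≠ c := fun h => hi (Fin.ext h)
            simp only [Fin.le_def, Fin.val_castSucc, Fin.val_succ]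
            omega
          rw [if_neg hi, add_zero]
          simp only [this]
      simp only [e]
      rw [Finset.sum_add_distrib, ih hb, Finset.sum_ite_eq' Finset.univ c, if_pos (Finset.mem_univ _)]
      abel

/-- The total space `diag B_•(*, G, G)`, with `k`-simplices the functions `[k] → G_k`. -/
def tot (G : SAb.{u}) : SAb.{u} where
  obj k := AddCommGrpCat.of (Fin (k.unop.len + 1) → G.obj k)
  map {k l} a := AddCommGrpCat.ofHom
    { toFun x j := G.map a (x (a.unop.toOrderHom j))
      map_zero' := funext fun _ => map_zero (G.map a).hom
      map_add' _ _ := funext fun _ => map_add (G.map a).hom _ _ }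
  map_id k := by
    refine AddCommGrpCat.hom_ext (AddMonoidHom.ext fun x => funext fun j => ?_)
    change G.map (𝟙 k) (x j) = x j
    simp
  map_comp {k l m} a b := by
    refine AddCommGrpCat.hom_ext (AddMonoidHom.ext fun x => funext fun j => ?_)
    change G.map (a ≫ b) (x _) = G.map b (G.map a (x _))
    rw [G.map_comp]; rfl

lemma tot_act (a : ⦋m⦌ ⟶ ⦋n⦌) (x : Fin (n + 1) → G.obj (op ⦋n⦌)) (j : Fin (m + 1)) :
    ((tot G).act a x : Fin (m + 1) → G.obj (op ⦋m⦌)) j = G.act a (x (a.toOrderHom j)) := rfl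

/-- The projection from the total space to the bar construction. -/
def totToBar (G : SAb.{u}) : tot G ⟶ bar G where
  app k := AddCommGrpCat.ofHom
    { toFun (x : Fin (k.unop.len + 1) → G.obj k) := fun j : Fin k.unop.len => x j.succ - x j.castSucc
      map_zero' := funext fun _ => sub_self _
      map_add' (x y : Fin (k.unop.len + 1) → G.obj k) := funext fun j => add_sub_add_comm (x j.succ) (y j.succ) _ _ }
  naturality k l a := by
    refine AddCommGrpCat.hom_ext (AddMonoidHom.ext fun (x : Fin (k.unop.len + 1) → G.obj k) => funext fun j => ?_)
    change G.map a (x (a.unop.toOrderHom j.succ)) - G.map a (x (a.unop.toOrderHom j.castSucc)) =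
      ∑ i : Fin k.unop.len, if a.unop.toOrderHom j.castSucc ≤ i.castSucc ∧ i.succ ≤ a.unop.toOrderHom j.succ then
        (G.map a).hom (x i.succ - x i.castSucc) else 0
    simp only [map_sub]
    exact (sum_differences (fun i => (G.map a).hom (x i)) _ _
      (a.unop.toOrderHom.monotone (Fin.castSucc_lt_succ (i := j)).le)).symm

/-- The inclusion of the fibre of the total space. -/
def toTot (G : SAb.{u}) : G ⟶ tot G where
  app k := AddCommGrpCat.ofHom
    { toFun x _ := x
      map_zero' := rfl
      map_add' _ _ := rfl }

lemma ap_totToBar (x : Fin (n + 1) → G.obj (op ⦋n⦌)) (j : Fin n) :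
    (ap (totToBar G) n x : Fin n → G.obj (op ⦋n⦌)) j = x j.succ - x j.castSucc := rfl

lemma toTot_injective (n : ℕ) : Function.Injective (ap (toTot G) n) :=
  fun _ _ h => congrFun h (0 : Fin (n + 1))

lemma totToBar_toTot (x : G.obj (op ⦋n⦌)) : ap (totToBar G) n (ap (toTot G) n x) = 0 :=
  funext fun _ : Fin n => sub_self x

/-- Exactness in the middle of `G ⟶ tot G ⟶ bar G`: a function with vanishing consecutive
differences is constant. -/
lemma exists_of_totToBar_eq_zero (x : (tot G).obj (op ⦋n⦌)) (hx : ap (totToBar G) n x = 0) :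
    x = ap (toTot G) n ((x : Fin (n + 1) → G.obj (op ⦋n⦌)) 0) := by
  change Fin (n + 1) → G.obj (op ⦋n⦌) at x
  refine funext fun j : Fin (n + 1) => ?_
  change x j = x 0
  induction j using Fin.induction with
  | zero => rfl
  | succ j ih => rw [← ih]; exact sub_eq_zero.mp (congrFun hx j)

lemma exists_totToBar_eq (z : (bar G).obj (op ⦋n⦌)) :
    ∃ x : (tot G).obj (op ⦋n⦌), ap (totToBar G) n x = z ∧ (x : Fin (n + 1) → G.obj (op ⦋n⦌)) 0 = 0 := by
  change Fin n → G.obj (op ⦋n⦌) at z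
  refine ⟨(Fin.partialSum z : Fin (n + 1) → G.obj (op ⦋n⦌)), funext fun j : Fin n => ?_, Fin.partialSum_zero _⟩
  change Fin.partialSum z j.succ - Fin.partialSum z j.castSucc = z j
  rw [Fin.partialSum_succ]; abel

lemma totToBar_surjective (n : ℕ) : Function.Surjective (ap (totToBar G) n) :=
  fun z => ⟨_, (exists_totToBar_eq z).choose_spec.1⟩

/-- The total space is acyclic. -/
lemma cycles_tot_le_null (z : (tot G).obj (op ⦋n⦌)) (hz : z ∈ (tot G).cycles n) : z ∈ (tot G).null 0 n := by
  classical
  let x : Fin (n + 1) → G.obj (op ⦋n⦌) := z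
  -- A cycle is the sum of its single entries, and each summand is null by itself: it is the `j`-th
  -- face of `s j (x j)` placed at position `j + 1`.
  have key (j : Fin (n + 1)) : (Pi.single j (x j) : Fin (n + 1) → G.obj (op ⦋n⦌)) ∈ (tot G).null 0 n := by
    rw [← null_eq (show (j : ℕ) ≤ n + 1 by omega)]
    have aux (i : ℕ) (hi : i ≤ n + 1) (r : Fin (n + 1)) :
        ((tot G).d i (Pi.single j.succ (G.s j (x j)) : Fin (n + 2) → G.obj (op ⦋n + 1⦌)) :
          Fin (n + 1) → G.obj (op ⦋n⦌)) r =
        if (if (r : ℕ) < i then (r : ℕ) else r + 1) = j + 1 then G.d i (G.s j (x j)) else 0 := by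
      unfold d
      rw [tot_act, Pi.single_apply, apply_ite (G.act _), map_zero]
      refine if_congr ?_ rfl rfl
      rw [Fin.ext_iff, delta_val _ hi, Fin.val_succ]
    refine ⟨(Pi.single j.succ (G.s j (x j)) : Fin (n + 2) → G.obj (op ⦋n + 1⦌)), funext fun r : Fin (n + 1) => ?_,
      fun i hi hij => funext fun r : Fin (n + 1) => ?_⟩
    · rw [aux _ (by omega), d_s_self (by omega), Pi.single_apply]
      refine if_congr ?_ rfl rfl
      rw [Fin.ext_iff]
      split_ifs <;> omega
    · rw [aux _ hi]
      refine ite_eq_right_iff.mpr fun h => ?_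
      have hij' : i ≠ j + 1 := by rintro rfl; split_ifs at h <;> omega
      -- Only faces `i ≠ j, j + 1` can still contribute. There `δ i ≫ σ j` is not surjective, and
      -- the cycle condition for this operator, read at entry `r`, makes the contribution `d i (s j
      -- (x j))` vanish.
      have hw : ¬ Function.Surjective
          (SimplexCategory.δ (Fin.ofNat (n + 2) i) ≫ SimplexCategory.σ (Fin.ofNat (n + 1) j)).toOrderHom := by
        intro hs
        obtain ⟨c, hc⟩ : ∃ c, c = if i < (j : ℕ) then i else i - 1 := ⟨_, rfl⟩
        obtain ⟨q, hq⟩ := hs (⟨c, by split_ifs at hc <;> omega⟩ : Fin (n + 1))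
        have : _ = c := congrArg Fin.val hq
        rw [comp_val, sigma_val _ (Nat.lt_succ_iff.mp j.2), delta_val _ hi] at this
        split_ifs at this hc <;> omega
      have hr : (SimplexCategory.δ (Fin.ofNat (n + 2) i) ≫
          SimplexCategory.σ (Fin.ofNat (n + 1) j)).toOrderHom r = j := by
        refine Fin.ext ?_
        rw [comp_val, sigma_val _ (by omega), delta_val _ hi, h]
        split_ifs <;> omega
      have : G.act _ (x _) = 0 := congrFun (hz n _ hw) r
      exact ((act_act _ _ _).trans (congrArg (fun q => G.act _ (x q)) hr.symm)).trans this
  have : z = ∑ j : Fin (n + 1), (Pi.single j (x j) : Fin (n + 1) → G.obj (op ⦋n⦌)) :=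
    (Finset.univ_sum_single x).symm
  rw [this]
  exact AddSubgroup.sum_mem _ fun j _ => key j

end SAb

namespace SAb

variable {G H : SAb.{u}} {k l m n : ℕ}

/-! ### Lifting properties -/

/-- The simplicial set underlying a simplicial abelian group. -/
abbrev ss (G : SAb.{u}) : SSet.{u} := (underlying G).sset

/-- The map of simplicial sets underlying a morphism of simplicial abelian groups. -/
def ssMap (φ : G ⟶ H) : G.ss ⟶ H.ss := Functor.whiskerRight φ (forget AddCommGrpCat)

lemma delta_eq_d (i : Fin (n + 2)) (x : G.obj (op ⦋n + 1⦌)) : G.ss.δ i x = G.d i x := by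
  unfold d
  rw [Fin.ofNat_eq_cast, Fin.cast_val_eq_self]
  rfl

/-- The map from the standard simplex with a given value on the universal simplex. -/
def smp (x : G.obj (op ⦋n⦌)) : Δ[n] ⟶ G.ss := SSet.yonedaEquiv.symm (x : G.ss _⦋n⦌)

/-- The value of a map from the standard simplex on the universal simplex. -/
def ev (f : Δ[n] ⟶ G.ss) : G.obj (op ⦋n⦌) := SSet.yonedaEquiv f

lemma ev_injective : Function.Injective (ev : (Δ[n] ⟶ G.ss) → G.obj (op ⦋n⦌)) := SSet.yonedaEquiv.injective

lemma ev_smp (x : G.obj (op ⦋n⦌)) : ev (smp x) = x := SSet.yonedaEquiv.apply_symm_apply _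

lemma ev_delta_comp (i : Fin (n + 2)) (f : Δ[n + 1] ⟶ G.ss) :
    ev (SSet.stdSimplex.δ i ≫ f) = G.d i (ev f) := by
  exact (SSet.stdSimplex.yonedaEquiv_δ_comp f i).trans (delta_eq_d i (ev f))

lemma ev_comp_ssMap (φ : G ⟶ H) (f : Δ[n] ⟶ G.ss) : ev (f ≫ ssMap φ) = ap φ n (ev f) := rfl

lemma exists_filler_of_isCompatible (φ : G ⟶ H) (hφ : ∀ n, Function.Surjective (ap φ n)) {i : Fin (n + 2)}
    (f : ∀ (j : Fin (n + 2)) (_ : j ≠ i), Δ[n] ⟶ G.ss) (hf : SSet.horn.IsCompatible f) (b : H.obj (op ⦋n + 1⦌))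
    (hb : ∀ (j : Fin (n + 2)) (hj : j ≠ i), ap φ n (ev (f j hj)) = H.d j b) :
    ∃ u : G.obj (op ⦋n + 1⦌), ap φ (n + 1) u = b ∧
      ∀ (j : Fin (n + 2)) (hj : j ≠ i), G.d j u = ev (f j hj) := by
  let y (j : ℕ) : G.obj (op ⦋n⦌) :=
    if h : ∃ h : j < n + 2, (⟨j, h⟩ : Fin (n + 2)) ≠ i then ev (f ⟨j, h.1⟩ h.2) else 0
  have hy (j : Fin (n + 2)) (hj : j ≠ i) : y j = ev (f j hj) := dif_pos ⟨j.2, hj⟩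
  obtain ⟨u, hu, h⟩ := exists_filler φ hφ i (Nat.lt_succ_iff.mp i.2) y b
    (fun j hj hji => by
      have := hb ⟨j, by omega⟩ (fun h => hji (congrArg Fin.val h))
      rw [← hy] at this
      exact this)
    (by
      rintro p rfl j k hjk hk hj hk'
      have := hf ⟨j, by omega⟩ ⟨k, by omega⟩ (fun h => hj (congrArg Fin.val h)) (fun h => hk' (congrArg Fin.val h)) hjk
      have := congrArg ev this
      rw [ev_delta_comp, ev_delta_comp, ← hy, ← hy] at this
      exact this.symm)
  refine ⟨u, hu, fun j hj => ?_⟩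
  rw [h j (Nat.lt_succ_iff.mp j.2) (fun h => hj (Fin.ext h)), hy]

open SSet.modelCategoryQuillen HomotopicalAlgebra in
-- It suffices to lift against horn inclusions, and such a lifting problem is a relative filling
-- problem.
lemma fibration_ssMap (φ : G ⟶ H) (hφ : ∀ n, Function.Surjective (ap φ n)) : Fibration (ssMap φ) := by
  rw [fibration_iff]
  intro _ _ _ hf
  simp only [J, MorphismProperty.iSup_iff] at hf
  obtain ⟨n, ⟨i⟩⟩ := hf
  refine ⟨fun {t b} sq => ?_⟩
  obtain ⟨u, hu, huj⟩ := exists_filler_of_isCompatible φ hφ _ (SSet.horn.IsCompatible.of_hom t) (ev b)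
    (fun j hj => by
      rw [← ev_delta_comp, ← SSet.horn.ι_ι i j hj, Category.assoc, ← sq.w, ← Category.assoc,
        ev_comp_ssMap])
  refine ⟨⟨{ l := smp u, fac_left := SSet.horn.hom_ext' fun j hj => ?_, fac_right := ?_ }⟩⟩
  · rw [SSet.horn.ι_ι_assoc]
    apply ev_injective
    rw [ev_delta_comp, ev_smp, huj j hj]
  · apply ev_injective
    rw [ev_comp_ssMap, ev_smp, hu]

/-- The zero simplicial abelian group. -/
def zero : SAb.{u} := (Functor.const _).obj (AddCommGrpCat.of PUnit)

/-- The map to the zero simplicial abelian group. -/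
def toZero (G : SAb.{u}) : G ⟶ zero where
  app _ := AddCommGrpCat.ofHom 0

lemma toZero_surjective (n : ℕ) : Function.Surjective (ap (toZero G) n) := fun _ => ⟨0, rfl⟩

/-- Moore's theorem: simplicial abelian groups are Kan complexes. -/
lemma kanComplex (G : SAb.{u}) : SSet.KanComplex G.ss := by
  rw [SSet.KanComplex.iff]
  intro n i f hf
  obtain ⟨u, -, hu⟩ := exists_filler_of_isCompatible (toZero G) toZero_surjective f hf 0 (fun _ _ => rfl)
  refine ⟨smp u, fun j hj => ?_⟩
  apply ev_injective
  rw [ev_delta_comp, ev_smp, hu j hj]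

lemma horn_le_boundary (i : Fin (n + 1)) : SSet.horn.{u} n i ≤ SSet.boundary n := by
  intro m x hx hs
  exact hx (by rw [hs.range_eq, Set.univ_union])

/-- Maps into an acyclic simplicial abelian group extend along monomorphisms. -/
lemma exists_extension_of_acyclic (hG : ∀ n, G.cycles n ≤ G.null 0 n) {X Y : SSet.{u}} (i : X ⟶ Y) [Mono i]
    (f : X ⟶ G.ss) : ∃ g : Y ⟶ G.ss, i ≫ g = f := by
  have h : (MorphismProperty.monomorphisms SSet.{u}).rlp (terminal.from G.ss) := by
    rw [SSet.rlp_monomorphisms]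
    rintro _ _ _ ⟨n⟩
    refine ⟨fun {t b} sq => ?_⟩
    obtain _ | n := n
    · exact ⟨⟨{ l := smp 0
                fac_left := SSet.boundary.hom_ext₀
                fac_right := by subsingleton }⟩⟩
    · let y (j : Fin (n + 2)) : G.obj (op ⦋n⦌) := ev (SSet.boundary.ι j ≫ t)
      -- It is enough to extend from `∂Δ[n + 1]`. First the horn without the face `0` is filled by
      -- `u`. The error on that face is then a cycle, and acyclicity supplies `w` with this error as
      -- face `0` and no other faces, so `u - w` is the extension.
      obtain ⟨u, -, hu⟩ := exists_filler_of_isCompatible (toZero G) toZero_surjective _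
        (SSet.horn.IsCompatible.of_hom (i := (0 : Fin (n + 2)))
          (Subfunctor.homOfLe (horn_le_boundary (0 : Fin (n + 2))) ≫ t)) 0 (fun _ _ => rfl)
      replace hu (j : Fin (n + 2)) (hj : j ≠ 0) : G.d j u = y j := hu j hj
      have hc : G.d 0 u - y 0 ∈ G.cycles n := by
        obtain _ | n := n
        · exact mem_cycles_zero _
        · rw [mem_cycles_succ]
          intro i hi
          have e : SSet.stdSimplex.δ (⟨i, by omega⟩ : Fin (n + 2)) ≫ SSet.boundary.ι (0 : Fin (n + 3)) =
              SSet.stdSimplex.δ (0 : Fin (n + 2)) ≫ SSet.boundary.ι (⟨i + 1, by omega⟩ : Fin (n + 3)) := by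
            rw [← cancel_mono (SSet.Subcomplex.ι _), Category.assoc, Category.assoc, SSet.boundary.ι_ι,
              SSet.boundary.ι_ι]
            exact (SSet.stdSimplex.δ_comp_δ (Fin.zero_le _)).symm
          have e' := congrArg (fun f => ev (f ≫ t)) e
          simp only [Category.assoc, ev_delta_comp, Fin.val_zero] at e'
          have := d_d (G := G) (i := 0) (j := i + 1) (by omega) (by omega) u
          have h₁ : G.d (i + 1) u = y ⟨i + 1, by omega⟩ := hu ⟨i + 1, by omega⟩ (by simp [Fin.ext_iff])
          rw [h₁] at this
          rw [map_sub, sub_eq_zero]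
          exact this.symm.trans e'.symm
      obtain ⟨w, hw, hw'⟩ := hG n hc
      have huw (j : Fin (n + 2)) : G.d j (u - w) = y j := by
        rw [map_sub]
        by_cases hj : j = 0
        · subst hj
          rw [Fin.val_zero, hw]; abel
        · rw [hu j hj, hw' j (Nat.lt_succ_iff.mp j.2) (fun h => hj (Fin.ext h)), sub_zero]
      refine ⟨⟨{ l := smp (u - w)
                 fac_left := SSet.boundary.hom_ext fun j => ?_
                 fac_right := by subsingleton }⟩⟩
      rw [SSet.boundary.ι_ι_assoc]
      apply ev_injective
      rw [ev_delta_comp, ev_smp, huw]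
  have := h i inferInstance
  have sq : CommSq f i (terminal.from G.ss) (terminal.from Y) := ⟨by subsingleton⟩
  exact ⟨sq.lift, sq.fac_left⟩

end SAb

namespace SAb

variable {G H : SAb.{u}} {k l m n : ℕ}

/-! ### Function complexes -/

section HomGroup

variable {X : SSet.{u}}

/-- Maps into a simplicial abelian group are determined by their values. -/
lemma hom_ext_app {f g : X ⟶ G.ss} (h : ∀ k (x : X.obj k), f.app k x = g.app k x) : f = g := by
  ext k x
  exact h k x

/-- The map into a simplicial abelian group with given values. -/
def homMk (f : ∀ k, X.obj k → G.obj k)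
    (hf : ∀ {k l : SimplexCategoryᵒᵖ} (a : k ⟶ l) (x : X.obj k), f l (X.map a x) = G.map a (f k x)) : X ⟶ G.ss where
  app k := ↾(f k : X.obj k → G.ss.obj k)
  naturality k l a := by
    ext x
    exact hf a x

lemma hom_naturality (f : X ⟶ G.ss) {k l : SimplexCategoryᵒᵖ} (a : k ⟶ l) (x : X.obj k) :
    (f.app l (X.map a x) : G.obj l) = G.map a (f.app k x : G.obj k) :=
  NatTrans.naturality_apply f a x

/-- The value of a map into a simplicial abelian group. -/
def hv (f : X ⟶ G.ss) {k : SimplexCategoryᵒᵖ} (x : X.obj k) : G.obj k := f.app k x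

lemma hv_map (f : X ⟶ G.ss) {k l : SimplexCategoryᵒᵖ} (a : k ⟶ l) (x : X.obj k) :
    hv f (X.map a x) = (G.map a).hom (hv f x) :=
  hom_naturality f a x

instance : Add (X ⟶ G.ss) where
  add f g := homMk (fun _ x => hv f x + hv g x) fun a x => by
    rw [hv_map, hv_map]
    exact (map_add (G.map a).hom _ _).symm

instance : Zero (X ⟶ G.ss) where
  zero := homMk (fun _ _ => 0) fun a _ => (map_zero (G.map a).hom).symm

instance : Neg (X ⟶ G.ss) where
  neg f := homMk (fun _ x => -(hv f x)) fun a x => by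
    rw [hv_map]
    exact (map_neg (G.map a).hom _).symm

instance : AddCommGroup (X ⟶ G.ss) :=
  { AddGroup.ofLeftAxioms (G := X ⟶ G.ss)
      (fun f g h => hom_ext_app fun _ x => add_assoc (hv f x) (hv g x) (hv h x))
      (fun f => hom_ext_app fun _ x => zero_add (hv f x))
      (fun f => hom_ext_app fun _ x => neg_add_cancel (hv f x)) with
    add_comm := fun f g => hom_ext_app fun _ x => add_comm (hv f x) (hv g x) }

end HomGroup

/-! ### Function complexes of maps vanishing on a subcomplex. -/

variable {W : SSet.{u}} {A : W.Subcomplex}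

/-- The simplicial abelian group of maps `W ⟶ G` vanishing on a subcomplex `A`. -/
def mapGrp (W : SSet.{u}) (A : W.Subcomplex) (G : SAb.{u}) : SAb.{u} where
  obj k := AddCommGrpCat.of
    ({ carrier := { f | ∀ m (w : W.obj m) (_ : w ∈ A.obj m) (t : (SSet.stdSimplex.obj k.unop).obj m),
        hv f (w, t) = 0 }
       zero_mem' := fun _ _ _ _ => rfl
       add_mem' := fun {f g} hf hg m w hw t =>
        (congrArg₂ (fun x y : G.obj m => x + y) (hf m w hw t) (hg m w hw t)).trans (add_zero (0 : G.obj m))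
       neg_mem' := fun {f} hf m w hw t => (congrArg (fun x : G.obj m => -x) (hf m w hw t)).trans (neg_zero (G := G.obj m)) } :
      AddSubgroup (W ⊗ SSet.stdSimplex.obj k.unop ⟶ G.ss))
  map a := AddCommGrpCat.ofHom
    { toFun f := ⟨W ◁ SSet.stdSimplex.map a.unop ≫ f.1, fun m w hw _ => f.2 m w hw _⟩
      map_zero' := rfl
      map_add' _ _ := rfl }
  map_id k := by
    refine AddCommGrpCat.hom_ext (AddMonoidHom.ext fun f => Subtype.ext (hom_ext_app fun m x => ?_))
    exact congrArg (fun q : SSet.stdSimplex.obj k.unop ⟶ SSet.stdSimplex.obj k.unop => hv f.1 (x.1, q.app m x.2))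
      (CategoryTheory.Functor.map_id SSet.stdSimplex k.unop)
  map_comp a b := by
    refine AddCommGrpCat.hom_ext (AddMonoidHom.ext fun f => Subtype.ext (hom_ext_app fun m x => ?_))
    rfl

/-- The underlying map of a simplex of the function complex. -/
def toHom (f : (mapGrp W A G).obj (op ⦋n⦌)) : W ⊗ Δ[n] ⟶ G.ss := f.1

/-- A simplex of the function complex. -/
def ofHom (f : W ⊗ Δ[n] ⟶ G.ss)
    (hf : ∀ m (w : W.obj m) (_ : w ∈ A.obj m) (t : Δ[n].obj m), f.app m (w, t) = (0 : G.obj m)) :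
    (mapGrp W A G).obj (op ⦋n⦌) := ⟨f, hf⟩

/-- The values of a simplex of the function complex. -/
def val (f : (mapGrp W A G).obj (op ⦋n⦌)) (w : W.obj (op ⦋m⦌)) (a : ⦋m⦌ ⟶ ⦋n⦌) : G.obj (op ⦋m⦌) :=
  (toHom f).app _ (w, SSet.stdSimplex.objEquiv.symm a)

lemma val_sub (f g : (mapGrp W A G).obj (op ⦋n⦌)) (w : W.obj (op ⦋m⦌)) (a : ⦋m⦌ ⟶ ⦋n⦌) :
    val (f - g) w a = val f w a - val g w a := by
  rw [sub_eq_add_neg, sub_eq_add_neg]; rfl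

lemma val_zero (w : W.obj (op ⦋m⦌)) (a : ⦋m⦌ ⟶ ⦋n⦌) :
    val (0 : (mapGrp W A G).obj (op ⦋n⦌)) w a = 0 := rfl

lemma val_of_mem (f : (mapGrp W A G).obj (op ⦋n⦌)) {w : W.obj (op ⦋m⦌)} (hw : w ∈ A.obj (op ⦋m⦌)) (a : ⦋m⦌ ⟶ ⦋n⦌) :
    val f w a = 0 := f.2 _ w hw _

lemma val_ext {f g : (mapGrp W A G).obj (op ⦋n⦌)}
    (h : ∀ (m : ℕ) (w : W.obj (op ⦋m⦌)) (a : ⦋m⦌ ⟶ ⦋n⦌), val f w a = val g w a) : f = g :=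
  Subtype.ext (hom_ext_app fun m x => h m.unop.len x.1 (SSet.stdSimplex.objEquiv x.2))

lemma val_act (f : (mapGrp W A G).obj (op ⦋n⦌)) (b : ⦋l⦌ ⟶ ⦋n⦌) (w : W.obj (op ⦋m⦌)) (a : ⦋m⦌ ⟶ ⦋l⦌) :
    val ((mapGrp W A G).act b f) w a = val f w (a ≫ b) := rfl

lemma act_val (f : (mapGrp W A G).obj (op ⦋n⦌)) (w : W.obj (op ⦋m⦌)) (a : ⦋m⦌ ⟶ ⦋n⦌) (b : ⦋l⦌ ⟶ ⦋m⦌) :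
    G.act b (val f w a) = val f (W.map b.op w) (b ≫ a) :=
  (hom_naturality (toHom f) b.op (w, SSet.stdSimplex.objEquiv.symm a)).symm

/-- Functoriality of the function complex. -/
def mapGrpMap (W : SSet.{u}) (A : W.Subcomplex) (φ : G ⟶ H) : mapGrp W A G ⟶ mapGrp W A H where
  app k := AddCommGrpCat.ofHom
    { toFun f := ⟨f.1 ≫ ssMap φ, fun m w hw t =>
        (congrArg (φ.app m).hom (f.2 m w hw t)).trans (map_zero (φ.app m).hom)⟩
      map_zero' := Subtype.ext (hom_ext_app fun m _ => map_zero (φ.app m).hom)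
      map_add' _ _ := Subtype.ext (hom_ext_app fun m _ => map_add (φ.app m).hom _ _) }

lemma val_mapGrpMap (φ : G ⟶ H) (f : (mapGrp W A G).obj (op ⦋n⦌)) (w : W.obj (op ⦋m⦌)) (a : ⦋m⦌ ⟶ ⦋n⦌) :
    val (ap (mapGrpMap W A φ) n f) w a = ap φ m (val f w a) := rfl

lemma val_of_not_surjective {z : (mapGrp W A G).obj (op ⦋n⦌)} (hz : z ∈ (mapGrp W A G).cycles n)
    (w : W.obj (op ⦋m⦌)) {b : ⦋m⦌ ⟶ ⦋n⦌} (hb : ¬ Function.Surjective b.toOrderHom) : val z w b = 0 := by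
  have := val_act z b w (𝟙 _)
  rw [hz _ b hb, val_zero, Category.id_comp] at this
  exact this.symm

/-- The common composite misses `i`, while `δ 0` reaches `i` from its predecessor, so `b'` misses
that predecessor. -/
lemma not_surjective_of_comp_delta {i : Fin (n + 2)} (hi : i ≠ 0) {b b' : ⦋m⦌ ⟶ ⦋n⦌}
    (h : b' ≫ SimplexCategory.δ 0 = b ≫ SimplexCategory.δ i) : ¬ Function.Surjective b'.toOrderHom := by
  intro hs
  obtain ⟨j, hj⟩ := hs (i.pred hi)
  have := congrArg (fun q : ⦋m⦌ ⟶ ⦋n + 1⦌ => q.toOrderHom j) h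
  change Fin.succAbove 0 (b'.toOrderHom j) = Fin.succAbove i (b.toOrderHom j) at this
  rw [hj, Fin.zero_succAbove, Fin.succ_pred] at this
  exact Fin.succAbove_ne i _ this.symm

/-- A cycle in a function complex extends by zero from one face to the boundary. -/
lemma exists_extension_by_zero (z : (mapGrp W A G).obj (op ⦋n⦌)) (hz : z ∈ (mapGrp W A G).cycles n) :
    ∃ f : (A.unionProd ∂Δ[n + 1] : SSet.{u}) ⟶ G.ss,
      ∀ (m : ℕ) (w : W.obj (op ⦋m⦌)) (a : ⦋m⦌ ⟶ ⦋n + 1⦌)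
        (h : (w, SSet.stdSimplex.objEquiv.symm a) ∈ (A.unionProd ∂Δ[n + 1]).obj (op ⦋m⦌)),
        (w ∈ A.obj _ → f.app _ ⟨_, h⟩ = (0 : G.obj (op ⦋m⦌))) ∧
        (∀ b : ⦋m⦌ ⟶ ⦋n⦌, a = b ≫ SimplexCategory.δ 0 → f.app _ ⟨_, h⟩ = val z w b) ∧
        ((∃ (b : ⦋m⦌ ⟶ ⦋n⦌) (i : Fin (n + 2)), i ≠ 0 ∧ a = b ≫ SimplexCategory.δ i) →
          f.app _ ⟨_, h⟩ = (0 : G.obj (op ⦋m⦌))) := by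
  classical
  -- The extension is `z` on face `0` and zero on everything else. This is consistent on overlaps
  -- because `z` is a cycle and vanishes on `A`.
  let F (m : ℕ) (w : W.obj (op ⦋m⦌)) (a : ⦋m⦌ ⟶ ⦋n + 1⦌) : G.obj (op ⦋m⦌) :=
    if h : ∃ b : ⦋m⦌ ⟶ ⦋n⦌, a = b ≫ SimplexCategory.δ 0 then val z w h.choose else 0
  have hF (m : ℕ) (w : W.obj (op ⦋m⦌)) (b : ⦋m⦌ ⟶ ⦋n⦌) : F m w (b ≫ SimplexCategory.δ 0) = val z w b := by
    have h : ∃ b' : ⦋m⦌ ⟶ ⦋n⦌, b ≫ SimplexCategory.δ 0 = b' ≫ SimplexCategory.δ 0 := ⟨b, rfl⟩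
    have e : h.choose = b := (cancel_mono (SimplexCategory.δ 0)).mp h.choose_spec.symm
    exact (dif_pos h).trans (by rw [e])
  have hF₁ (m : ℕ) (w : W.obj (op ⦋m⦌)) (a : ⦋m⦌ ⟶ ⦋n + 1⦌) (hw : w ∈ A.obj _) : F m w a = 0 := by
    dsimp only [F]
    split_ifs
    · exact val_of_mem _ hw _
    · rfl
  have hF₂ (m : ℕ) (w : W.obj (op ⦋m⦌)) (b : ⦋m⦌ ⟶ ⦋n⦌) (i : Fin (n + 2)) (hi : i ≠ 0) :
      F m w (b ≫ SimplexCategory.δ i) = 0 := by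
    by_cases h : ∃ b' : ⦋m⦌ ⟶ ⦋n⦌, b ≫ SimplexCategory.δ i = b' ≫ SimplexCategory.δ 0
    · obtain ⟨b', hb'⟩ := h
      rw [hb', hF, val_of_not_surjective hz w (not_surjective_of_comp_delta hi hb'.symm)]
    · exact dif_neg h
  -- Naturality needs the simplex to lie in the union: elsewhere `F` is zero, yet an operator may
  -- carry such a simplex into face `0`.
  have hFn (l m : ℕ) (c : ⦋l⦌ ⟶ ⦋m⦌) (w : W.obj (op ⦋m⦌)) (a : ⦋m⦌ ⟶ ⦋n + 1⦌)
      (h : (w, SSet.stdSimplex.objEquiv.symm a) ∈ (A.unionProd ∂Δ[n + 1]).obj (op ⦋m⦌)) :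
      F l (W.map c.op w) (c ≫ a) = G.act c (F m w a) := by
    by_cases h₀ : ∃ b : ⦋m⦌ ⟶ ⦋n⦌, a = b ≫ SimplexCategory.δ 0
    · obtain ⟨b, rfl⟩ := h₀
      rw [← Category.assoc, hF, hF, act_val]
    · rcases (SSet.Subcomplex.mem_unionProd_iff _ _ _).mp h with h | h
      · obtain ⟨i, b, rfl⟩ := SimplexCategory.eq_comp_δ_of_not_surjective a h
        have hi : i ≠ 0 := by
          rintro rfl
          exact h₀ ⟨b, rfl⟩
        rw [← Category.assoc, hF₂ _ _ _ _ hi, hF₂ _ _ _ _ hi, map_zero]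
      · rw [hF₁ _ _ _ h, hF₁ _ _ _ (A.map c.op h), map_zero]
  refine ⟨homMk (fun k x => F k.unop.len x.1.1 (SSet.stdSimplex.objEquiv x.1.2))
    (fun {k l} a x => hFn _ _ a.unop _ _ x.2), fun m w a h => ⟨fun hw => hF₁ _ _ _ hw, ?_, ?_⟩⟩
  · rintro b rfl
    exact hF _ _ _
  · rintro ⟨b, i, hi, rfl⟩
    exact hF₂ _ _ _ _ hi

/-- If maps from `A × Δⁿ⁺¹ ∪ W × ∂Δⁿ⁺¹` to `G` extend, then the function complex is acyclic. -/
lemma cycles_mapGrp_le_null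
    (hext : ∀ (n : ℕ) (f : (A.unionProd ∂Δ[n + 1] : SSet.{u}) ⟶ G.ss),
      ∃ g : W ⊗ Δ[n + 1] ⟶ G.ss, (A.unionProd ∂Δ[n + 1]).ι ≫ g = f)
    (n : ℕ) : (mapGrp W A G).cycles n ≤ (mapGrp W A G).null 0 n := by
  intro z hz
  obtain ⟨f, hf⟩ := exists_extension_by_zero z hz
  obtain ⟨g, rfl⟩ := hext n f
  have hmem (m : ℕ) (w : W.obj (op ⦋m⦌)) (b : ⦋m⦌ ⟶ ⦋n⦌) (i : Fin (n + 2)) :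
      (w, SSet.stdSimplex.objEquiv.symm (b ≫ SimplexCategory.δ i)) ∈ (A.unionProd ∂Δ[n + 1]).obj (op ⦋m⦌) := by
    refine (SSet.Subcomplex.mem_unionProd_iff _ _ _).mpr (Or.inl fun hs => ?_)
    obtain ⟨j, hj⟩ := hs i
    exact Fin.succAbove_ne i (b.toOrderHom j) hj
  -- The extension `g` is itself an `(n + 1)`-simplex of the function complex, with face `0` equal
  -- to `z` and the other faces zero.
  refine ⟨ofHom g fun k w hw t => ?_, val_ext fun m w b => ?_, fun i hi hi0 => val_ext fun m w b => ?_⟩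
  · exact (hf k.unop.len w (SSet.stdSimplex.objEquiv t)
      ((SSet.Subcomplex.mem_unionProd_iff _ _ _).mpr (Or.inr hw))).1 hw
  · exact (hf m w _ (hmem m w b 0)).2.1 b rfl
  · exact (hf m w _ (hmem m w b (Fin.ofNat (n + 2) i))).2.2 ⟨b, Fin.ofNat (n + 2) i, fun h => hi0 (by
      have := congrArg Fin.val h
      simpa [Fin.ofNat, Nat.mod_eq_of_lt (show i < n + 2 by omega)] using this), rfl⟩

end SAb

namespace SAb

variable {G H P Q : SAb.{u}} {k l m n : ℕ}

/-! ### Surjections with acyclic kernel -/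

/-- This is relative filling for the horn whose faces are all zero. -/
lemma exists_normalized_lift (φ : P ⟶ H) (hφ : ∀ n, Function.Surjective (ap φ n)) (y : H.obj (op ⦋n + 1⦌))
    (hy : ∀ i ≤ n + 1, i ≠ 0 → H.d i y = 0) :
    ∃ u : P.obj (op ⦋n + 1⦌), ap φ (n + 1) u = y ∧ ∀ i ≤ n + 1, i ≠ 0 → P.d i u = 0 :=
  exists_filler φ hφ 0 (Nat.zero_le _) (fun _ => 0) y (fun j hj h => by rw [map_zero, hy j hj h])
    (by
      rintro p rfl j k - - - -
      dsimp only
      rw [map_zero, map_zero])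

/-- A normalized lift `u` of `y` may have the wrong face `0`. The error is a cycle of the kernel
`Q`, hence face `0` of some `v` in `Q` with no other faces, and subtracting `v` corrects it without
changing the image. -/
lemma exists_lift_of_acyclic_kernel (ψ : Q ⟶ P) (φ : P ⟶ H) (hφ : ∀ n, Function.Surjective (ap φ n))
    (hψ : ∀ n, Function.Injective (ap ψ n)) (hψφ : ∀ n q, ap φ n (ap ψ n q) = 0)
    (hex : ∀ n u, ap φ n u = 0 → ∃ q, ap ψ n q = u) (hQ : ∀ n, Q.cycles n ≤ Q.null 0 n)
    (y : H.obj (op ⦋n + 1⦌)) (hy : ∀ i ≤ n + 1, i ≠ 0 → H.d i y = 0) (w : P.obj (op ⦋n⦌)) (hw : w ∈ P.cycles n)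
    (hwy : ap φ n w = H.d 0 y) :
    ∃ u : P.obj (op ⦋n + 1⦌), ap φ (n + 1) u = y ∧ P.d 0 u = w ∧ ∀ i ≤ n + 1, i ≠ 0 → P.d i u = 0 := by
  obtain ⟨u, hu, hui⟩ := exists_normalized_lift φ hφ y hy
  have hc : P.d 0 u - w ∈ P.cycles n :=
    sub_mem (null_le_cycles (Nat.zero_le _) ⟨u, rfl, hui⟩) hw
  obtain ⟨q, hq⟩ := hex n (P.d 0 u - w) (by rw [map_sub, ap_d, hu, hwy, sub_self])
  obtain ⟨v, hv, hvi⟩ := hQ n (mem_cycles_of_ap ψ hψ (hq ▸ hc))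
  refine ⟨u - ap ψ _ v, ?_, ?_, fun i hi hi0 => ?_⟩
  · rw [map_sub, hu, hψφ, sub_zero]
  · rw [map_sub, ← ap_d, hv, hq]; abel
  · rw [map_sub, ← ap_d, hvi i hi hi0, hui i hi hi0, map_zero, sub_zero]

lemma exists_cycle_lift_of_acyclic_kernel (ψ : Q ⟶ P) (φ : P ⟶ H) (hφ : ∀ n, Function.Surjective (ap φ n))
    (hψ : ∀ n, Function.Injective (ap ψ n)) (hψφ : ∀ n q, ap φ n (ap ψ n q) = 0)
    (hex : ∀ n u, ap φ n u = 0 → ∃ q, ap ψ n q = u) (hQ : ∀ n, Q.cycles n ≤ Q.null 0 n)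
    (h : H.obj (op ⦋n⦌)) (hh : h ∈ H.cycles n) : ∃ u ∈ P.cycles n, ap φ n u = h := by
  obtain _ | n := n
  · obtain ⟨u, hu⟩ := hφ 0 h
    exact ⟨u, mem_cycles_zero u, hu⟩
  · obtain ⟨u, hu, h₀, h₁⟩ := exists_lift_of_acyclic_kernel ψ φ hφ hψ hψφ hex hQ h
      (fun i hi _ => d_eq_zero_of_mem_cycles hh hi) 0 (zero_mem _)
      (by rw [map_zero, d_eq_zero_of_mem_cycles hh (Nat.zero_le _)])
    refine ⟨u, mem_cycles_succ.mpr fun i hi => ?_, hu⟩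
    by_cases hi0 : i = 0
    · rw [hi0, h₀]
    · exact h₁ i hi hi0

/-! ### Path and loop objects -/

open SSet.modelCategoryQuillen HomotopicalAlgebra in
-- The product of an anodyne inclusion with `Δ[n]` is anodyne, so the zero map on `A × Δ[n]` extends
-- to a lift along the Kan fibration `ssMap φ`.
lemma mapGrpMap_surjective {W : SSet.{u}} {A : W.Subcomplex} (hA : SSet.anodyneExtensions A.ι) (φ : G ⟶ H)
    (hφ : ∀ n, Function.Surjective (ap φ n)) (n : ℕ) : Function.Surjective (ap (mapGrpMap W A φ) n) := by
  intro v
  have := fibration_ssMap φ hφ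
  have := (hA.whiskerRight Δ[n]) (ssMap φ) ((HomotopicalAlgebra.fibration_iff _).mp this)
  have sq : CommSq (0 : (A : SSet.{u}) ⊗ Δ[n] ⟶ G.ss) (A.ι ▷ Δ[n]) (ssMap φ) (toHom v) := ⟨by
    refine hom_ext_app fun k x => ?_
    exact (map_zero (φ.app k).hom).trans (v.2 k x.1.1 x.1.2 x.2).symm⟩
  refine ⟨ofHom sq.lift fun m w hw t => ?_, Subtype.ext sq.fac_right⟩
  exact congrArg (fun f : (A : SSet.{u}) ⊗ Δ[n] ⟶ G.ss => hv f (⟨w, hw⟩, t)) sq.fac_left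

open SSet.modelCategoryQuillen HomotopicalAlgebra in
-- The inclusion of `A × Δⁿ⁺¹ ∪ W × ∂Δⁿ⁺¹` is anodyne together with `A.ι`, and `G` is a Kan complex.
lemma cycles_mapGrp_le_null_of_anodyne {W : SSet.{u}} {A : W.Subcomplex} (hA : SSet.anodyneExtensions A.ι) (n : ℕ) :
    (mapGrp W A G).cycles n ≤ (mapGrp W A G).null 0 n :=
  cycles_mapGrp_le_null (fun n f => by
    have := kanComplex G
    have := (SSet.anodyneExtensions_unionProd_ι' A ∂Δ[n + 1] hA) (terminal.from G.ss)
      ((HomotopicalAlgebra.fibration_iff _).mp ((isFibrant_iff _).mp this))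
    have sq : CommSq f (A.unionProd ∂Δ[n + 1]).ι (terminal.from G.ss) (terminal.from _) := ⟨by subsingleton⟩
    exact ⟨sq.lift, sq.fac_left⟩) n

lemma cycles_mapGrp_le_null_of_acyclic (hG : ∀ n, G.cycles n ≤ G.null 0 n) {W : SSet.{u}} {A : W.Subcomplex} (n : ℕ) :
    (mapGrp W A G).cycles n ≤ (mapGrp W A G).null 0 n :=
  cycles_mapGrp_le_null (fun _ f => exists_extension_of_acyclic hG _ f) n

/-- Restriction to maps vanishing on a larger subcomplex. -/
def mapGrpIncl {W : SSet.{u}} {A B : W.Subcomplex} (h : A ≤ B) (G : SAb.{u}) : mapGrp W B G ⟶ mapGrp W A G where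
  app k := AddCommGrpCat.ofHom
    { toFun f := ⟨f.1, fun m w hw t => f.2 m w (h m hw) t⟩
      map_zero' := rfl
      map_add' _ _ := rfl }

lemma mapGrpIncl_injective {W : SSet.{u}} {A B : W.Subcomplex} (h : A ≤ B) (n : ℕ) :
    Function.Injective (ap (mapGrpIncl h G) n) := fun f g e =>
  Subtype.ext (show (ap (mapGrpIncl h G) n f).1 = (ap (mapGrpIncl h G) n g).1 from congrArg Subtype.val e)

lemma mapGrpMap_injective {W : SSet.{u}} {A : W.Subcomplex} {φ : G ⟶ H} (hφ : ∀ n, Function.Injective (ap φ n)) (n : ℕ) :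
    Function.Injective (ap (mapGrpMap W A φ) n) := fun _ _ e => val_ext fun m w a =>
  hφ m (congrArg (fun f => val f w a) e)

lemma val_mapGrpIncl {W : SSet.{u}} {A B : W.Subcomplex} (h : A ≤ B) (f : (mapGrp W B G).obj (op ⦋n⦌))
    (w : W.obj (op ⦋m⦌)) (a : ⦋m⦌ ⟶ ⦋n⦌) : val (ap (mapGrpIncl h G) n f) w a = val f w a := rfl

/-- Exactness passes to function complexes: every value of `u` is a constant tuple, and its entry
`0` depends naturally on the simplex. -/
lemma exists_mapGrpMap_toTot_eq {W : SSet.{u}} {A : W.Subcomplex} (u : (mapGrp W A (tot G)).obj (op ⦋n⦌))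
    (hu : ap (mapGrpMap W A (totToBar G)) n u = 0) : ∃ q, ap (mapGrpMap W A (toTot G)) n q = u := by
  have h (k : SimplexCategoryᵒᵖ) (x : (W ⊗ Δ[n]).obj k) :
      hv (toHom u) x = ap (toTot G) k.unop.len ((hv (toHom u) x : Fin (k.unop.len + 1) → G.obj k) 0) :=
    exists_of_totToBar_eq_zero (G := G) (n := k.unop.len) (hv (toHom u) x)
      (congrArg (fun f => hv (toHom f) x) hu)
  have hn {k l : SimplexCategoryᵒᵖ} (a : k ⟶ l) (x : (W ⊗ Δ[n]).obj k) :
      (hv (toHom u) ((W ⊗ Δ[n]).map a x) : Fin (l.unop.len + 1) → G.obj l) 0 =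
        G.map a ((hv (toHom u) x : Fin (k.unop.len + 1) → G.obj k) 0) := by
    rw [hv_map, h k x]
    rfl
  refine ⟨ofHom (homMk (fun k x => (hv (toHom u) x : Fin (k.unop.len + 1) → G.obj k) 0) hn) fun m w hw t => ?_, ?_⟩
  · exact congrFun (u.2 m w hw t) (0 : Fin (m.unop.len + 1))
  · exact Subtype.ext (hom_ext_app fun k x => (h k x).symm)

/-! ### Paths in the total space and loops in the bar construction. -/

/-- The vertex `0` of the interval. -/
abbrev startPt : (Δ[1] : SSet.{u}).Subcomplex := SSet.horn 1 0

/-- The horn `Λ¹₀` omits the face opposite `0`. What remains is the face opposite `1`, which is the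
vertex `0`. -/
lemma mem_startPt_iff (w : (Δ[1] : SSet.{u}).obj (op ⦋m⦌)) :
    w ∈ startPt.obj _ ↔ ∀ j : Fin (m + 1), (SSet.stdSimplex.objEquiv w).toOrderHom j = (0 : Fin 2) := by
  rw [SSet.mem_horn_iff_notMem_range]
  constructor
  · rintro ⟨j, hj, h⟩ r
    have : (SSet.stdSimplex.objEquiv w).toOrderHom r ≠ j := fun e => h ⟨r, e⟩
    clear h
    revert this hj
    generalize (SSet.stdSimplex.objEquiv w).toOrderHom r = q
    change Fin 2 at q
    revert j q
    decide
  · intro h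
    refine ⟨1, by decide, ?_⟩
    rintro ⟨r, hr⟩
    exact absurd ((h r).symm.trans hr) (by decide)

lemma startPt_le : startPt.{u} ≤ ∂Δ[1] := horn_le_boundary _

/-- The constant simplices at the vertex `1` of the interval. -/
def endPt (m : ℕ) : (Δ[1] : SSet.{u}).obj (op ⦋m⦌) := SSet.stdSimplex.objMk (OrderHom.const _ (1 : Fin 2))

lemma endPt_mem : endPt.{u} m ∈ (∂Δ[1] : (Δ[1] : SSet.{u}).Subcomplex).obj (op ⦋m⦌) := by
  intro h
  obtain ⟨i, hi⟩ := h (0 : Fin 2)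
  exact absurd hi (by change ¬ ((1 : Fin 2) = 0); decide)

lemma mem_boundary_iff (w : (Δ[1] : SSet.{u}).obj (op ⦋m⦌)) (hw : w ∈ (∂Δ[1] : (Δ[1] : SSet.{u}).Subcomplex).obj (op ⦋m⦌)) :
    w ∈ startPt.obj (op ⦋m⦌) ∨ w = endPt m := by
  obtain ⟨j, hj⟩ := (SSet.mem_boundary_iff_notMem_range w).mp hw
  change Fin 2 at j
  by_cases h : j = 1
  · exact Or.inl ((SSet.mem_horn_iff_notMem_range _ _).mpr ⟨j, by rw [h]; decide, hj⟩)
  · refine Or.inr (SSet.stdSimplex.ext _ _ fun r => ?_)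
    have : w r ≠ j := fun e => hj ⟨r, e⟩
    clear hj
    change w r = (1 : Fin 2)
    generalize w r = q at *
    change Fin 2 at q
    revert j q
    decide

/-- The value at the end of a path. -/
def endVal {A : (Δ[1] : SSet.{u}).Subcomplex} (f : (mapGrp Δ[1] A G).obj (op ⦋n⦌)) : G.obj (op ⦋n⦌) := val f (endPt n) (𝟙 _)

lemma act_endVal {A : (Δ[1] : SSet.{u}).Subcomplex} (f : (mapGrp Δ[1] A G).obj (op ⦋n⦌)) (b : ⦋m⦌ ⟶ ⦋n⦌) :
    G.act b (endVal f) = val f (endPt m) b := by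
  unfold endVal
  rw [act_val, Category.comp_id]
  rfl

lemma act_endVal' {A : (Δ[1] : SSet.{u}).Subcomplex} (f : (mapGrp Δ[1] A G).obj (op ⦋n⦌)) (b : ⦋m⦌ ⟶ ⦋n⦌) :
    G.act b (endVal f) = endVal ((mapGrp Δ[1] A G).act b f) := by
  rw [act_endVal]
  unfold endVal
  rw [val_act, Category.id_comp]

/-- The tuple with entry `x` where the simplex `w` of the interval is at the vertex `1`. -/
def pathTuple {M : Type u} [AddCommGroup M] {k : SimplexCategoryᵒᵖ} (w : (Δ[1] : SSet.{u}).obj k) (x : M) :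
    Fin (k.unop.len + 1) → M := fun j =>
  if (SSet.stdSimplex.objEquiv w).toOrderHom j = (1 : Fin 2) then x else 0

lemma pathTuple_zero {M : Type u} [AddCommGroup M] {k : SimplexCategoryᵒᵖ} (w : (Δ[1] : SSet.{u}).obj k) :
    pathTuple w (0 : M) = 0 := funext fun _ => ite_self _

lemma pathTuple_add {M : Type u} [AddCommGroup M] {k : SimplexCategoryᵒᵖ} (w : (Δ[1] : SSet.{u}).obj k) (x y : M) :
    pathTuple w (x + y) = pathTuple w x + pathTuple w y := by
  funext j
  rw [Pi.add_apply]
  unfold pathTuple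
  split_ifs
  · rfl
  · exact (add_zero _).symm

lemma pathTuple_map {M N : Type u} [AddCommGroup M] [AddCommGroup N] (φ : M →+ N) {k l : SimplexCategoryᵒᵖ}
    (a : k ⟶ l) (w : (Δ[1] : SSet.{u}).obj k) (x : M) :
    pathTuple ((Δ[1] : SSet.{u}).map a w) (φ x) = fun j => φ (pathTuple w x (a.unop.toOrderHom j)) := by
  funext j
  unfold pathTuple
  rw [apply_ite φ, map_zero]
  rfl

lemma pathTuple_of_mem {M : Type u} [AddCommGroup M] {k : SimplexCategoryᵒᵖ} (w : (Δ[1] : SSet.{u}).obj k)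
    (hw : w ∈ startPt.obj k) (x : M) : pathTuple w x = 0 := funext fun j =>
  if_neg (fun h => absurd (((mem_startPt_iff (m := k.unop.len) w).mp hw j).symm.trans h) (by decide))

lemma circleTuple_add {M : Type u} [AddCommGroup M] {k : SimplexCategoryᵒᵖ}
    (s : PSSet.circle.{u}.sset.obj k) (x y : M) :
    circleTuple s (x + y) = circleTuple s x + circleTuple s y := by
  obtain ⟨α⟩ := s
  rw [circleTuple_mk, circleTuple_mk, circleTuple_mk, ← map_add]
  rfl

/-- The simplicial path of `x` from `0` to `x` in the total space. -/
def pathTot (G : SAb.{u}) : G ⟶ mapGrp Δ[1] startPt (tot G) where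
  app k := AddCommGrpCat.ofHom
    { toFun x := ⟨homMk (fun l z => (pathTuple z.1 ((G.map (SSet.stdSimplex.objEquiv z.2).op).hom x) : Fin (l.unop.len + 1) → G.obj l))
          (fun {l m} a z => by
            refine Eq.trans ?_ (pathTuple_map (G.map a).hom a z.1 _)
            refine congrArg (pathTuple _) ?_
            change _ = G.map a (G.map _ x)
            rw [← Functor.map_comp_apply]
            rfl), fun _ w hw _ => pathTuple_of_mem w hw _⟩
      map_zero' := Subtype.ext (hom_ext_app fun m z =>
        (congrArg (pathTuple z.1) (map_zero (G.map (SSet.stdSimplex.objEquiv z.2).op).hom)).trans (pathTuple_zero _))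
      map_add' x y := Subtype.ext (hom_ext_app fun m z =>
        (congrArg (pathTuple z.1) (map_add (G.map (SSet.stdSimplex.objEquiv z.2).op).hom x y)).trans
          (pathTuple_add _ _ _)) }
  naturality k l a := by
    refine AddCommGrpCat.hom_ext (AddMonoidHom.ext fun x =>
      Subtype.ext (hom_ext_app fun m z => congrArg (pathTuple z.1) ?_))
    change G.map _ (G.map a x) = G.map _ x
    rw [← Functor.map_comp_apply]
    rfl

lemma val_pathTot (x : G.obj (op ⦋n⦌)) (w : (Δ[1] : SSet.{u}).obj (op ⦋m⦌)) (a : ⦋m⦌ ⟶ ⦋n⦌) (j : Fin (m + 1)) :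
    (val (ap (pathTot G) n x) w a : Fin (m + 1) → G.obj (op ⦋m⦌)) j =
      if (SSet.stdSimplex.objEquiv w).toOrderHom j = (1 : Fin 2) then G.act a x else 0 := rfl

lemma circleVertex_mem (k : SimplexCategoryᵒᵖ) :
    (Δ[1] : SSet.{u}).map (k.unop.const ⦋0⦌ 0).op
      (SSet.stdSimplex.objMk (m := op ⦋0⦌) ⟨fun _ => (0 : Fin 2), fun _ _ _ => le_rfl⟩) ∈
        (∂Δ[1] : (Δ[1] : SSet.{u}).Subcomplex).obj k :=
  (∂Δ[1] : (Δ[1] : SSet.{u}).Subcomplex).map _ (by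
    intro h
    obtain ⟨i, hi⟩ := h (1 : Fin 2)
    exact absurd hi (by change ¬ ((0 : Fin 2) = 1); decide))

lemma mk_eq_circle_base {k : SimplexCategoryᵒᵖ} {w : (Δ[1] : SSet.{u}).obj k}
    (hw : w ∈ (∂Δ[1] : (Δ[1] : SSet.{u}).Subcomplex).obj k) :
    (Quot.mk _ w : PSSet.circle.{u}.sset.obj k) = PSSet.circle.base k :=
  Quot.sound (Or.inr ⟨hw, circleVertex_mem k⟩)

/-- The simplicial loop in the bar construction given by the suspension of a simplex. -/
def loopBar (G : SAb.{u}) : G ⟶ mapGrp Δ[1] ∂Δ[1] (bar G) where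
  app k := AddCommGrpCat.ofHom
    { toFun x := ⟨homMk (fun l z => circleTuple (Quot.mk _ z.1) (G.map (SSet.stdSimplex.objEquiv z.2).op x))
          (fun {l m} a z => by
            refine Eq.trans ?_ (circleTuple_map (G.map a).hom a (Quot.mk _ z.1) _)
            refine congrArg (circleTuple _) ?_
            change _ = G.map a (G.map _ x)
            rw [← Functor.map_comp_apply]
            rfl), fun m w hw t => by
          change circleTuple (Quot.mk _ w) _ = 0
          rw [mk_eq_circle_base hw]
          exact circleTuple_base m _⟩
      map_zero' := Subtype.ext (hom_ext_app fun m z =>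
        (congrArg (circleTuple (Quot.mk _ z.1)) (map_zero (G.map (SSet.stdSimplex.objEquiv z.2).op).hom)).trans
          (circleTuple_zero (M := G.obj m) _))
      map_add' x y := Subtype.ext (hom_ext_app fun m z =>
        (congrArg (circleTuple (Quot.mk _ z.1)) (map_add (G.map (SSet.stdSimplex.objEquiv z.2).op).hom x y)).trans
          (circleTuple_add _ _ _)) }
  naturality k l a := by
    refine AddCommGrpCat.hom_ext (AddMonoidHom.ext fun x => Subtype.ext (hom_ext_app fun m z => ?_))
    refine congrArg (circleTuple (M := G.obj m) (Quot.mk _ z.1)) ?_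
    change G.map _ (G.map a x) = G.map _ x
    rw [← Functor.map_comp_apply]
    rfl

lemma val_pathTot_endPt (x : G.obj (op ⦋n⦌)) (a : ⦋m⦌ ⟶ ⦋n⦌) :
    val (ap (pathTot G) n x) (endPt m) a = ap (toTot G) m (G.act a x) :=
  funext fun j : Fin (m + 1) => (val_pathTot x (endPt m) a j).trans (if_pos rfl)

lemma endVal_pathTot (x : G.obj (op ⦋n⦌)) : endVal (ap (pathTot G) n x) = ap (toTot G) n x := by
  unfold endVal
  rw [val_pathTot_endPt, act_id]

/-- The path tuple is `0` before the jump of `w` and `x` from the jump on, so its only possibly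
nonzero difference is the `x` at the jump. That is the circle tuple. -/
lemma totToBar_pathTot (x : G.obj (op ⦋n⦌)) :
    ap (mapGrpMap Δ[1] startPt (totToBar G)) n (ap (pathTot G) n x) =
      ap (mapGrpIncl startPt_le (bar G)) n (ap (loopBar G) n x) := by
  refine val_ext fun m w a => funext fun j : Fin m => ?_
  refine (ap_totToBar (G := G) (n := m) (val (ap (pathTot G) n x) w a) j).trans ?_
  rw [val_pathTot, val_pathTot]
  change _ = if (SSet.stdSimplex.objEquiv w).toOrderHom j.castSucc =
    (SSet.stdSimplex.objEquiv w).toOrderHom j.succ then 0 else G.act a x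
  have hm := (SSet.stdSimplex.objEquiv w).toOrderHom.monotone (Fin.castSucc_lt_succ (i := j)).le
  revert hm
  generalize (SSet.stdSimplex.objEquiv w).toOrderHom j.castSucc = p
  generalize (SSet.stdSimplex.objEquiv w).toOrderHom j.succ = q
  change Fin 2 at p q
  intro hm
  fin_cases p <;> fin_cases q
  · exact (sub_zero (0 : G.obj (op ⦋m⦌)))
  · exact (sub_zero (G.act a x))
  · exact absurd hm (by decide)
  · exact (sub_self (G.act a x))

/-- Paths in the total space. -/
abbrev PathTot (G : SAb.{u}) : SAb.{u} := mapGrp Δ[1] startPt (tot G)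

/-- Paths in the bar construction. -/
abbrev PathBar (G : SAb.{u}) : SAb.{u} := mapGrp Δ[1] startPt (bar G)

lemma anodyne_startPt : SSet.anodyneExtensions (startPt.{u}).ι := SSet.anodyneExtensions.horn_ι (0 : Fin 2)

/-- The lifting lemmas for paths. -/
lemma exists_pathTot_lift (y : (PathBar G).obj (op ⦋n + 1⦌)) (hy : ∀ i ≤ n + 1, i ≠ 0 → (PathBar G).d i y = 0)
    (w : (PathTot G).obj (op ⦋n⦌)) (hw : w ∈ (PathTot G).cycles n)
    (hwy : ap (mapGrpMap Δ[1] startPt (totToBar G)) n w = (PathBar G).d 0 y) :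
    ∃ u : (PathTot G).obj (op ⦋n + 1⦌), ap (mapGrpMap Δ[1] startPt (totToBar G)) (n + 1) u = y ∧
      (PathTot G).d 0 u = w ∧ ∀ i ≤ n + 1, i ≠ 0 → (PathTot G).d i u = 0 :=
  exists_lift_of_acyclic_kernel (mapGrpMap Δ[1] startPt (toTot G)) _
    (mapGrpMap_surjective anodyne_startPt _ totToBar_surjective) (mapGrpMap_injective toTot_injective)
    (fun _ q => val_ext fun _ w a => totToBar_toTot (val q w a))
    (fun _ u hu => exists_mapGrpMap_toTot_eq u hu) (cycles_mapGrp_le_null_of_anodyne anodyne_startPt) y hy w hw hwy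

lemma exists_pathTot_cycle_lift (h : (PathBar G).obj (op ⦋n⦌)) (hh : h ∈ (PathBar G).cycles n) :
    ∃ u ∈ (PathTot G).cycles n, ap (mapGrpMap Δ[1] startPt (totToBar G)) n u = h :=
  exists_cycle_lift_of_acyclic_kernel (mapGrpMap Δ[1] startPt (toTot G)) _
    (mapGrpMap_surjective anodyne_startPt _ totToBar_surjective) (mapGrpMap_injective toTot_injective)
    (fun _ q => val_ext fun _ w a => totToBar_toTot (val q w a))
    (fun _ u hu => exists_mapGrpMap_toTot_eq u hu) (cycles_mapGrp_le_null_of_anodyne anodyne_startPt) h hh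

/-- The end of `u` projects to the end of a loop, which is `0`, so it lies in the fibre `G`. -/
lemma exists_endVal_eq (u : (PathTot G).obj (op ⦋n⦌)) (h : (mapGrp Δ[1] ∂Δ[1] (bar G)).obj (op ⦋n⦌))
    (hu : ap (mapGrpMap Δ[1] startPt (totToBar G)) n u = ap (mapGrpIncl startPt_le (bar G)) n h) :
    ∃ g, endVal u = ap (toTot G) n g := by
  refine ⟨_, exists_of_totToBar_eq_zero (endVal u) ?_⟩
  change ap (totToBar G) n (val u (endPt n) (𝟙 _)) = 0
  rw [← val_mapGrpMap, hu, val_mapGrpIncl, val_of_mem _ endPt_mem]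

/-- The map `G ⟶ Ω B G` adjoint to the bonding map is an isomorphism on homotopy groups. -/
lemma isPiIso_loopBar (G : SAb.{u}) : IsPiIso (loopBar G) where
  surj n h hh := by
    -- The preimage of a loop `h` is the endpoint `g` of a lifted path `u`.
    obtain ⟨u, hu, huh⟩ := exists_pathTot_cycle_lift _ (ap_mem_cycles (mapGrpIncl startPt_le (bar G)) hh)
    obtain ⟨g, hg⟩ := exists_endVal_eq u h huh
    refine ⟨g, fun m b hb => toTot_injective _ ?_, ?_⟩
    · rw [ap_act, ← hg, act_endVal', hu _ b hb, map_zero]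
      rfl
    -- The paths `pathTot g` and `u` have the same ends, so their difference is a loop `v` in the
    -- acyclic `tot G`. It is therefore null, and it projects to `loopBar g - h`.
    · have hv : ∀ {m : ℕ} (w : (Δ[1] : SSet.{u}).obj (op ⦋m⦌)) (_ : w ∈ (∂Δ[1] : (Δ[1] : SSet.{u}).Subcomplex).obj _) (a : ⦋m⦌ ⟶ ⦋n⦌),
          val (ap (pathTot G) n g - u) w a = 0 := by
        intro m w hw a
        rcases mem_boundary_iff w hw with hw | rfl
        · exact val_of_mem _ hw a
        · rw [val_sub, val_pathTot_endPt, ← act_endVal, hg, ap_act, sub_self]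
      let v : (mapGrp Δ[1] ∂Δ[1] (tot G)).obj (op ⦋n⦌) := ofHom (toHom (ap (pathTot G) n g - u))
        fun m w hw t => hv w hw (SSet.stdSimplex.objEquiv t)
      have hvi : ap (mapGrpIncl startPt_le (tot G)) n v = ap (pathTot G) n g - u := rfl
      have hgc : g ∈ G.cycles n := fun m b hb => toTot_injective _ (by
        rw [ap_act, ← hg, act_endVal', hu _ b hb, map_zero]
        rfl)
      have hvc : v ∈ (mapGrp Δ[1] ∂Δ[1] (tot G)).cycles n :=
        mem_cycles_of_ap _ (mapGrpIncl_injective startPt_le) (hvi ▸ sub_mem (ap_mem_cycles _ hgc) hu)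
      have := ap_mem_null (mapGrpMap Δ[1] ∂Δ[1] (totToBar G))
        (cycles_mapGrp_le_null_of_acyclic (fun n => cycles_tot_le_null) n hvc)
      convert this using 1
      apply mapGrpIncl_injective startPt_le
      rw [map_sub, ← totToBar_pathTot, ← huh, ← map_sub]
      rfl
  inj n g hg := by
    rintro ⟨y, hy, hyi⟩
    -- The null witness `y` lifts to a simplex of paths with face `0` equal to `pathTot g`. The
    -- endpoint of this lift is a null witness for `g`.
    obtain ⟨u, huy, hu, hui⟩ := exists_pathTot_lift (ap (mapGrpIncl startPt_le (bar G)) (n + 1) y)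
      (fun i hi hi0 => by rw [← ap_d, hyi i hi hi0, map_zero]) (ap (pathTot G) n g) (ap_mem_cycles _ hg)
      (by rw [totToBar_pathTot, ← ap_d, hy])
    obtain ⟨g', hg'⟩ := exists_endVal_eq u y huy
    refine ⟨g', toTot_injective _ ?_, fun i hi hi0 => toTot_injective _ ?_⟩
    · rw [ap_d, ← hg', ← endVal_pathTot, ← hu]
      exact act_endVal' _ _
    · rw [ap_d, ← hg', map_zero]
      refine (act_endVal' _ _).trans ?_
      change endVal ((PathTot G).d i u) = 0
      rw [hui i hi hi0]
      rfl

end SAb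

/-! ### Weak equivalences in terms of simplices -/

namespace SSet

variable {X Y : SSet.{u}} {n m : ℕ}

/-- The degenerate simplex at a vertex. -/
def cst (X : SSet.{u}) (n : ℕ) (x : X _⦋0⦌) : X _⦋n⦌ := X.map (SimplexCategory.const ⦋n⦌ ⦋0⦌ 0).op x

lemma app_cst (φ : X ⟶ Y) (x : X _⦋0⦌) : φ.app _ (X.cst n x) = Y.cst n (φ.app _ x) :=
  NatTrans.naturality_apply φ _ x

/-- The simplices with boundary at `x`. -/
def IsPt (X : SSet.{u}) (n : ℕ) (x : X _⦋0⦌) (f : X _⦋n⦌) : Prop :=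
  ∀ (m : ℕ) (b : ⦋m⦌ ⟶ ⦋n⦌), ¬ Function.Surjective b.toOrderHom → X.map b.op f = X.cst m x

/-- The relation defining homotopy groups, on simplices. -/
def PtRel (X : SSet.{u}) (n : ℕ) (x : X _⦋0⦌) (f g : X _⦋n⦌) : Prop :=
  ∃ y : X _⦋n + 1⦌, X.δ (Fin.last n).castSucc y = f ∧ X.δ (Fin.last n).succ y = g ∧
    ∀ j, j < (Fin.last n).castSucc → X.δ j y = X.cst n x

/-- Maps which are bijective on homotopy groups, defined by simplices; the homotopy relation of the target is
required to be an equivalence relation. -/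
structure IsPiEquiv (φ : X ⟶ Y) : Prop where
  refl (n : ℕ) (y : Y _⦋0⦌) (f) (hf : Y.IsPt n y f) : Y.PtRel n y f f
  symm (n : ℕ) (y : Y _⦋0⦌) (f g) (hf : Y.IsPt n y f) (hg : Y.IsPt n y g) (h : Y.PtRel n y f g) : Y.PtRel n y g f
  trans (n : ℕ) (y : Y _⦋0⦌) (f g h) (hf : Y.IsPt n y f) (hg : Y.IsPt n y g) (hh : Y.IsPt n y h)
    (_ : Y.PtRel n y f g) (_ : Y.PtRel n y g h) : Y.PtRel n y f h
  surj (n : ℕ) (x : X _⦋0⦌) (h) (hh : Y.IsPt n (φ.app _ x) h) :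
    ∃ g, X.IsPt n x g ∧ Y.PtRel n (φ.app _ x) (φ.app _ g) h
  inj (n : ℕ) (x : X _⦋0⦌) (f g) (hf : X.IsPt n x f) (hg : X.IsPt n x g)
    (_ : Y.PtRel n (φ.app _ x) (φ.app _ f) (φ.app _ g)) : X.PtRel n x f g

lemma IsPt.map (φ : X ⟶ Y) {x : X _⦋0⦌} {f : X _⦋n⦌} (hf : X.IsPt n x f) : Y.IsPt n (φ.app _ x) (φ.app _ f) :=
  fun m b hb => by rw [← NatTrans.naturality_apply, hf m b hb, app_cst]

lemma PtRel.map (φ : X ⟶ Y) {x : X _⦋0⦌} {f g : X _⦋n⦌} (h : X.PtRel n x f g) :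
    Y.PtRel n (φ.app _ x) (φ.app _ f) (φ.app _ g) := by
  obtain ⟨y, rfl, rfl, hy⟩ := h
  exact ⟨φ.app _ y, (NatTrans.naturality_apply φ _ y).symm, (NatTrans.naturality_apply φ _ y).symm,
    fun j hj => (NatTrans.naturality_apply φ _ y).symm.trans ((congrArg _ (hy j hj)).trans (app_cst φ x))⟩

/-- The simplex underlying a map with constant boundary. -/
def PtSimplex.el {x : X _⦋0⦌} (f : X.PtSimplex n x) : X _⦋n⦌ := yonedaEquiv f.map

lemma PtSimplex.isPt_el {x : X _⦋0⦌} (f : X.PtSimplex n x) : X.IsPt n x f.el := fun m b hb => by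
  have e : stdSimplex.objEquiv.symm b = Δ[n].map b.op (stdSimplex.objEquiv.symm (𝟙 ⦋n⦌)) :=
    stdSimplex.objEquiv.injective (Category.comp_id b).symm
  refine (NatTrans.naturality_apply f.map b.op (stdSimplex.objEquiv.symm (𝟙 ⦋n⦌))).symm.trans ?_
  rw [← e]
  exact RelativeMorphism.map_eq_of_mem f (stdSimplex.objEquiv.symm b) hb

/-- The map with constant boundary given by a simplex. -/
def PtSimplex.ofEl {x : X _⦋0⦌} (f : X _⦋n⦌) (hf : X.IsPt n x f) : X.PtSimplex n x where
  map := yonedaEquiv.symm f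
  comm := by
    ext k ⟨a, ha⟩
    exact hf k.unop.len (stdSimplex.objEquiv a) ha

lemma PtSimplex.el_ofEl {x : X _⦋0⦌} (f : X _⦋n⦌) (hf : X.IsPt n x f) : (ofEl f hf).el = f :=
  yonedaEquiv.apply_symm_apply f

lemma PtSimplex.nonempty_relStruct_iff {x : X _⦋0⦌} (f g : X.PtSimplex n x) :
    Nonempty (f.RelStruct g (Fin.last n)) ↔ X.PtRel n x f.el g.el := by
  constructor
  · rintro ⟨r⟩
    refine ⟨yonedaEquiv r.map, ?_, ?_, fun j hj => ?_⟩
    · rw [← stdSimplex.yonedaEquiv_δ_comp, r.δ_castSucc_map]; rfl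
    · rw [← stdSimplex.yonedaEquiv_δ_comp, r.δ_succ_map]; rfl
    · rw [← stdSimplex.yonedaEquiv_δ_comp, r.δ_map_of_lt j hj]; rfl
  · rintro ⟨y, h₁, h₂, h₃⟩
    refine ⟨⟨yonedaEquiv.symm y, yonedaEquiv.injective ?_, yonedaEquiv.injective ?_,
      fun j hj => yonedaEquiv.injective ?_, fun j hj => ?_⟩⟩
    · rw [stdSimplex.yonedaEquiv_δ_comp, Equiv.apply_symm_apply, h₁]; rfl
    · rw [stdSimplex.yonedaEquiv_δ_comp, Equiv.apply_symm_apply, h₂]; rfl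
    · rw [stdSimplex.yonedaEquiv_δ_comp, Equiv.apply_symm_apply, h₃ j hj]; rfl
    · rw [Fin.succ_last] at hj
      exact absurd (Fin.le_last j) (not_le.mpr hj)

/-- Equality in `piSet` only yields the equivalence relation generated by homotopies. An equivalence
relation `r` containing them absorbs it. -/
lemma ptRel_of_eqvGen {x : X _⦋0⦌} {r : X.PtSimplex n x → X.PtSimplex n x → Prop}
    (hr : Equivalence r) (hrel : ∀ f g : X.PtSimplex n x, Nonempty (f.RelStruct g (Fin.last n)) → r f g)
    {f g : X.PtSimplex n x} (h : (Quot.mk _ f : PSSet.piSet n X x) = Quot.mk _ g) : r f g := by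
  have := Quot.eqvGen_exact h
  exact hr.eqvGen_iff.mp (this.mono hrel)

/-- Face `0` of an edge is its target and face `1` its source, hence the reversed order. -/
lemma ptRel_zero_iff {x x₀ x₁ : X _⦋0⦌} : X.PtRel 0 x x₁ x₀ ↔ Nonempty (Edge x₀ x₁) := by
  constructor
  · rintro ⟨y, h₁, h₂, -⟩
    exact ⟨⟨y, h₂, h₁⟩⟩
  · rintro ⟨e⟩
    exact ⟨e.edge, e.tgt_eq, e.src_eq, fun j hj => absurd hj (Fin.not_lt_zero j)⟩

lemma isPt_zero (x f : X _⦋0⦌) : X.IsPt 0 x f := fun _ _ hb =>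
  absurd (fun _ => ⟨0, Subsingleton.elim (α := Fin 1) _ _⟩) hb

lemma IsPiEquiv.equivalence {φ : X ⟶ Y} (h : IsPiEquiv φ) (n : ℕ) (y : Y _⦋0⦌) :
    Equivalence (fun f g : Y.PtSimplex n y => Y.PtRel n y f.el g.el) where
  refl f := h.refl n y _ f.isPt_el
  symm {f g} := h.symm n y _ _ f.isPt_el g.isPt_el
  trans {f g k} := h.trans n y _ _ _ f.isPt_el g.isPt_el k.isPt_el

/-- Maps bijective on homotopy groups in terms of simplices are weak equivalences. -/
lemma IsPiEquiv.isWeakEquiv {φ : X ⟶ Y} (h : IsPiEquiv φ) (x : X _⦋0⦌) : PSSet.IsWeakEquiv φ := by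
  refine ⟨⟨fun a b hab => ?_, fun b => ?_⟩, fun n x => ⟨fun a b hab => ?_, fun b => ?_⟩⟩
  · induction a with | mk a =>
    induction b with | mk b =>
    rw [mapπ₀_mk, mapπ₀_mk, π₀.mk_eq_mk_iff] at hab
    -- In degree `0` both `IsPt` and `PtRel` are independent of the base vertex, so the given `x`
    -- serves for all components.
    have he : Equivalence (fun f g : Y _⦋0⦌ => Y.PtRel 0 (φ.app _ x) g f) :=
      ⟨fun f => h.refl _ _ _ (isPt_zero _ _), fun {f g} => h.symm _ _ _ _ (isPt_zero _ _) (isPt_zero _ _),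
        fun {f g k} h₁ h₂ => h.trans _ _ _ _ _ (isPt_zero _ _) (isPt_zero _ _) (isPt_zero _ _) h₂ h₁⟩
    have := he.eqvGen_iff.mp (hab.mono fun f g hfg => ptRel_zero_iff.mpr hfg)
    obtain ⟨e⟩ := ptRel_zero_iff.mp (h.inj 0 x b a (isPt_zero _ _) (isPt_zero _ _) this)
    exact π₀.sound e
  · induction b with | mk b =>
    obtain ⟨g, -, hg⟩ := h.surj 0 x b (isPt_zero _ _)
    obtain ⟨e⟩ := ptRel_zero_iff.mp hg
    exact ⟨π₀.mk g, (π₀.sound e).symm⟩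
  · obtain ⟨a⟩ := a
    obtain ⟨b⟩ := b
    have := ptRel_of_eqvGen (h.equivalence _ _) (fun f g => (PtSimplex.nonempty_relStruct_iff f g).mp) hab
    exact Quot.sound ((PtSimplex.nonempty_relStruct_iff _ _).mpr (h.inj _ x _ _ a.isPt_el b.isPt_el this))
  · obtain ⟨b⟩ := b
    obtain ⟨g, hg, hgb⟩ := h.surj _ x _ b.isPt_el
    refine ⟨Quot.mk _ (PtSimplex.ofEl g hg), Quot.sound ((PtSimplex.nonempty_relStruct_iff _ _).mpr ?_)⟩
    convert hgb using 1
    exact congrArg (φ.app _) (PtSimplex.el_ofEl g hg)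

/-! ### Products -/

variable {J : Type*} {Xi Yi : J → SSet.{u}}

/-- Families of maps exhibiting `X` as a product. -/
def IsProd (p : ∀ i, X ⟶ Xi i) : Prop :=
  ∀ k, Function.Bijective (fun (x : X.obj k) i => (p i).app k x)

lemma IsProd.ext {p : ∀ i, X ⟶ Xi i} (hp : IsProd p) {k} {x y : X.obj k} (h : ∀ i, (p i).app k x = (p i).app k y) :
    x = y := (hp k).1 (funext h)

lemma IsProd.exists {p : ∀ i, X ⟶ Xi i} (hp : IsProd p) {k} (x : ∀ i, (Xi i).obj k) :
    ∃ y, ∀ i, (p i).app k y = x i :=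
  ((hp k).2 x).imp fun _ h => congrFun h

lemma IsProd.isPt_iff {p : ∀ i, X ⟶ Xi i} (hp : IsProd p) (x : X _⦋0⦌) (f : X _⦋n⦌) :
    X.IsPt n x f ↔ ∀ i, (Xi i).IsPt n ((p i).app _ x) ((p i).app _ f) :=
  ⟨fun h i => h.map (p i), fun h m b hb => hp.ext fun i => by
    rw [NatTrans.naturality_apply, h i m b hb, app_cst]⟩

lemma IsProd.ptRel_iff {p : ∀ i, X ⟶ Xi i} (hp : IsProd p) (x : X _⦋0⦌) (f g : X _⦋n⦌) :
    X.PtRel n x f g ↔ ∀ i, (Xi i).PtRel n ((p i).app _ x) ((p i).app _ f) ((p i).app _ g) := by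
  refine ⟨fun h i => h.map (p i), fun h => ?_⟩
  choose y h₁ h₂ h₃ using h
  obtain ⟨z, hz⟩ := hp.exists y
  refine ⟨z, hp.ext fun i => ?_, hp.ext fun i => ?_, fun j hj => hp.ext fun i => ?_⟩
  · rw [← h₁ i, ← hz i]; exact NatTrans.naturality_apply _ _ _
  · rw [← h₂ i, ← hz i]; exact NatTrans.naturality_apply _ _ _
  · rw [app_cst, ← h₃ i j hj, ← hz i]; exact NatTrans.naturality_apply _ _ _

/-- Pointed simplices and homotopies in a product are families of such in the factors, so preimages
and witnesses may be chosen separately. With a single factor this transports the property along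
levelwise bijections. -/
lemma IsPiEquiv.of_isProd {p : ∀ i, X ⟶ Xi i} (hp : IsProd p) {q : ∀ i, Y ⟶ Yi i} (hq : IsProd q) (φ : X ⟶ Y)
    (φi : ∀ i, Xi i ⟶ Yi i) (hφ : ∀ i k x, (q i).app k (φ.app k x) = (φi i).app k ((p i).app k x))
    (h : ∀ i, IsPiEquiv (φi i)) : IsPiEquiv φ where
  refl n y f hf := (hq.ptRel_iff _ _ _).mpr fun i => (h i).refl _ _ _ ((hq.isPt_iff _ _).mp hf i)
  symm n y f g hf hg hfg := (hq.ptRel_iff _ _ _).mpr fun i => (h i).symm _ _ _ _ ((hq.isPt_iff _ _).mp hf i)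
    ((hq.isPt_iff _ _).mp hg i) ((hq.ptRel_iff _ _ _).mp hfg i)
  trans n y f g k hf hg hk hfg hgk := (hq.ptRel_iff _ _ _).mpr fun i => (h i).trans _ _ _ _ _
    ((hq.isPt_iff _ _).mp hf i) ((hq.isPt_iff _ _).mp hg i) ((hq.isPt_iff _ _).mp hk i)
    ((hq.ptRel_iff _ _ _).mp hfg i) ((hq.ptRel_iff _ _ _).mp hgk i)
  surj n x k hk := by
    have hk' := fun i => (hq.isPt_iff _ _).mp hk i
    simp only [hφ] at hk'
    choose g hg hgk using fun i => (h i).surj n _ _ (hk' i)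
    obtain ⟨g', hg'⟩ := hp.exists g
    refine ⟨g', (hp.isPt_iff _ _).mpr fun i => by rw [hg']; exact hg i, (hq.ptRel_iff _ _ _).mpr fun i => ?_⟩
    rw [hφ, hφ, hg']
    exact hgk i
  inj n x f g hf hg hfg := (hp.ptRel_iff _ _ _).mpr fun i => (h i).inj _ _ _ _ ((hp.isPt_iff _ _).mp hf i)
    ((hp.isPt_iff _ _).mp hg i) (by
      have := (hq.ptRel_iff _ _ _).mp hfg i
      rwa [hφ, hφ, hφ] at this)

end SSet

/-! ### Homotopy in simplicial abelian groups at arbitrary vertices, and loops on the circle. -/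

namespace SAb

variable {G H : SAb.{u}} {k l m n : ℕ}

/-- Translation by the degenerate simplex at `x` moves the base vertex to `0`. -/
lemma isPt_iff (x : G.obj (op ⦋0⦌)) (f : G.obj (op ⦋n⦌)) :
    SSet.IsPt G.ss n x f ↔ f - G.act (SimplexCategory.const ⦋n⦌ ⦋0⦌ 0) x ∈ G.cycles n := by
  rw [mem_cycles]
  refine forall₂_congr fun m b => imp_congr_right fun _ => ?_
  rw [map_sub, sub_eq_zero, act_act]
  rfl

lemma d_s_last (x : G.obj (op ⦋0⦌)) {g : G.obj (op ⦋n⦌)} (hg : SSet.IsPt G.ss n x g) {j : ℕ} (hj : j < n) :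
    G.d j (G.s n g) = G.act (SimplexCategory.const ⦋n⦌ ⦋0⦌ 0) x := by
  have h := d_s_of_mem_cycles ((isPt_iff x g).mp hg) (i := j) (j := n) (by omega) le_rfl (by omega) (by omega)
  rw [map_sub, map_sub, sub_eq_zero] at h
  rw [h]
  unfold d s
  rw [act_act, act_act]
  rfl

lemma ptRel_iff_exists (x : G.obj (op ⦋0⦌)) (f g : G.obj (op ⦋n⦌)) :
    SSet.PtRel G.ss n x f g ↔ ∃ y : G.obj (op ⦋n + 1⦌), G.d n y = f ∧ G.d (n + 1) y = g ∧
      ∀ j < n, G.d j y = G.act (SimplexCategory.const ⦋n⦌ ⦋0⦌ 0) x := by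
  constructor
  · rintro ⟨y, h₁, h₂, h₃⟩
    exact ⟨y, (delta_eq_d (G := G) (Fin.last n).castSucc y).symm.trans h₁,
      (delta_eq_d (G := G) (Fin.last n).succ y).symm.trans h₂, fun j hj =>
      (delta_eq_d (G := G) ⟨j, by omega⟩ y).symm.trans (h₃ ⟨j, by omega⟩ hj)⟩
  · rintro ⟨y, h₁, h₂, h₃⟩
    exact ⟨y, (delta_eq_d (G := G) (Fin.last n).castSucc y).trans h₁,
      (delta_eq_d (G := G) (Fin.last n).succ y).trans h₂, fun j hj =>
      (delta_eq_d (G := G) j y).trans (h₃ j hj)⟩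

/-- Subtracting `s n g` from a homotopy leaves a simplex with `n`-th face `f - g` and all other
faces zero. Adding it back recovers the homotopy. The position of the nonzero face is immaterial by
`null_eq`. -/
lemma ptRel_iff (x : G.obj (op ⦋0⦌)) {f g : G.obj (op ⦋n⦌)} (hg : SSet.IsPt G.ss n x g) :
    SSet.PtRel G.ss n x f g ↔ f - g ∈ G.null 0 n := by
  rw [← null_eq (m := n) (by omega), ptRel_iff_exists]
  constructor
  · rintro ⟨y, h₁, h₂, h₃⟩
    refine ⟨y - G.s n g, ?_, fun i hi hin => ?_⟩
    · rw [map_sub, h₁, d_s_self le_rfl]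
    · rw [map_sub]
      rcases lt_or_gt_of_ne hin with h | h
      · rw [d_s_last x hg h, h₃ i h, sub_self]
      · obtain rfl : i = n + 1 := by omega
        rw [h₂, d_s_succ le_rfl, sub_self]
  · rintro ⟨y, hy, hyi⟩
    refine ⟨y + G.s n g, ?_, ?_, fun j hj => ?_⟩
    · rw [map_add, hy, d_s_self le_rfl, sub_add_cancel]
    · rw [map_add, hyi _ le_rfl (by omega), d_s_succ le_rfl, zero_add]
    · rw [map_add, hyi _ (by omega) (by omega), d_s_last x hg hj, zero_add]

lemma ptRel_equivalence (x : G.obj (op ⦋0⦌)) :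
    (∀ f : G.obj (op ⦋n⦌), SSet.IsPt G.ss n x f → SSet.PtRel G.ss n x f f) ∧
    (∀ f g : G.obj (op ⦋n⦌), SSet.IsPt G.ss n x f → SSet.IsPt G.ss n x g → SSet.PtRel G.ss n x f g →
      SSet.PtRel G.ss n x g f) ∧
    (∀ f g h : G.obj (op ⦋n⦌), SSet.IsPt G.ss n x g → SSet.IsPt G.ss n x h →
      SSet.PtRel G.ss n x f g → SSet.PtRel G.ss n x g h → SSet.PtRel G.ss n x f h) := by
  refine ⟨fun f hf => ?_, fun f g hf hg h => ?_, fun f g h hg hh h₁ h₂ => ?_⟩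
  · rw [ptRel_iff x hf, sub_self]
    exact zero_mem _
  · rw [ptRel_iff x hf, ← neg_sub]
    exact neg_mem ((ptRel_iff x hg).mp h)
  · rw [ptRel_iff x hh, ← sub_add_sub_cancel f g h]
    exact add_mem ((ptRel_iff x hg).mp h₁) ((ptRel_iff x hh).mp h₂)

lemma IsPiIso.isPiEquiv {φ : G ⟶ H} (h : IsPiIso φ) : SSet.IsPiEquiv (ssMap φ) where
  refl n y f hf := (ptRel_equivalence (G := H) y).1 f hf
  symm n y f g hf hg hfg := (ptRel_equivalence (G := H) y).2.1 f g hf hg hfg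
  trans n y f g k hf hg hk hfg hgk := (ptRel_equivalence (G := H) y).2.2 f g k hg hk hfg hgk
  surj n x k hk := by
    change G.obj (op ⦋0⦌) at x
    change H.obj (op ⦋n⦌) at k
    obtain ⟨g, hg, hgk⟩ := h.surj n _ ((isPt_iff (ap φ 0 x) k).mp hk)
    have hp : SSet.IsPt G.ss n x (g + G.act (SimplexCategory.const ⦋n⦌ ⦋0⦌ 0) x : G.obj (op ⦋n⦌)) :=
      (isPt_iff x _).mpr (by rwa [add_sub_cancel_right])
    refine ⟨_, hp, (ptRel_iff (G := H) (ap φ 0 x) hk).mpr ?_⟩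
    rw [sub_sub_eq_add_sub, ← ap_act, ← map_add] at hgk
    exact hgk
  inj n x f g hf hg hfg := (ptRel_iff (G := G) x hg).mpr (by
    change G.obj (op ⦋0⦌) at x
    change G.obj (op ⦋n⦌) at f g
    have h' := (ptRel_iff (G := H) (ap φ 0 x) (hg.map (ssMap φ))).mp hfg
    refine h.inj n _ ?_ ?_
    · have := sub_mem ((isPt_iff x _).mp hf) ((isPt_iff x _).mp hg)
      rwa [sub_sub_sub_cancel_right] at this
    · exact (map_sub (ap φ n) _ _).symm ▸ h')

/-- The quotient map from the interval to the circle. -/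
def toCircle : (Δ[1] : SSet.{u}) ⟶ PSSet.circle.sset where
  app _ := ↾(Quot.mk _)

/-- Loops as maps from the interval vanishing on the boundary. -/
def loopIncl (G : SAb.{u}) : (PSSet.loop (underlying G)).sset ⟶ (mapGrp Δ[1] ∂Δ[1] G).ss where
  app k := ↾fun f => ⟨toCircle ▷ _ ≫ f.1, fun m w hw t => by
    refine Eq.trans ?_ ((f.2 m t).trans (map_zero (G.map _).hom))
    exact congrArg (fun s => f.1.app m (s, t)) (mk_eq_circle_base hw)⟩

/-- This is the universal property of the quotient `Δ[1] / ∂Δ[1]`, applied after taking the product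
with a simplex. -/
lemma loopIncl_bijective (G : SAb.{u}) (k : SimplexCategoryᵒᵖ) : Function.Bijective ((loopIncl G).app k) := by
  constructor
  · intro f g h
    apply Subtype.ext
    ext m ⟨⟨w⟩, t⟩
    exact congrArg (fun v => hv (G := G) (X := Δ[1] ⊗ SSet.stdSimplex.obj k.unop) v.1 (w, t)) h
  · intro v
    let F (m : SimplexCategoryᵒᵖ) (z : PSSet.circle.{u}.sset.obj m × (SSet.stdSimplex.obj k.unop).obj m) : G.obj m :=
      Quot.lift (fun w => hv v.1 (w, z.2)) (by
        rintro a b (rfl | ⟨ha, hb⟩)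
        · rfl
        · rw [v.2 m a ha, v.2 m b hb]) z.1
    refine ⟨⟨homMk F ?_, fun m t => ?_⟩, ?_⟩
    · rintro m l a ⟨⟨w⟩, t⟩
      exact hv_map v.1 a (w, t)
    · exact (v.2 m _ (circleVertex_mem m) t).trans (map_zero (G.map _).hom).symm
    · exact Subtype.ext (hom_ext_app fun m z => rfl)

/-- Under the bijection `loopIncl` the adjoint bonding map is `loopBar` on the nose. The one-factor
case of `IsPiEquiv.of_isProd` carries out the transport. -/
lemma isPiEquiv_adjoint_barBond (G : SAb.{u}) : SSet.IsPiEquiv (PSSet.adjoint (barBond G)).map :=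
  SSet.IsPiEquiv.of_isProd (J := PUnit.{1}) (p := fun _ => 𝟙 _) (q := fun _ => loopIncl (bar G))
    (fun k => ⟨fun x y h => congrFun h PUnit.unit, fun y => ⟨y PUnit.unit, rfl⟩⟩)
    (fun k => ⟨fun x y h => (loopIncl_bijective _ k).1 (congrFun h PUnit.unit), fun y => by
      obtain ⟨x, hx⟩ := (loopIncl_bijective _ k).2 (y PUnit.unit)
      exact ⟨x, funext fun _ => hx⟩⟩)
    _ (fun _ => ssMap (loopBar G)) (fun _ _ _ => rfl) (fun _ => (isPiIso_loopBar G).isPiEquiv)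

end SAb

/-! ### Cofibrant spectra and products -/

namespace PSSet

/-- A class in the smash product is determined up to the wedge. -/
lemma smashMk_eq_iff {X Y : PSSet.{u}} {k : SimplexCategoryᵒᵖ} (x x' : X.sset.obj k) (y y' : Y.sset.obj k) :
    smashMk x y = smashMk x' y' ↔ (x = x' ∧ y = y') ∨
      ((x = X.base k ∨ y = Y.base k) ∧ (x' = X.base k ∨ y' = Y.base k)) := by
  constructor
  · intro h
    -- The collapse relation is already an equivalence relation, so equality in the quotient
    -- generates nothing new.
    have he : Equivalence (collapseRel (wedge X Y) k) := by
      refine ⟨fun _ => Or.inl rfl, ?_, ?_⟩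
      · rintro a b (rfl | ⟨h₁, h₂⟩)
        · exact Or.inl rfl
        · exact Or.inr ⟨h₂, h₁⟩
      · rintro a b c (rfl | ⟨h₁, h₂⟩) (rfl | ⟨h₃, h₄⟩)
        · exact Or.inl rfl
        · exact Or.inr ⟨h₃, h₄⟩
        · exact Or.inr ⟨h₁, h₂⟩
        · exact Or.inr ⟨h₁, h₄⟩
    rcases he.eqvGen_iff.mp (Quot.eqvGen_exact h) with h | ⟨h₁, h₂⟩
    · exact Or.inl ⟨congrArg Prod.fst h, congrArg Prod.snd h⟩
    · exact Or.inr ⟨h₁, h₂⟩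
  · rintro (⟨rfl, rfl⟩ | ⟨h₁, h₂⟩)
    · rfl
    · exact Quot.sound (Or.inr ⟨h₁, h₂⟩)

end PSSet

/-! ### Injectivity of the bonding maps. -/

namespace SAb

lemma circle_exists_jump {k : SimplexCategoryᵒᵖ} (α : (Δ[1] : SSet.{u}).obj k)
    (h : (Quot.mk _ α : PSSet.circle.{u}.sset.obj k) ≠ PSSet.circle.base k) :
    ∃ i : Fin k.unop.len, (SSet.stdSimplex.objEquiv α).toOrderHom i.castSucc = (0 : Fin 2) ∧
      (SSet.stdSimplex.objEquiv α).toOrderHom i.succ = (1 : Fin 2) := by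
  by_contra! hn
  refine h (mk_eq_circle_base fun hs => ?_)
  change Function.Surjective (SSet.stdSimplex.objEquiv α).toOrderHom at hs
  revert hn hs
  generalize (SSet.stdSimplex.objEquiv α).toOrderHom = F
  clear h α
  change Fin (k.unop.len + 1) →o Fin 2 at F
  intro hn hs
  obtain ⟨a, ha⟩ := hs (0 : Fin 2)
  obtain ⟨b, hb⟩ := hs (1 : Fin 2)
  have h0 : ∀ r, F r = 0 := by
    intro r
    induction r using Fin.induction with
    | zero => exact Fin.le_zero_iff.mp (ha ▸ F.monotone (Fin.zero_le a))
    | succ i ih =>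
      have := hn i ih
      generalize F i.succ = q at *
      clear ih ha hb
      revert q
      decide
  rw [h0 b] at hb
  exact absurd hb (by decide)

/-- A monotone map to `[1]` that jumps between `i` and `i + 1` is `0` up to `i` and `1` afterwards.
-/
lemma eq_of_jump {k : SimplexCategoryᵒᵖ} (α β : (Δ[1] : SSet.{u}).obj k) (i : Fin k.unop.len)
    (h₀ : (SSet.stdSimplex.objEquiv α).toOrderHom i.castSucc = (0 : Fin 2))
    (h₁ : (SSet.stdSimplex.objEquiv α).toOrderHom i.succ = (1 : Fin 2))
    (h₂ : (SSet.stdSimplex.objEquiv β).toOrderHom i.castSucc ≠ (SSet.stdSimplex.objEquiv β).toOrderHom i.succ) :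
    α = β := by
  apply SSet.stdSimplex.objEquiv.injective
  apply SimplexCategory.Hom.ext
  revert h₀ h₁ h₂
  generalize (SSet.stdSimplex.objEquiv α).toOrderHom = F
  generalize (SSet.stdSimplex.objEquiv β).toOrderHom = F'
  clear α β
  change ∀ _ : F i.castSucc = (0 : Fin 2), _
  revert F F'
  change ∀ F F' : Fin (k.unop.len + 1) →o Fin 2, _
  intro F F' h₀ h₁ h₂
  have h₃ := F'.monotone (Fin.castSucc_lt_succ (i := i)).le
  have key : ∀ p q : Fin 2, p ≠ q → p ≤ q → p = 0 ∧ q = 1 := by decide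
  obtain ⟨h₄, h₅⟩ := key _ _ h₂ h₃
  ext r : 2
  have h1 : ∀ q : Fin 2, 1 ≤ q → q = 1 := by decide
  rcases le_or_gt r i.castSucc with h | h
  · exact (Fin.le_zero_iff.mp (h₀ ▸ F.monotone h)).trans (Fin.le_zero_iff.mp (h₄ ▸ F'.monotone h)).symm
  · have h := Fin.castSucc_lt_iff_succ_le.mp h
    exact (h1 _ (h₁ ▸ F.monotone h)).trans (h1 _ (h₅ ▸ F'.monotone h)).symm

lemma circleTuple_jump {M : Type u} [AddCommGroup M] {k : SimplexCategoryᵒᵖ} (α : (Δ[1] : SSet.{u}).obj k) (x : M)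
    (i : Fin k.unop.len)
    (h : (SSet.stdSimplex.objEquiv α).toOrderHom i.castSucc ≠ (SSet.stdSimplex.objEquiv α).toOrderHom i.succ) :
    circleTuple (Quot.mk _ α) x i = x := if_neg h

lemma eq_zero_of_circleTuple_eq_zero {M : Type u} [AddCommGroup M] {k : SimplexCategoryᵒᵖ}
    {s : PSSet.circle.{u}.sset.obj k} {x : M} (h : circleTuple s x = 0) (hs : s ≠ PSSet.circle.base k) : x = 0 := by
  obtain ⟨α⟩ := s
  obtain ⟨i, h₀, h₁⟩ := circle_exists_jump α hs
  rw [← circleTuple_jump α x i (by rw [h₀, h₁]; exact Fin.zero_ne_one), h]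
  rfl

/-- Away from the basepoint the tuple has its only nonzero entry at the jump of the circle simplex,
and this entry is the coefficient. Both can be read off. A zero tuple arises only from the
basepoint. -/
lemma circleTuple_inj {M : Type u} [AddCommGroup M] {k : SimplexCategoryᵒᵖ}
    {s t : PSSet.circle.{u}.sset.obj k} {x y : M} (h : circleTuple s x = circleTuple t y) :
    (s = t ∧ x = y) ∨ ((s = PSSet.circle.base k ∨ x = 0) ∧ (t = PSSet.circle.base k ∨ y = 0)) := by
  by_cases hs : s = PSSet.circle.base k
  · refine Or.inr ⟨Or.inl hs, or_iff_not_imp_left.mpr fun ht => eq_zero_of_circleTuple_eq_zero ?_ ht⟩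
    rw [← h, hs, circleTuple_base]
  by_cases hx : x = 0
  · refine Or.inr ⟨Or.inr hx, or_iff_not_imp_left.mpr fun ht => eq_zero_of_circleTuple_eq_zero ?_ ht⟩
    rw [← h, hx, circleTuple_zero]
  obtain ⟨α⟩ := s
  obtain ⟨β⟩ := t
  obtain ⟨i, h₀, h₁⟩ := circle_exists_jump α hs
  have e := congrFun h i
  rw [circleTuple_jump α x i (by rw [h₀, h₁]; exact Fin.zero_ne_one)] at e
  have h₂ : (SSet.stdSimplex.objEquiv β).toOrderHom i.castSucc ≠ (SSet.stdSimplex.objEquiv β).toOrderHom i.succ :=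
    fun h₂ => hx (e.trans (if_pos h₂))
  exact Or.inl ⟨congrArg _ (eq_of_jump α β i h₀ h₁ h₂), e.trans (circleTuple_jump β y i h₂)⟩

lemma mono_barBond (G : SAb.{u}) : Mono (barBond G).map := by
  rw [NatTrans.mono_iff_mono_app]
  intro k
  rw [CategoryTheory.mono_iff_injective]
  rintro ⟨s, x⟩ ⟨t, y⟩ h
  have hb : (0 : G.obj k) = (underlying G).base k := (map_zero (G.map _).hom).symm
  refine (PSSet.smashMk_eq_iff (Y := underlying G) s t x y).mpr ?_
  rw [← hb]
  exact circleTuple_inj (M := G.obj k) h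

end SAb

/-! ### Levelwise products of spectra. -/

namespace BFSpectrum

variable {X : BFSpectrum.{u}} {J : Type*} {Xi : J → BFSpectrum.{u}}

/-- Families of maps of spectra exhibiting `X` as a levelwise product. -/
def IsLevelProd (p : ∀ i, X ⟶ Xi i) : Prop := ∀ n, SSet.IsProd (fun i => ((p i).map n).map)

lemma Hom.map_bond {X Y : BFSpectrum.{u}} (f : X ⟶ Y) {n : ℕ} {k : SimplexCategoryᵒᵖ}
    (s : PSSet.circle.{u}.sset.obj k) (x : (X.level n).sset.obj k) :
    f.eval ((X.bond n).map.app k (PSSet.smashMk s x)) = (Y.bond n).map.app k (PSSet.smashMk s (f.eval x)) :=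
  congrArg (fun h => h.map.app k (PSSet.smashMk s x)) (f.comm n)

/-- Smashing with the circle does not preserve products, so the identifications in the factors must
be combined. If `s` and `t` are distinct and neither is the base simplex, each factor forces both
components to the basepoint. If `s = t` is not the base simplex, each factor gives equal components.
-/
lemma IsLevelProd.cofibrant {p : ∀ i, X ⟶ Xi i} (hp : IsLevelProd p) (h : ∀ i, (Xi i).Cofibrant) : X.Cofibrant := by
  intro n
  rw [NatTrans.mono_iff_mono_app]
  intro k
  rw [CategoryTheory.mono_iff_injective]
  rintro ⟨s, x⟩ ⟨t, y⟩ hst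
  change PSSet.smashMk s x = PSSet.smashMk t y
  have hi (i : J) : PSSet.smashMk s ((p i).eval x) = PSSet.smashMk t ((p i).eval y) := by
    have := (NatTrans.mono_iff_mono_app _).mp (h i n) k
    refine (CategoryTheory.mono_iff_injective _).mp this ?_
    rw [← Hom.map_bond, ← Hom.map_bond]
    exact congrArg (p i).eval hst
  have hb (z : (X.level n).sset.obj k) : z = (X.level n).base k ↔ ∀ i, (p i).eval z = ((Xi i).level n).base k :=
    ⟨fun h i => h ▸ ((p i).map n).map_base k, fun h => (hp n).ext fun i =>
      (h i).trans (((p i).map n).map_base k).symm⟩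
  simp only [PSSet.smashMk_eq_iff] at hi ⊢
  by_cases hs : s = PSSet.circle.base k
  · by_cases ht : t = PSSet.circle.base k
    · exact Or.inr ⟨Or.inl hs, Or.inl ht⟩
    · refine Or.inr ⟨Or.inl hs, Or.inr ((hb y).mpr fun i => ?_)⟩
      rcases hi i with h | h
      · exact absurd (h.1.symm.trans hs) ht
      · exact h.2.resolve_left ht
  · by_cases ht : t = PSSet.circle.base k
    · refine Or.inr ⟨Or.inr ((hb x).mpr fun i => ?_), Or.inl ht⟩
      rcases hi i with h | h
      · exact absurd (h.1.trans ht) hs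
      · exact h.1.resolve_left hs
    · by_cases hst : s = t
      · refine Or.inl ⟨hst, (hp n).ext fun i => ?_⟩
        rcases hi i with h | h
        · exact h.2
        · exact (h.1.resolve_left hs).trans (h.2.resolve_left ht).symm
      · have := fun i => (hi i).resolve_left fun h => hst h.1
        exact Or.inr ⟨Or.inr ((hb x).mpr fun i => (this i).1.resolve_left hs),
          Or.inr ((hb y).mpr fun i => (this i).2.resolve_left ht)⟩

lemma IsLevelProd.levelFibrant {p : ∀ i, X ⟶ Xi i} (hp : IsLevelProd p) (h : ∀ i, (Xi i).LevelFibrant) :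
    X.LevelFibrant := by
  intro n
  rw [SSet.KanComplex.iff]
  intro m i f hf
  have hi (a : J) : ∃ φ : Δ[m + 1] ⟶ ((Xi a).level n).sset,
      ∀ (j : Fin (m + 2)) (hj : j ≠ i), SSet.stdSimplex.δ j ≫ φ = f j hj ≫ ((p a).map n).map := by
    have := h a n
    refine SSet.horn.IsCompatible.exists_lift_of_kanComplex (f := fun j hj => f j hj ≫ ((p a).map n).map) ?_
    obtain _ | m := m
    · trivial
    · intro j k hj hk hjk
      rw [← Category.assoc, hf j k hj hk hjk, Category.assoc]
  choose φ hφ using hi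
  obtain ⟨u, hu⟩ := (hp n).exists fun a => SSet.yonedaEquiv (φ a)
  refine ⟨SSet.yonedaEquiv.symm u, fun j hj => ?_⟩
  apply SSet.yonedaEquiv.injective
  refine (hp n).ext fun a => ?_
  rw [SSet.stdSimplex.yonedaEquiv_δ_comp, Equiv.apply_symm_apply]
  refine (NatTrans.naturality_apply ((p a).map n).map _ u).trans ?_
  rw [hu a]
  refine (SSet.stdSimplex.yonedaEquiv_δ_comp (φ a) j).symm.trans ?_
  rw [hφ a j hj]
  rfl

/-- The adjoint bonding maps are bijective on homotopy groups. -/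
def IsPiOmega (X : BFSpectrum.{u}) : Prop := ∀ n, SSet.IsPiEquiv (PSSet.adjoint (X.bond n)).map

lemma IsPiOmega.isOmega (h : X.IsPiOmega) : X.IsOmega := fun n => (h n).isWeakEquiv (X.level n).pt

/-- Functoriality of loop spaces. -/
def loopMap {X Y : PSSet.{u}} (f : X ⟶ Y) : (PSSet.loop X).sset ⟶ (PSSet.loop Y).sset where
  app k := ↾fun g => ⟨g.1 ≫ f.map, fun m s => (congrArg (f.map.app m) (g.2 m s)).trans (f.map_base m)⟩

lemma isProd_loopMap {X : PSSet.{u}} {Xi : J → PSSet.{u}} {p : ∀ i, X ⟶ Xi i} (hp : SSet.IsProd (fun i => (p i).map)) :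
    SSet.IsProd (fun i => loopMap (p i)) := by
  intro k
  constructor
  · intro f g h
    apply Subtype.ext
    ext m z
    exact hp.ext fun i => congrArg (fun v => v.1.app m z) (congrFun h i)
  · intro v
    choose F hF using fun (m : SimplexCategoryᵒᵖ) (z : PSSet.circle.{u}.sset.obj m × (SSet.stdSimplex.obj k.unop).obj m) =>
      hp.exists (fun i => (v i).1.app m z)
    refine ⟨⟨{ app m := ↾(F m), naturality := ?_ }, fun m s => hp.ext fun i => ?_⟩, funext fun i => Subtype.ext ?_⟩
    · intro m l a
      ext z
      refine hp.ext fun i => (hF l _ i).trans ?_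
      refine (NatTrans.naturality_apply (v i).1 a z).trans ?_
      refine (congrArg (((Xi i).sset).map a) (hF m z i).symm).trans ?_
      exact (NatTrans.naturality_apply (p i).map a (F m z)).symm
    · exact (hF m _ i).trans (((v i).2 m s).trans ((p i).map_base m).symm)
    · ext m z
      exact hF m z i

/-- The loop space of a product is the product of the loop spaces, and the adjoint bonding map of
`X` is computed factorwise. -/
lemma IsLevelProd.isPiOmega {p : ∀ i, X ⟶ Xi i} (hp : IsLevelProd p) (h : ∀ i, (Xi i).IsPiOmega) : X.IsPiOmega := by
  intro n
  refine SSet.IsPiEquiv.of_isProd (hp n) (isProd_loopMap (hp (n + 1))) _ (fun i => (PSSet.adjoint ((Xi i).bond n)).map)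
    (fun i k x => Subtype.ext ?_) (fun i => h i n)
  ext m z
  refine ((p i).map_bond z.1 _).trans (congrArg (fun w => ((Xi i).bond n).map.app m (PSSet.smashMk z.1 w)) ?_)
  exact NatTrans.naturality_apply ((p i).map n).map _ x

lemma cofibrant_HA (A : Type u) [AddCommGroup A] : (HA A).Cofibrant := fun _ => SAb.mono_barBond _

lemma levelFibrant_HA (A : Type u) [AddCommGroup A] : (HA A).LevelFibrant := fun _ => SAb.kanComplex _

lemma isPiOmega_HA (A : Type u) [AddCommGroup A] : (HA A).IsPiOmega := fun _ => SAb.isPiEquiv_adjoint_barBond _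

end BFSpectrum

/-! ### Explicit products -/

namespace PSSet

variable {r : ℕ}

/-- The product of a finite family of pointed simplicial sets. -/
def pi (X : Fin r → PSSet.{u}) : PSSet.{u} where
  sset :=
    { obj k := ∀ i, (X i).sset.obj k
      map a := ↾fun x i => (X i).sset.map a (x i)
      map_id k := by ext x i; simp
      map_comp a b := by ext x i; simp }
  pt := fun i => (X i).pt

/-- The projections. -/
def piProj (X : Fin r → PSSet.{u}) (i : Fin r) : pi X ⟶ X i := ⟨{ app k := ↾fun x => x i }, rfl⟩

/-- The map into a product with given components. -/
def piLift {X : Fin r → PSSet.{u}} {T : PSSet.{u}} (f : ∀ i, T ⟶ X i) : T ⟶ pi X where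
  map :=
    { app k := ↾fun x i => (f i).map.app k x
      naturality k l a := by
        ext x
        funext i
        exact (f i).map_naturality a x }
  map_pt := funext fun i => (f i).map_pt

lemma pi_hom_ext {X : Fin r → PSSet.{u}} {T : PSSet.{u}} {f g : T ⟶ pi X}
    (h : ∀ i, f ≫ piProj X i = g ≫ piProj X i) : f = g := by
  apply PSSet.hom_ext
  ext k x
  funext i
  exact congrArg (fun q => q.map.app k x) (h i)

end PSSet

namespace BFSpectrum

variable {r : ℕ}

/-- The levelwise product of a family of spectra. -/
def pi (X : Fin r → BFSpectrum.{u}) : BFSpectrum.{u} where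
  level n := PSSet.pi fun i => (X i).level n
  bond n := PSSet.piLift fun i => PSSet.susp.map (PSSet.piProj _ i) ≫ (X i).bond n

/-- The projections. -/
def piProj (X : Fin r → BFSpectrum.{u}) (i : Fin r) : pi X ⟶ X i where
  map _ := PSSet.piProj _ i
  comm _ := rfl

/-- The map into the product. -/
def piLift {X : Fin r → BFSpectrum.{u}} {T : BFSpectrum.{u}} (f : ∀ i, T ⟶ X i) : T ⟶ pi X where
  map n := PSSet.piLift fun i => (f i).map n
  comm n := PSSet.pi_hom_ext fun i => by
    refine ((f i).comm n).trans ?_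
    change _ = PSSet.susp.map _ ≫ PSSet.susp.map _ ≫ (X i).bond n
    rw [← Functor.map_comp_assoc]
    rfl

/-- The categorical product is compared with the explicit one. That `piLift` followed by `Pi.lift`
is the identity gives injectivity, and the projection formula for `Pi.lift` gives surjectivity. -/
lemma isLevelProd_piπ (X : Fin r → BFSpectrum.{u}) : IsLevelProd (fun i => Pi.π X i) := by
  intro n k
  have h₁ : piLift (fun i => Pi.π X i) ≫ Pi.lift (piProj X) = 𝟙 (∏ᶜ X) := by
    refine Pi.hom_ext _ _ fun i => ?_
    rw [Category.assoc, Pi.lift_π, Category.id_comp]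
    rfl
  constructor
  · intro x y h
    have h₂ := fun x => congrArg (fun f : ∏ᶜ X ⟶ ∏ᶜ X => f.eval (n := n) (k := k) x) h₁
    refine (h₂ x).symm.trans (Eq.trans ?_ (h₂ y))
    exact congrArg (Pi.lift (piProj X)).eval h
  · intro v
    refine ⟨(Pi.lift (piProj X)).eval v, funext fun i => ?_⟩
    exact congrArg (fun f : pi X ⟶ X i => f.eval (n := n) (k := k) v) (Pi.lift_π (piProj X) i)

end BFSpectrum

/-! ### Abelian group objects -/

namespace BFSpectrum

variable {X : BFSpectrum.{u}}

/-- A levelwise abelian group structure compatible with the simplicial operators and the bonding maps. -/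
structure IsAdditive (X : BFSpectrum.{u}) [∀ n k, AddCommGroup ((X.level n).sset.obj k)] : Prop where
  map_add {n : ℕ} {k l : SimplexCategoryᵒᵖ} (a : k ⟶ l) (x y : (X.level n).sset.obj k) :
    (X.level n).sset.map a (x + y) = (X.level n).sset.map a x + (X.level n).sset.map a y
  pt_eq (n : ℕ) : (X.level n).pt = 0
  bond_add {n : ℕ} {k : SimplexCategoryᵒᵖ} (s : PSSet.circle.{u}.sset.obj k) (x y : (X.level n).sset.obj k) :
    (X.bond n).map.app k (PSSet.smashMk s (x + y)) =
      (X.bond n).map.app k (PSSet.smashMk s x) + (X.bond n).map.app k (PSSet.smashMk s y)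

variable [∀ n k, AddCommGroup ((X.level n).sset.obj k)]

/-- A morphism given levelwise by additive endomorphisms. -/
def IsAdditive.endo (f : ∀ n k, (X.level n).sset.obj k →+ (X.level n).sset.obj k) (hX : X.IsAdditive)
    (hf : ∀ {n k l} (a : k ⟶ l) (x : (X.level n).sset.obj k), f n l ((X.level n).sset.map a x) =
      (X.level n).sset.map a (f n k x))
    (hb : ∀ {n k} (s : PSSet.circle.{u}.sset.obj k) (x : (X.level n).sset.obj k),
      f (n + 1) k ((X.bond n).map.app k (PSSet.smashMk s x)) = (X.bond n).map.app k (PSSet.smashMk s (f n k x))) : X ⟶ X where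
  map n :=
    { map := { app k := ↾(f n k), naturality := fun k l a => by ext x; exact hf a x }
      map_pt := by
        rw [hX.pt_eq]
        exact map_zero (f n _) }
  comm n := by
    apply PSSet.hom_ext
    ext k ⟨s, x⟩
    exact hb s x

/-- Addition. -/
def IsAdditive.add (hX : X.IsAdditive) : X ⊗ X ⟶ X where
  map n :=
    { map :=
        { app k := ↾fun z : (X.level n).sset.obj k × (X.level n).sset.obj k => z.1 + z.2
          naturality := fun k l a => by ext z; exact (hX.map_add a z.1 z.2).symm }
      map_pt := by
        change (X.level n).pt + (X.level n).pt = _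
        rw [hX.pt_eq, add_zero] }
  comm n := by
    apply PSSet.hom_ext
    ext k ⟨s, z⟩
    exact (hX.bond_add s z.1 z.2).symm

lemma IsAdditive.bond_zero (hX : X.IsAdditive) {n : ℕ} {k : SimplexCategoryᵒᵖ} (s : PSSet.circle.{u}.sset.obj k) :
    (X.bond n).map.app k (PSSet.smashMk s 0) = 0 := by
  have := hX.bond_add (n := n) s 0 0
  rw [add_zero] at this
  exact left_eq_add.mp this

lemma IsAdditive.bond_neg (hX : X.IsAdditive) {n : ℕ} {k : SimplexCategoryᵒᵖ} (s : PSSet.circle.{u}.sset.obj k)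
    (x : (X.level n).sset.obj k) :
    (X.bond n).map.app k (PSSet.smashMk s (-x)) = -(X.bond n).map.app k (PSSet.smashMk s x) := by
  rw [eq_neg_iff_add_eq_zero, ← hX.bond_add, neg_add_cancel, hX.bond_zero]

lemma IsAdditive.map_zero (hX : X.IsAdditive) {n : ℕ} {k l : SimplexCategoryᵒᵖ} (a : k ⟶ l) :
    (X.level n).sset.map a 0 = 0 := by
  have := hX.map_add (n := n) a 0 0
  rw [add_zero] at this
  exact left_eq_add.mp this

lemma IsAdditive.map_neg (hX : X.IsAdditive) {n : ℕ} {k l : SimplexCategoryᵒᵖ} (a : k ⟶ l) (x : (X.level n).sset.obj k) :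
    (X.level n).sset.map a (-x) = -(X.level n).sset.map a x := by
  rw [eq_neg_iff_add_eq_zero, ← hX.map_add, neg_add_cancel, hX.map_zero]

/-- The zero. -/
def IsAdditive.zero (hX : X.IsAdditive) : 𝟙_ BFSpectrum.{u} ⟶ X where
  map n :=
    { map :=
        { app k := ↾fun _ => 0
          naturality := fun k l a => by ext z; exact (hX.map_zero a).symm }
      map_pt := (hX.pt_eq n).symm }
  comm n := by
    apply PSSet.hom_ext
    ext k ⟨s, z⟩
    exact (hX.bond_zero s).symm

/-- Negation. -/
def IsAdditive.neg (hX : X.IsAdditive) : X ⟶ X :=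
  IsAdditive.endo (fun _ _ => negAddMonoidHom) hX (fun a x => (hX.map_neg a x).symm) (fun s x => (hX.bond_neg s x).symm)

lemma hom_ext_eval {X Y : BFSpectrum.{u}} {f g : X ⟶ Y}
    (h : ∀ n k (x : (X.level n).sset.obj k), f.eval x = g.eval x) : f = g := by
  ext n k x
  exact h n k x

/-- The abelian group object given by a compatible levelwise group structure. -/
abbrev IsAdditive.commGrpObj (hX : X.IsAdditive) : CommGrpObj X where
  one := hX.zero
  mul := hX.add
  one_mul := hom_ext_eval fun n k z => zero_add (z.2 : (X.level n).sset.obj k)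
  mul_one := hom_ext_eval fun n k z => add_zero (z.1 : (X.level n).sset.obj k)
  mul_assoc := hom_ext_eval fun n k z =>
    add_assoc (z.1.1 : (X.level n).sset.obj k) (z.1.2 : (X.level n).sset.obj k) (z.2 : (X.level n).sset.obj k)
  inv := hX.neg
  left_inv := hom_ext_eval fun n k z => neg_add_cancel (z : (X.level n).sset.obj k)
  right_inv := hom_ext_eval fun n k z => add_neg_cancel (z : (X.level n).sset.obj k)
  mul_comm := hom_ext_eval fun n k z => add_comm (z.2 : (X.level n).sset.obj k) (z.1 : (X.level n).sset.obj k)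

lemma isAdditive_HA (A : Type u) [AddCommGroup A] : (HA A).IsAdditive where
  map_add {n _ _} a x y := _root_.map_add ((iterBar A n).map a).hom x y
  pt_eq _ := rfl
  bond_add {n k} s x y := SAb.circleTuple_add (M := (iterBar A n).obj k) s x y

lemma isAdditive_shiftHA (A : Type u) [AddCommGroup A] (m : ℕ) : (shiftHA A m).IsAdditive where
  map_add {n _ _} a x y := _root_.map_add ((iterBar A (m + n)).map a).hom x y
  pt_eq _ := rfl
  bond_add {n k} s x y := SAb.circleTuple_add (M := (iterBar A (m + n)).obj k) s x y

section Prod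

variable {X : BFSpectrum.{u}} {J : Type*} {Xi : J → BFSpectrum.{u}}
  [∀ i n k, AddCommGroup (((Xi i).level n).sset.obj k)] {p : ∀ i, X ⟶ Xi i}

/-- The levelwise group structure of a product. -/
noncomputable abbrev IsLevelProd.addCommGroup (hp : IsLevelProd p) (n : ℕ) (k : SimplexCategoryᵒᵖ) :
    AddCommGroup ((X.level n).sset.obj k) :=
  (Equiv.ofBijective _ (hp n k)).addCommGroup

lemma IsLevelProd.eval_add (hp : IsLevelProd p) (i : J) {n : ℕ} {k : SimplexCategoryᵒᵖ} (x y : (X.level n).sset.obj k) :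
    letI := hp.addCommGroup n k
    (p i).eval (x + y) = (p i).eval x + (p i).eval y :=
  congrFun ((Equiv.ofBijective _ (hp n k)).apply_symm_apply _) i

lemma IsLevelProd.eval_zero (hp : IsLevelProd p) (i : J) {n : ℕ} {k : SimplexCategoryᵒᵖ} :
    letI := hp.addCommGroup n k
    (p i).eval (0 : (X.level n).sset.obj k) = 0 :=
  congrFun ((Equiv.ofBijective _ (hp n k)).apply_symm_apply _) i

lemma IsLevelProd.isAdditive (hp : IsLevelProd p) (h : ∀ i, (Xi i).IsAdditive) :
    letI := hp.addCommGroup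
    X.IsAdditive :=
  letI := hp.addCommGroup
  { map_add := fun {n k l} a x y => (hp n).ext fun i => by
      have e (z : (X.level n).sset.obj k) : (p i).eval ((X.level n).sset.map a z) = ((Xi i).level n).sset.map a ((p i).eval z) :=
        ((p i).map n).map_naturality a z
      change (p i).eval _ = (p i).eval _
      rw [hp.eval_add, e, e, e, hp.eval_add, (h i).map_add]
    pt_eq := fun n => (hp n).ext fun i => (((p i).map n).map_pt.trans ((h i).pt_eq n)).trans (hp.eval_zero i).symm
    bond_add := fun {n k} s x y => (hp (n + 1)).ext fun i => by
      change (p i).eval _ = (p i).eval _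
      rw [hp.eval_add, Hom.map_bond, Hom.map_bond, Hom.map_bond, hp.eval_add, (h i).bond_add] }

end Prod

/-! ### Module objects -/

section Module

variable {A : Type u} [AddCommGroup A] {p : ℕ} [Fact p.Prime] [Module (ZMod p) A]

lemma nsmul_iterBar_eq_zero (p : ℕ) (hp : ∀ a : A, p • a = 0) (n : ℕ) (k : SimplexCategoryᵒᵖ) (x : (iterBar A n).obj k) :
    p • x = 0 := by
  induction n with
  | zero => exact hp x
  | succ n ih => exact funext fun j => ih (x j)

lemma nsmul_HA_eq_zero (p : ℕ) [Module (ZMod p) A] (n : ℕ) (k : SimplexCategoryᵒᵖ) (x : ((HA A).level n).sset.obj k) :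
    p • x = 0 :=
  nsmul_iterBar_eq_zero p (fun a => by
    rw [← Nat.cast_smul_eq_nsmul (ZMod p), ZMod.natCast_self, zero_smul]) n k x

/-- Sums and products in `ZMod p` have representatives reduced modulo `p`. This shows that the
reduction does not affect the action. -/
lemma mod_nsmul_HA (p : ℕ) [Module (ZMod p) A] (m n : ℕ) (k : SimplexCategoryᵒᵖ) (x : ((HA A).level n).sset.obj k) :
    (m % p) • x = m • x := by
  conv_rhs => rw [← Nat.mod_add_div m p, add_nsmul, mul_nsmul, nsmul_HA_eq_zero p, smul_zero, add_zero]

/-- Multiplication by a natural number. -/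
def IsAdditive.nsmul {X : BFSpectrum.{u}} [∀ n k, AddCommGroup ((X.level n).sset.obj k)] (hX : X.IsAdditive) (m : ℕ) : X ⟶ X :=
  IsAdditive.endo (fun _ _ => nsmulAddMonoidHom m) hX
    (fun {n _ _} a x => (map_nsmul (AddMonoidHom.mk' (fun x => (X.level n).sset.map a x) (hX.map_add a)) m x).symm)
    (fun {n k} s x => (map_nsmul (AddMonoidHom.mk' (fun x => (X.bond n).map.app k (PSSet.smashMk s x)) (hX.bond_add s)) m x).symm)

lemma IsAdditive.eval_nsmul {X : BFSpectrum.{u}} [∀ n k, AddCommGroup ((X.level n).sset.obj k)] (hX : X.IsAdditive) (m : ℕ)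
    {n : ℕ} {k : SimplexCategoryᵒᵖ} (x : (X.level n).sset.obj k) : (hX.nsmul m).eval x = m • x := rfl

/-- The module structure on `HA`. -/
def moduleObj (A : Type u) [AddCommGroup A] (p : ℕ) [Fact p.Prime] [Module (ZMod p) A] :
    letI := (isAdditive_HA A).commGrpObj
    ModuleObj (ZMod p) (HA A) :=
  letI := (isAdditive_HA A).commGrpObj
  { smul := fun r => (isAdditive_HA A).nsmul r.val
    isMonHom := fun r =>
      { one_hom := hom_ext_eval fun n k _ => smul_zero (A := ((HA A).level n).sset.obj k) r.val
        mul_hom := hom_ext_eval fun n k z => smul_add (A := ((HA A).level n).sset.obj k) r.val z.1 z.2 }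
    add_smul := fun r s => hom_ext_eval fun n k x => by
      refine Eq.trans ?_ (add_nsmul (M := ((HA A).level n).sset.obj k) x r.val s.val)
      rw [IsAdditive.eval_nsmul, ZMod.val_add, mod_nsmul_HA]
    mul_smul := fun r s => hom_ext_eval fun n k x => by
      refine Eq.trans ?_ (mul_nsmul' (M := ((HA A).level n).sset.obj k) x r.val s.val)
      rw [IsAdditive.eval_nsmul, ZMod.val_mul, mod_nsmul_HA]
    one_smul := hom_ext_eval fun n k x => by
      have := Fact.mk (Fact.out : p.Prime).one_lt
      rw [IsAdditive.eval_nsmul, ZMod.val_one, one_nsmul]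
      rfl }

end Module

end BFSpectrum

namespace SAb

variable {G H : SAb.{u}} {k l m n : ℕ}

/-! ### Homotopy groups of the bar construction -/

/-- The relation defining the connecting homomorphism of `G ⟶ tot G ⟶ bar G`. -/
def Connects (G : SAb.{u}) (n : ℕ) (z : (bar G).obj (op ⦋n + 1⦌)) (g : G.obj (op ⦋n⦌)) : Prop :=
  ∃ x : (tot G).obj (op ⦋n + 1⦌), ap (totToBar G) (n + 1) x = z ∧ (tot G).d 0 x = ap (toTot G) n g ∧
    ∀ i ≤ n + 1, i ≠ 0 → (tot G).d i x = 0

lemma Connects.add {z z' : (bar G).obj (op ⦋n + 1⦌)} {g g' : G.obj (op ⦋n⦌)} (h : Connects G n z g)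
    (h' : Connects G n z' g') : Connects G n (z + z') (g + g') := by
  obtain ⟨x, rfl, h₁, h₂⟩ := h
  obtain ⟨x', rfl, h₁', h₂'⟩ := h'
  exact ⟨x + x', map_add _ _ _, by rw [map_add, map_add, h₁, h₁'], fun i hi hi0 => by
    rw [map_add, h₂ i hi hi0, h₂' i hi hi0, add_zero]⟩

lemma Connects.neg {z : (bar G).obj (op ⦋n + 1⦌)} {g : G.obj (op ⦋n⦌)} (h : Connects G n z g) :
    Connects G n (-z) (-g) := by
  obtain ⟨x, rfl, h₁, h₂⟩ := h
  exact ⟨-x, map_neg _ _, by rw [map_neg, map_neg, h₁], fun i hi hi0 => by rw [map_neg, h₂ i hi hi0, neg_zero]⟩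

lemma Connects.mem_cycles {z : (bar G).obj (op ⦋n + 1⦌)} {g : G.obj (op ⦋n⦌)} (h : Connects G n z g) :
    g ∈ G.cycles n := by
  obtain ⟨x, -, h₁, h₂⟩ := h
  exact mem_cycles_of_ap (toTot G) toTot_injective (null_le_cycles (m := 0) (Nat.zero_le _) ⟨x, h₁, h₂⟩)

lemma exists_connects {z : (bar G).obj (op ⦋n + 1⦌)} (hz : z ∈ cycles (bar G) (n + 1)) : ∃ g, Connects G n z g := by
  obtain ⟨x, hx, hxi⟩ := exists_normalized_lift (totToBar G) totToBar_surjective z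
    fun i hi _ => d_eq_zero_of_mem_cycles hz hi
  exact ⟨_, x, hx, exists_of_totToBar_eq_zero _ (by rw [ap_d, hx, d_eq_zero_of_mem_cycles hz (Nat.zero_le _)]), hxi⟩

/-- A witness lying over `0` consists of constant functions, so it is already a null witness in `G`.
-/
lemma Connects.mem_null_of_zero {g : G.obj (op ⦋n⦌)} (h : Connects G n 0 g) : g ∈ G.null 0 n := by
  obtain ⟨x, hx, h₁, h₂⟩ := h
  have hx' := exists_of_totToBar_eq_zero x hx
  rw [hx'] at h₁ h₂
  refine ⟨_, toTot_injective _ ((ap_d _ _ _).trans h₁), fun i hi hi0 => toTot_injective _ ?_⟩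
  rw [ap_d, h₂ i hi hi0, map_zero]

lemma exists_connects' {g : G.obj (op ⦋n⦌)} (hg : g ∈ G.cycles n) :
    ∃ z ∈ cycles (bar G) (n + 1), Connects G n z g := by
  obtain ⟨x, hx, hxi⟩ := cycles_tot_le_null _ (ap_mem_cycles (toTot G) hg)
  refine ⟨_, mem_cycles_succ.mpr fun i hi => ?_, x, rfl, hx, hxi⟩
  rw [← ap_d]
  by_cases hi0 : i = 0
  · rw [hi0, hx, totToBar_toTot]
  · rw [hxi i hi hi0, map_zero]

/-- Subtracting a null witness of `g` from the lift of `z` gives a cycle of the acyclic `tot G` that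
still projects to `z`. -/
lemma Connects.mem_null {z : (bar G).obj (op ⦋n + 1⦌)} {g : G.obj (op ⦋n⦌)} (h : Connects G n z g)
    (hg : g ∈ G.null 0 n) : z ∈ null (bar G) 0 (n + 1) := by
  obtain ⟨x, rfl, h₁, h₂⟩ := h
  obtain ⟨w, rfl, hw⟩ := hg
  have hc : x - ap (toTot G) (n + 1) w ∈ (tot G).cycles (n + 1) := mem_cycles_succ.mpr fun i hi => by
    by_cases hi0 : i = 0
    · rw [hi0, map_sub, h₁, ap_d, sub_self]
    · rw [map_sub, h₂ i hi hi0, ← ap_d, hw i hi hi0, map_zero, sub_zero]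
  have := ap_mem_null (totToBar G) (cycles_tot_le_null _ hc)
  rwa [map_sub, totToBar_toTot, sub_zero] at this

/-- If `u` is a normalized lift of a null witness for `z`, then `d 0 u` lifts `z` and is itself a
cycle. -/
lemma connects_zero {z : (bar G).obj (op ⦋n + 1⦌)} (hz : z ∈ null (bar G) 0 (n + 1)) : Connects G n z 0 := by
  obtain ⟨y, rfl, hy⟩ := hz
  obtain ⟨u, hu, hui⟩ := exists_normalized_lift (totToBar G) totToBar_surjective y hy
  have hc : (tot G).d 0 u ∈ (tot G).cycles (n + 1) := null_le_cycles (m := 0) (Nat.zero_le _) ⟨u, rfl, hui⟩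
  refine ⟨(tot G).d 0 u, by rw [ap_d, hu], ?_, fun i hi _ => d_eq_zero_of_mem_cycles hc hi⟩
  rw [map_zero, d_eq_zero_of_mem_cycles hc (Nat.zero_le _)]

/-- An identification of the `n`-th homotopy group with `A`. -/
structure PiIdent (A : Type u) [AddCommGroup A] (G : SAb.{u}) (n : ℕ) where
  /-- the class of a cycle -/
  cls : G.cycles n →+ A
  surjective : Function.Surjective cls
  eq_zero_iff (z) : cls z = 0 ↔ z.1 ∈ G.null 0 n

variable {A : Type u} [AddCommGroup A]

/-- The difference `g - g'` connects to `0`, hence is null. Thus the connecting map does not depend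
on the chosen lift. -/
lemma PiIdent.eq_of_connects (e : PiIdent A G n) {z : (bar G).obj (op ⦋n + 1⦌)} {g g' : G.obj (op ⦋n⦌)}
    (h : Connects G n z g) (h' : Connects G n z g') : e.cls ⟨g, h.mem_cycles⟩ = e.cls ⟨g', h'.mem_cycles⟩ := by
  rw [← sub_eq_zero, ← map_sub, e.eq_zero_iff]
  have := h.add h'.neg
  rw [add_neg_cancel, ← sub_eq_add_neg] at this
  exact this.mem_null_of_zero

/-- The homotopy groups of the bar construction. -/
noncomputable def PiIdent.bar (e : PiIdent A G n) : PiIdent A (bar G) (n + 1) where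
  cls := AddMonoidHom.mk' (fun z => e.cls ⟨_, (exists_connects z.2).choose_spec.mem_cycles⟩) fun z z' => by
    rw [← map_add]
    exact e.eq_of_connects (exists_connects (z + z').2).choose_spec
      ((exists_connects z.2).choose_spec.add (exists_connects z'.2).choose_spec)
  surjective a := by
    obtain ⟨⟨g, hg⟩, rfl⟩ := e.surjective a
    obtain ⟨z, hz, h⟩ := exists_connects' hg
    exact ⟨⟨z, hz⟩, e.eq_of_connects (exists_connects hz).choose_spec h⟩
  eq_zero_iff z := by
    have hc := (exists_connects z.2).choose_spec
    refine (e.eq_zero_iff ⟨_, hc.mem_cycles⟩).trans ⟨fun h => hc.mem_null h, fun h => ?_⟩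
    rw [← e.eq_zero_iff ⟨_, hc.mem_cycles⟩, e.eq_of_connects hc (connects_zero h)]
    exact map_zero e.cls

lemma cycles_bar_le_null (h : G.cycles n ≤ G.null 0 n) : cycles (bar G) (n + 1) ≤ null (bar G) 0 (n + 1) := by
  intro z hz
  obtain ⟨g, hg⟩ := exists_connects hz
  exact hg.mem_null (h hg.mem_cycles)

/-- The homotopy group of the constant simplicial group. -/
def piIdentConst (A : Type u) [AddCommGroup A] : PiIdent A (iterBar A 0) 0 where
  cls := (cycles (iterBar A 0) 0).subtype
  surjective a := ⟨⟨a, mem_cycles_zero _⟩, rfl⟩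
  eq_zero_iff z := by
    constructor
    · intro h
      change z.1 = 0 at h
      rw [h]
      exact zero_mem _
    -- In a constant group all face maps are the identity, so face `0` of `y` equals face `1`, which
    -- is zero.
    · rintro ⟨y, hy, hyi⟩
      exact hy.symm.trans (hyi 1 le_rfl one_ne_zero)

/-- The `n`-th homotopy group of `Bⁿ A`. -/
noncomputable def piIdent (A : Type u) [AddCommGroup A] (n : ℕ) : PiIdent A (iterBar A n) n :=
  Nat.rec (piIdentConst A) (fun _ e => e.bar) n

/-- Each bar construction shifts homotopy up by one degree, and its group in degree `0` is trivial.
In the constant group a cycle of positive degree equals its own face `0`, hence is zero. -/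
lemma cycles_iterBar_le_null (A : Type u) [AddCommGroup A] (k n : ℕ) (h : k ≠ n) :
    cycles (iterBar A n) k ≤ null (iterBar A n) 0 k := by
  induction n generalizing k with
  | zero =>
    obtain _ | k := k
    · exact absurd rfl h
    · intro z hz
      rw [show z = 0 from d_eq_zero_of_mem_cycles hz (Nat.zero_le _)]
      exact zero_mem _
  | succ n ih =>
    obtain _ | k := k
    · intro z _
      rw [show z = 0 from funext fun i : Fin 0 => i.elim0]
      exact zero_mem _
    · exact cycles_bar_le_null (ih k (by omega))

/-! ### Eilenberg--MacLane structures -/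

lemma isPt_zero_iff (f : G.obj (op ⦋n⦌)) : SSet.IsPt G.ss n (underlying G).pt f ↔ f ∈ G.cycles n := by
  refine (isPt_iff (0 : G.obj (op ⦋0⦌)) f).trans ?_
  rw [map_zero, sub_zero]

/-- The cycle given by a map with constant boundary. -/
def cyc (f : SSet.PtSimplex G.ss n (underlying G).pt) : G.cycles n := ⟨ev f.map, (isPt_zero_iff _).mp f.isPt_el⟩

lemma ptRel_el_iff (x : G.obj (op ⦋0⦌)) (f g : SSet.PtSimplex G.ss n x) :
    Nonempty (f.RelStruct g (Fin.last n)) ↔ ev f.map - ev g.map ∈ G.null 0 n :=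
  (SSet.PtSimplex.nonempty_relStruct_iff f g).trans (ptRel_iff x g.isPt_el)

lemma PiIdent.cls_eq_iff (e : PiIdent A G n) (f g : SSet.PtSimplex G.ss n (underlying G).pt) :
    e.cls (cyc f) = e.cls (cyc g) ↔ Nonempty (f.RelStruct g (Fin.last n)) := by
  rw [← sub_eq_zero, ← map_sub, e.eq_zero_iff]
  exact (ptRel_el_iff (G := G) _ f g).symm

lemma subsingleton_piSet (h : G.cycles n ≤ G.null 0 n) (x : G.ss _⦋0⦌) : Subsingleton (PSSet.piSet n G.ss x) := by
  refine ⟨?_⟩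
  rintro ⟨f⟩ ⟨g⟩
  refine Quot.sound ((ptRel_el_iff (G := G) x f g).mpr (h ?_))
  have := sub_mem ((isPt_iff (G := G) x (ev f.map)).mp f.isPt_el) ((isPt_iff (G := G) x (ev g.map)).mp g.isPt_el)
  rwa [sub_sub_sub_cancel_right] at this

lemma mulStruct_mem_null (f g h : SSet.PtSimplex G.ss n (underlying G).pt) (i : Fin n) (hi : (i : ℕ) + 1 = n)
    (r : f.MulStruct g h i) : ((cyc h - cyc f - cyc g : G.cycles n) : G.obj (op ⦋n⦌)) ∈ G.null 0 n := by
  obtain _ | n := n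
  · exact i.elim0
  obtain rfl : i = Fin.last n := Fin.ext (by rw [Fin.val_last]; omega)
  rw [← null_eq (m := n + 1) (by omega)]
  have h₁ : G.d n (ev r.map) = (cyc g).1 :=
    (ev_delta_comp (Fin.last n).castSucc.castSucc r.map).symm.trans (congrArg ev r.δ_castSucc_castSucc_map)
  have h₂ : G.d (n + 1) (ev r.map) = (cyc h).1 :=
    (ev_delta_comp (Fin.last n).castSucc.succ r.map).symm.trans (congrArg ev r.δ_succ_castSucc_map)
  have h₃ : G.d (n + 2) (ev r.map) = (cyc f).1 :=
    (ev_delta_comp (Fin.last n).succ.succ r.map).symm.trans (congrArg ev r.δ_succ_succ_map)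
  have h₄ (j : ℕ) (hj : j < n) : G.d j (ev r.map) = 0 := by
    refine (ev_delta_comp ⟨j, by omega⟩ r.map).symm.trans ((congrArg ev (r.δ_map_of_lt ⟨j, by omega⟩ hj)).trans ?_)
    exact map_zero (G.map _).hom
  -- The faces `n`, `n + 1`, `n + 2` of `r` are `g`, `h`, `f`. Subtracting `s n g` and `s (n + 1) f`
  -- cancels the outer two and leaves `h - g - f` as the only nonzero face.
  refine ⟨ev r.map - G.s n (cyc g).1 - G.s (n + 1) (cyc f).1, ?_, fun j hj hjn => ?_⟩
  · rw [map_sub, map_sub, h₂, d_s_succ (by omega), d_s_self le_rfl, AddSubgroup.coe_sub, AddSubgroup.coe_sub]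
    abel
  · rw [map_sub, map_sub]
    rcases lt_trichotomy j n with hlt | rfl | hgt
    · rw [h₄ j hlt, d_s_of_mem_cycles (cyc g).2 (by omega) (by omega) (by omega) (by omega),
        d_s_of_mem_cycles (cyc f).2 (by omega) (by omega) (by omega) (by omega), sub_zero, sub_zero]
    · rw [h₁, d_s_self (by omega), d_s_of_mem_cycles (cyc f).2 (by omega) (by omega) (by omega) (by omega),
        sub_self, sub_zero]
    · obtain rfl : j = n + 2 := by omega
      rw [h₃, d_s_of_mem_cycles (cyc g).2 (by omega) (by omega) (by omega) (by omega), d_s_succ le_rfl,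
        sub_zero, sub_self]

/-- The equivalence of the `n`-th homotopy group with `A`. -/
noncomputable def PiIdent.equiv (e : PiIdent A G n) : PSSet.piSet n (underlying G).sset (underlying G).pt ≃ A :=
  Equiv.ofBijective (Quot.lift (fun f : SSet.PtSimplex G.ss n (underlying G).pt => e.cls (cyc f))
    fun f g h => (e.cls_eq_iff f g).mpr h) (by
    constructor
    · rintro ⟨f⟩ ⟨g⟩ h
      exact Quot.sound ((e.cls_eq_iff f g).mp h)
    · intro a
      obtain ⟨⟨z, hz⟩, rfl⟩ := e.surjective a
      refine ⟨Quot.mk _ (SSet.PtSimplex.ofEl z ((isPt_zero_iff z).mpr hz)), ?_⟩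
      exact congrArg e.cls (Subtype.ext (SSet.PtSimplex.el_ofEl _ _)))

lemma PiIdent.equiv_mk (e : PiIdent A G n) (f : SSet.PtSimplex G.ss n (underlying G).pt) :
    e.equiv (Quot.mk _ f) = e.cls (cyc f) := rfl

/-- The space `Bⁿ A` is a `K(A, n)`. -/
noncomputable def emStructure (A : Type u) [AddCommGroup A] (n : ℕ) : EMStructure A n (underlying (iterBar A n)) where
  equiv := (piIdent A n).equiv
  map_mul f g h i hi r := by
    rw [PiIdent.equiv_mk, PiIdent.equiv_mk, PiIdent.equiv_mk, ← sub_eq_zero, ← sub_sub, ← map_sub, ← map_sub,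
      PiIdent.eq_zero_iff]
    exact mulStruct_mem_null f g h i hi r
  subsingleton k hk x := subsingleton_piSet (cycles_iterBar_le_null A k n hk) x

end SAb

/-! ### The main theorem -/

namespace BFSpectrum

/-- A representative in the product level is a pair of pointed simplices which `μ` adds entrywise,
so additivity of the class map on cycles suffices. -/
lemma eval_add_piLevel (A : Type u) [AddCommGroup A] (n : ℕ)
    (t : PSSet.piSet n ((HA A ⊗ HA A).level n).sset ((HA A ⊗ HA A).level n).pt) :
    (SAb.emStructure A n).equiv (Hom.piLevel (isAdditive_HA A).add n t) =
      (SAb.emStructure A n).equiv (Hom.piLevel (fst (HA A) (HA A)) n t) +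
        (SAb.emStructure A n).equiv (Hom.piLevel (snd (HA A) (HA A)) n t) := by
  obtain ⟨f⟩ := t
  exact map_add (SAb.piIdent A n).cls
    (SAb.cyc (PSSet.ptSimplexMap (Hom.map (fst (HA A) (HA A)) n).map (Hom.map (fst (HA A) (HA A)) n).map_pt f))
    (SAb.cyc (PSSet.ptSimplexMap (Hom.map (snd (HA A) (HA A)) n).map (Hom.map (snd (HA A) (HA A)) n).map_pt f))

lemma fibrant_HA (A : Type u) [AddCommGroup A] : (HA A).Fibrant :=
  ⟨levelFibrant_HA A, (isPiOmega_HA A).isOmega⟩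

lemma levelFibrant_shiftHA (A : Type u) [AddCommGroup A] (m : ℕ) : (shiftHA A m).LevelFibrant :=
  fun n => levelFibrant_HA A (m + n)

lemma isPiOmega_shiftHA (A : Type u) [AddCommGroup A] (m : ℕ) : (shiftHA A m).IsPiOmega :=
  fun n => isPiOmega_HA A (m + n)

lemma cofibrant_shiftHA (A : Type u) [AddCommGroup A] (m : ℕ) : (shiftHA A m).Cofibrant :=
  fun n => cofibrant_HA A (m + n)

end BFSpectrum

theorem mainTheorem10 :
    -- the Eilenberg--MacLane spectrum `HA`
    (∀ (A : Type u) [AddCommGroup A],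
      (HA A).Fibrant ∧ (HA A).Cofibrant ∧
      ∃ _ : CommGrpObj (HA A),
        -- the addition of `HA` is, in each level and degree, the addition induced by that of `A`
        (∀ (n : ℕ) (k : SimplexCategoryᵒᵖ) (z : ((HA A ⊗ HA A).level n).sset.obj k),
          BFSpectrum.Hom.eval μ[HA A] z =
            BFSpectrum.Hom.eval (fst (HA A) (HA A)) z +
              BFSpectrum.Hom.eval (snd (HA A) (HA A)) z) ∧
        -- the `n`-th level is a `K(A, n)`, and the addition of `HA` induces the addition of `A`
        (∃ e : ∀ n : ℕ, EMStructure A n ((HA A).level n),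
          ∀ (n : ℕ) (t : PSSet.piSet n ((HA A ⊗ HA A).level n).sset ((HA A ⊗ HA A).level n).pt),
            (e n).equiv (BFSpectrum.Hom.piLevel μ[HA A] n t) =
              (e n).equiv (BFSpectrum.Hom.piLevel (fst (HA A) (HA A)) n t) +
                (e n).equiv (BFSpectrum.Hom.piLevel (snd (HA A) (HA A)) n t)) ∧
        -- if `A` is an `𝔽_p`-vector space, then so is `HA`, compatibly in level `0`
        (∀ (p : ℕ) [Fact p.Prime] [Module (ZMod p) A],
          ∃ M : ModuleObj (ZMod p) (HA A),
            ∀ (c : ZMod p) (k : SimplexCategoryᵒᵖ) (a : A),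
              BFSpectrum.Hom.eval (n := 0) (k := k) (M.smul c) a = c • a)) ∧
    -- the shifts of `HA`
    (∀ (A : Type u) [AddCommGroup A] (m : ℕ),
      (shiftHA A m).IsOmega ∧ (shiftHA A m).Fibrant ∧ (shiftHA A m).Cofibrant ∧
      (∀ n : ℕ, Nonempty (EMStructure A (m + n) ((shiftHA A m).level n))) ∧
      ∃ _ : CommGrpObj (shiftHA A m),
        ∀ (n : ℕ) (k : SimplexCategoryᵒᵖ)
          (z : ((shiftHA A m ⊗ shiftHA A m).level n).sset.obj k),
          BFSpectrum.Hom.eval μ[shiftHA A m] z =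
            BFSpectrum.Hom.eval (fst (shiftHA A m) (shiftHA A m)) z +
              BFSpectrum.Hom.eval (snd (shiftHA A m) (shiftHA A m)) z) ∧
    -- finite products of shifts
    (∀ (r : ℕ) (A : Fin r → Type u) [∀ i, AddCommGroup (A i)] (m : Fin r → ℕ),
      (∏ᶜ fun i => shiftHA (A i) (m i)).Fibrant ∧
      (∏ᶜ fun i => shiftHA (A i) (m i)).Cofibrant ∧
      ∃ _ : CommGrpObj (∏ᶜ fun i => shiftHA (A i) (m i)),
        ∀ (i : Fin r) (n : ℕ) (k : SimplexCategoryᵒᵖ)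
          (z : (((∏ᶜ fun i => shiftHA (A i) (m i)) ⊗
            (∏ᶜ fun i => shiftHA (A i) (m i))).level n).sset.obj k),
          BFSpectrum.Hom.eval (μ[∏ᶜ fun i => shiftHA (A i) (m i)] ≫ Pi.π _ i) z =
            BFSpectrum.Hom.eval (fst _ _ ≫ Pi.π (fun i => shiftHA (A i) (m i)) i) z +
              BFSpectrum.Hom.eval (snd _ _ ≫ Pi.π (fun i => shiftHA (A i) (m i)) i) z) := by
  refine ⟨fun A _ => ⟨BFSpectrum.fibrant_HA A, BFSpectrum.cofibrant_HA A, (BFSpectrum.isAdditive_HA A).commGrpObj,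
      fun n k z => rfl, ⟨SAb.emStructure A, BFSpectrum.eval_add_piLevel A⟩, fun p _ _ =>
        ⟨BFSpectrum.moduleObj A p, fun c k a => ?_⟩⟩,
    fun A _ m => ⟨(BFSpectrum.isPiOmega_shiftHA A m).isOmega,
      ⟨BFSpectrum.levelFibrant_shiftHA A m, (BFSpectrum.isPiOmega_shiftHA A m).isOmega⟩,
      BFSpectrum.cofibrant_shiftHA A m, fun n => ⟨SAb.emStructure A (m + n)⟩,
      (BFSpectrum.isAdditive_shiftHA A m).commGrpObj, fun n k z => rfl⟩,
    fun r A _ m => ?_⟩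
  · change c.val • a = c • a
    rw [← Nat.cast_smul_eq_nsmul (ZMod p), ZMod.natCast_zmod_val]
  · have hp := BFSpectrum.isLevelProd_piπ fun i => shiftHA (A i) (m i)
    -- The simplices of the categorical product receive the group structure transported from the
    -- factors, which makes the projections additive.
    let := hp.addCommGroup
    refine ⟨⟨hp.levelFibrant fun i => BFSpectrum.levelFibrant_shiftHA _ _,
      (hp.isPiOmega fun i => BFSpectrum.isPiOmega_shiftHA _ _).isOmega⟩,
      hp.cofibrant fun i => BFSpectrum.cofibrant_shiftHA _ _,
      (hp.isAdditive fun i => BFSpectrum.isAdditive_shiftHA _ _).commGrpObj, fun i n k z => ?_⟩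
    exact hp.eval_add i (BFSpectrum.Hom.eval (fst _ _) z) (BFSpectrum.Hom.eval (snd _ _) z)
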